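/- Let $n\ge 1$, and let $(X,\Gamma_X)$ be either a bounded complete Reinhardt domain in $\mathbb C^n$ centred at the origin with $C^2$ boundary and $\Gamma_X=\partial X$, or the polydisc $X=\mathbb D^n$ with $\Gamma_X=\mathbb T^n$. Let $G$ be a finite subgroup of the unitary group $U(n)$ that preserves $X$ and $\Gamma_X$, let $\Omega\subset\mathbb C^n$ be a bounded domain, and let $\Phi:X\to\Omega$ be a proper surjective holomorphic map whose fibers are exactly the $G$-orbits (so that $\Omega\cong X/G$) and which extends smoothly to $\overline X$. Put $\Gamma_\Omega=\Phi(\Gamma_X)$, let $\sigma$ and $m$ be the induced Lebesgue measures of dimension $\dim_{\mathbb R}\Gamma_X$ on $\Gamma_X$ and $\Gamma_\Omega$, and assume that for $\sigma$-almost every $\zeta\in\Gamma_X$ the set $\{\zeta'\in\Gamma_X:\Phi(\zeta')=\Phi(\zeta)\}$ is the orbit $G\zeta$. Let $w\ge 0$ be a $G$-invariant measurable function on $\Gamma_X$ with $$\frac1{|G|}\int_{\Phi^{-1}(E)\cap\Gamma_X}w\,d\sigma=m(E)\quad\text{for all Borel }E\subset\Gamma_\Omega .$$ For a function $F$ on $X$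 write $F^*(\zeta)=\lim_{r\to1^-}F(r\zeta)$. Assume that the quadruple $(X,\Omega,\Phi,G)$ is admissible: there is a $G$-invariant holomorphic function $g$ on $X$ without zeros such that $g^*$ exists and $|g^*|^2=w$ $\sigma$-almost everywhere on $\Gamma_X$; fix such a $g$. Let $H^2(X)$ be the space of holomorphic functions $F$ on $X$ with $\sup_{0<r<1}\int_{\Gamma_X}|F(r\zeta)|^2d\sigma(\zeta)<\infty$, identified through $F\mapsto F^*$ with a subspace of $L^2(\Gamma_X,\sigma)$. Let $H^2(\Omega)$ be the space of holomorphic functions $f$ on $\Omega$ with $\frac1{|G|}\sup_{0<r<1}\int_{\Gamma_X}|f(\Phi(r\zeta))|^2|g(r\zeta)|^2d\sigma(\zeta)<\infty$, identified through $f\mapsto f^*$, where $f^*(\Phi(\xi))=\lim_{r\to1^-}f(\Phi(r\xi))$ for $\xi\in\Gamma_X$, with a subspace of $L^2(\Gamma_\Omega,m)$. Then the orthogonal projections (Szegő projections) $S_X:L^2(\Gamma_X,\sigma)\to H^2(X)$ and $S_\Omega:L^2(\Gamma_\Omega,m)\to H^2(\Omega)$ exist. Moreover the Szegő kernel $K_X(z,\zeta)$,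 $z\in X$, $\zeta\in\Gamma_X$, exists, that is, $\overline{K_X(z,\cdot)}\in H^2(X)$ and $F(z)=\int_{\Gamma_X}K_X(z,\zeta)F^*(\zeta)\,d\sigma(\zeta)$ for all $z\in X$ and $F\in H^2(X)$. For every $f\in L^2(\Gamma_\Omega,m)$ the holomorphic function $S_\Omega f$ on $\Omega$ is given by $$S_\Omega f=\frac1{|G|}\,\Phi_*\!\left(z\mapsto\int_{\Gamma_X}\frac{K_X(z,\zeta)}{g(z)\,\overline{g^*(\zeta)}}\,f(\Phi(\zeta))\,w(\zeta)\,d\sigma(\zeta)\right),$$ where the integral converges absolutely for every $z\in X$ and $\Phi_*h(\Phi(z))=\sum_{\tau\in G}h(\tau z)$ is the push-forward of a function $h$ on $X$ (the sum over the fiber, with multiplicity). Equivalently, $g^*\cdot(f\circ\Phi)\in L^2(\Gamma_X,\sigma)$ and $$S_\Omega f=\frac1{|G|}\,\Phi_*\!\left(\frac{S_X\big(g^*\cdot(f\circ\Phi)\big)}{g}\right).$$ -/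

import Mathlib

open Set Filter Topology MeasureTheory
open scoped ENNReal ContDiff ComplexConjugate

noncomputable section

/-- The open unit polydisc in `ℂⁿ`. -/
def polydisc (n : ℕ) : Set (EuclideanSpace ℂ (Fin n)) := {z | ∀ j, ‖z j‖ < 1}

/-- The unit torus, that is, the distinguished boundary of the polydisc. -/
def unitTorus (n : ℕ) : Set (EuclideanSpace ℂ (Fin n)) := {z | ∀ j, ‖z j‖ = 1}

/-- A complete Reinhardt set centred at the origin. -/
def IsCompleteReinhardt {n : ℕ} (X : Set (EuclideanSpace ℂ (Fin n))) : Prop :=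
  ∀ a ∈ X, ∀ z : EuclideanSpace ℂ (Fin n), (∀ j, ‖z j‖ ≤ ‖a j‖) → z ∈ X

/-- `X` has `C²` boundary: locally `X` is a sublevel set of a `C²` function with non-vanishing
differential. -/
def HasC2Boundary {n : ℕ} (X : Set (EuclideanSpace ℂ (Fin n))) : Prop :=
  ∀ p ∈ frontier X, ∃ (U : Set (EuclideanSpace ℂ (Fin n))) (ρ : EuclideanSpace ℂ (Fin n) → ℝ),
    IsOpen U ∧ p ∈ U ∧ ContDiffOn ℝ 2 ρ U ∧ fderiv ℝ ρ p ≠ 0 ∧ X ∩ U = {z | z ∈ U ∧ ρ z < 0}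

/-- The model domains `X`, with the part `Γ` of the boundary that carries the Hardy space and the
real dimension of `Γ`: a bounded complete Reinhardt domain with `C²` boundary and `Γ = ∂X`, or the
polydisc with `Γ` the torus. -/
inductive IsModelDomain {n : ℕ} :
    Set (EuclideanSpace ℂ (Fin n)) → Set (EuclideanSpace ℂ (Fin n)) → ℕ → Prop
  | reinhardt (X : Set (EuclideanSpace ℂ (Fin n))) (isOpen : IsOpen X) (nonempty : X.Nonempty)
      (bounded : Bornology.IsBounded X) (complete : IsCompleteReinhardt X)
      (boundary : HasC2Boundary X) : IsModelDomain X (frontier X) (2 * n - 1)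
  | polydisc : IsModelDomain (polydisc n) (unitTorus n) n

/-- A model domain with its boundary part. -/
structure ModelDomain (n : ℕ) where
  X : Set (EuclideanSpace ℂ (Fin n))
  Γ : Set (EuclideanSpace ℂ (Fin n))
  dim : ℕ
  isModel : IsModelDomain X Γ dim

/-- The radial limit `lim_{r → 1⁻} F (r ζ)`. -/
def radialLimit {n : ℕ} (F : EuclideanSpace ℂ (Fin n) → ℂ) (ζ : EuclideanSpace ℂ (Fin n)) : ℂ :=
  limUnder (𝓝[<] (1 : ℝ)) fun r => F (r • ζ)

namespace ModelDomain

variable {n : ℕ} (D : ModelDomain n)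

/-- The induced Lebesgue (surface) measure on `Γ`. -/
def σ : Measure (EuclideanSpace ℂ (Fin n)) := (Measure.euclideanHausdorffMeasure D.dim).restrict D.Γ

theorem isClosed_Γ : IsClosed D.Γ := by
  obtain ⟨X, Γ, d, h⟩ := D
  cases h with
  | reinhardt => exact isClosed_frontier
  | polydisc =>
    simp only [unitTorus, Set.ofPred_forall]
    exact isClosed_iInter fun j => isClosed_eq (by fun_prop) continuous_const

theorem smul_mem {r : ℝ} (hr : r ∈ Ioo (0 : ℝ) 1) {ζ : EuclideanSpace ℂ (Fin n)} (hζ : ζ ∈ D.Γ) :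
    r • ζ ∈ D.X := by
  obtain ⟨X, Γ, d, h⟩ := D
  cases h with
  | reinhardt _ _ _ _ hX _ =>
    have hcl : ζ ∈ closure X := frontier_subset_closure hζ
    set V : Set (EuclideanSpace ℂ (Fin n)) := {a | ∀ j, ζ j = 0 ∨ r * ‖ζ j‖ < ‖a j‖} with hV
    have hVo : IsOpen V := by
      simp only [hV, Set.ofPred_forall]
      refine isOpen_iInter_of_finite fun j => ?_
      by_cases h0 : ζ j = 0
      · simp [h0]
      · simp only [h0, false_or]
        exact isOpen_lt continuous_const (by fun_prop)
    have hζV : ζ ∈ V := by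
      intro j
      by_cases h0 : ζ j = 0
      · exact Or.inl h0
      · refine Or.inr ?_
        have : 0 < ‖ζ j‖ := norm_pos_iff.mpr h0
        nlinarith [hr.2]
    obtain ⟨a, haV, haX⟩ := mem_closure_iff.mp hcl V hVo hζV
    refine hX a haX _ fun j => ?_
    rw [PiLp.smul_apply, norm_smul, Real.norm_of_nonneg hr.1.le]
    rcases haV j with h0 | h0
    · simp [h0]
    · exact h0.le
  | polydisc =>
    intro j
    rw [PiLp.smul_apply, norm_smul, Real.norm_of_nonneg hr.1.le, hζ j, mul_one]
    exact hr.2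

theorem measurable_dilate {F : EuclideanSpace ℂ (Fin n) → ℂ} (hF : ContinuousOn F D.X) {r : ℝ}
    (hr : r ∈ Ioo (0 : ℝ) 1) : AEMeasurable (fun ζ => F (r • ζ)) D.σ :=
  ContinuousOn.aemeasurable
    (hF.comp (continuous_const_smul r).continuousOn fun _ hζ => D.smul_mem hr hζ)
    D.isClosed_Γ.measurableSet

/-- `sup_{0 < r < 1} ∫_Γ |F (r ζ)|² dσ(ζ)`. -/
def hardyNormSq (F : EuclideanSpace ℂ (Fin n) → ℂ) : ℝ≥0∞ :=
  ⨆ r ∈ Ioo (0 : ℝ) 1, ∫⁻ ζ, ‖F (r • ζ)‖ₑ ^ 2 ∂D.σ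

theorem hardyNormSq_zero : D.hardyNormSq (fun _ => 0) = 0 := by simp [hardyNormSq]

theorem hardyNormSq_const_mul_lt_top (c : ℂ) {F : EuclideanSpace ℂ (Fin n) → ℂ}
    (h : D.hardyNormSq F < ⊤) : D.hardyNormSq (fun z => c * F z) < ⊤ := by
  refine lt_of_le_of_lt (b := ‖c‖ₑ ^ 2 * D.hardyNormSq F) ?_
    (ENNReal.mul_lt_top (by simp) h)
  refine iSup₂_le fun r hr => ?_
  simp only [enorm_mul, mul_pow]
  rw [lintegral_const_mul' _ _ (by simp)]
  gcongr
  exact le_iSup₂_of_le r hr le_rfl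

theorem hardyNormSq_add_lt_top {F H : EuclideanSpace ℂ (Fin n) → ℂ} (hFc : ContinuousOn F D.X)
    (hF : D.hardyNormSq F < ⊤) (hH : D.hardyNormSq H < ⊤) :
    D.hardyNormSq (fun z => F z + H z) < ⊤ := by
  refine lt_of_le_of_lt (b := 2 * D.hardyNormSq F + 2 * D.hardyNormSq H) ?_
    (ENNReal.add_lt_top.mpr
      ⟨ENNReal.mul_lt_top (by simp) hF, ENNReal.mul_lt_top (by simp) hH⟩)
  refine iSup₂_le fun r hr => ?_
  calc ∫⁻ ζ, ‖F (r • ζ) + H (r • ζ)‖ₑ ^ 2 ∂D.σ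
      ≤ ∫⁻ ζ, (2 * ‖F (r • ζ)‖ₑ ^ 2 + 2 * ‖H (r • ζ)‖ₑ ^ 2) ∂D.σ := by
        refine lintegral_mono fun ζ => ?_
        have h := ENNReal.rpow_add_le_mul_rpow_add_rpow ‖F (r • ζ)‖ₑ ‖H (r • ζ)‖ₑ
          (p := 2) (by norm_num)
        norm_num at h
        calc ‖F (r • ζ) + H (r • ζ)‖ₑ ^ 2
            ≤ (‖F (r • ζ)‖ₑ + ‖H (r • ζ)‖ₑ) ^ 2 := by gcongr; exact enorm_add_le _ _
          _ ≤ _ := by rw [← mul_add]; exact h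
    _ = 2 * ∫⁻ ζ, ‖F (r • ζ)‖ₑ ^ 2 ∂D.σ + 2 * ∫⁻ ζ, ‖H (r • ζ)‖ₑ ^ 2 ∂D.σ := by
        rw [lintegral_add_left', lintegral_const_mul' _ _ (by simp),
          lintegral_const_mul' _ _ (by simp)]
        exact (((D.measurable_dilate hFc hr).enorm).pow_const 2).const_mul 2
    _ ≤ _ := by
        gcongr
        · exact le_iSup₂_of_le (f := fun r _ => ∫⁻ ζ, ‖F (r • ζ)‖ₑ ^ 2 ∂D.σ) r hr le_rfl
        · exact le_iSup₂_of_le (f := fun r _ => ∫⁻ ζ, ‖H (r • ζ)‖ₑ ^ 2 ∂D.σ) r hr le_rfl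

/-- `F` belongs to the Hardy space `H²(X)` of holomorphic functions. -/
def MemHardy (F : EuclideanSpace ℂ (Fin n) → ℂ) : Prop :=
  DifferentiableOn ℂ F D.X ∧ D.hardyNormSq F < ⊤

/-- `F ∈ H²(X)` and `u ∈ L²(Γ)` is its boundary function `F*`. -/
def IsHardyExtension (u : Lp ℂ 2 D.σ) (F : EuclideanSpace ℂ (Fin n) → ℂ) : Prop :=
  D.MemHardy F ∧ ∀ᵐ ζ ∂D.σ, Tendsto (fun r : ℝ => F (r • ζ)) (𝓝[<] 1) (𝓝 (u ζ))

/-- `H²(X)`, identified with the space of its boundary functions in `L²(Γ)`. -/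
def hardySpace : Submodule ℂ (Lp ℂ 2 D.σ) where
  carrier := {u | ∃ F, D.IsHardyExtension u F}
  zero_mem' := by
    refine ⟨fun _ => 0, ⟨differentiableOn_const 0, by simp [hardyNormSq_zero]⟩, ?_⟩
    filter_upwards [Lp.coeFn_zero ℂ 2 D.σ] with ζ h
    change Tendsto _ _ (𝓝 ((0 : Lp ℂ 2 D.σ) ζ))
    rw [h]
    exact tendsto_const_nhds
  add_mem' := by
    rintro u v ⟨F, ⟨hF, hF'⟩, hu⟩ ⟨H, ⟨hH, hH'⟩, hv⟩
    refine ⟨fun z => F z + H z,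
      ⟨hF.add hH, D.hardyNormSq_add_lt_top hF.continuousOn hF' hH'⟩, ?_⟩
    filter_upwards [hu, hv, Lp.coeFn_add u v] with ζ h1 h2 h3
    rw [h3]
    exact h1.add h2
  smul_mem' := by
    rintro c u ⟨F, ⟨hF, hF'⟩, hu⟩
    refine ⟨fun z => c * F z, ⟨hF.const_mul c, D.hardyNormSq_const_mul_lt_top c hF'⟩, ?_⟩
    filter_upwards [hu, Lp.coeFn_smul c u] with ζ h1 h3
    rw [h3]
    exact h1.const_mul c

/-- `k` is the element of `H²(X)` that represents evaluation at `z`. -/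
def IsReproducing (z : EuclideanSpace ℂ (Fin n)) (k : Lp ℂ 2 D.σ) : Prop :=
  k ∈ D.hardySpace ∧ ∀ u F, D.IsHardyExtension u F → F z = inner ℂ k u

open Classical in
/-- The reproducing element of `H²(X)` at `z` (zero if there is none). -/
def reproducing (z : EuclideanSpace ℂ (Fin n)) : Lp ℂ 2 D.σ :=
  if h : ∃ k, D.IsReproducing z k then h.choose else 0

/-- The Szegő kernel `K_X(z, ζ)`, `z ∈ X`, `ζ ∈ Γ`: the kernel for which
`F z = ∫ K_X(z, ζ) F*(ζ) dσ(ζ)` on `H²(X)` and such that the conjugate of `K_X(z, ·)` is in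
`H²(X)`. -/
def szegoKernel (z ζ : EuclideanSpace ℂ (Fin n)) : ℂ := conj (D.reproducing z ζ)

/-- The Szegő projection of `X`: the orthogonal projection of `L²(Γ)` onto `H²(X)`. -/
def szegoProjection [D.hardySpace.HasOrthogonalProjection] : Lp ℂ 2 D.σ →L[ℂ] Lp ℂ 2 D.σ :=
  D.hardySpace.starProjection

end ModelDomain

/-- A quotient domain `Ω = X / G` of a model domain `X` by a finite subgroup `G` of the unitary
group, with the proper holomorphic quotient map `Φ : X → Ω`, smooth up to the boundary. -/
structure QuotientQuadruple (n : ℕ) extends ModelDomain n where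
  Ω : Set (EuclideanSpace ℂ (Fin n))
  Φ : EuclideanSpace ℂ (Fin n) → EuclideanSpace ℂ (Fin n)
  G : Subgroup (EuclideanSpace ℂ (Fin n) ≃ₗᵢ[ℂ] EuclideanSpace ℂ (Fin n))
  isOpen_Ω : IsOpen Ω
  isConnected_Ω : IsConnected Ω
  isBounded_Ω : Bornology.IsBounded Ω
  holomorphic : DifferentiableOn ℂ Φ X
  smooth : ContDiffOn ℝ ∞ Φ (closure X)
  proper : ∀ K ⊆ Ω, IsCompact K → IsCompact (X ∩ Φ ⁻¹' K)
  finite_G : Finite G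
  maps_X : ∀ τ ∈ G, MapsTo τ X X
  maps_Γ : ∀ τ ∈ G, MapsTo τ Γ Γ
  image_eq : Φ '' X = Ω
  fiber : ∀ z ∈ X, ∀ z' ∈ X, Φ z' = Φ z ↔ ∃ τ ∈ G, τ z = z'
  /-- Over almost every boundary point the fiber of `Φ` in `Γ` is a single orbit. -/
  fiber_boundary : ∀ᵐ ζ ∂toModelDomain.σ, ∀ ζ' ∈ Γ, Φ ζ' = Φ ζ → ∃ τ ∈ G, τ ζ = ζ'

namespace QuotientQuadruple

variable {n : ℕ} (Q : QuotientQuadruple n)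

/-- The induced boundary `Γ_Ω = Φ(Γ)`. -/
def ΓΩ : Set (EuclideanSpace ℂ (Fin n)) := Q.Φ '' Q.Γ

/-- The induced Lebesgue measure on `Γ_Ω`. -/
def m : Measure (EuclideanSpace ℂ (Fin n)) :=
  (Measure.euclideanHausdorffMeasure Q.dim).restrict Q.ΓΩ

/-- `w` is a `G`-invariant density, with respect to `σ`, of the pullback under `Φ` of the induced
Lebesgue measure on `Γ_Ω`. -/
structure IsPullbackDensity (w : EuclideanSpace ℂ (Fin n) → ℝ) : Prop where
  aemeasurable : AEMeasurable w Q.σ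
  nonneg : ∀ ζ ∈ Q.Γ, 0 ≤ w ζ
  invariant : ∀ τ ∈ Q.G, ∀ ζ ∈ Q.Γ, w (τ ζ) = w ζ
  change : ∀ E ⊆ Q.ΓΩ, MeasurableSet E →
    (Nat.card Q.G : ℝ≥0∞)⁻¹ *
      ∫⁻ ζ in Q.Γ ∩ Q.Φ ⁻¹' E, ENNReal.ofReal (w ζ) ∂Measure.euclideanHausdorffMeasure Q.dim =
      Measure.euclideanHausdorffMeasure Q.dim E

/-- `g` is a zero-free `G`-invariant holomorphic function on `X` whose boundary function exists
almost everywhere and satisfies `|g*|² = w`. -/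
structure IsAdmissible (w : EuclideanSpace ℂ (Fin n) → ℝ) (g : EuclideanSpace ℂ (Fin n) → ℂ) :
    Prop where
  holomorphic : DifferentiableOn ℂ g Q.X
  ne_zero : ∀ z ∈ Q.X, g z ≠ 0
  invariant : ∀ τ ∈ Q.G, ∀ z ∈ Q.X, g (τ z) = g z
  boundary : ∀ᵐ ζ ∂Q.σ,
    Tendsto (fun r : ℝ => g (r • ζ)) (𝓝[<] 1) (𝓝 (radialLimit g ζ)) ∧ ‖radialLimit g ζ‖ ^ 2 = w ζ

theorem mapsTo : MapsTo Q.Φ Q.X Q.Ω := fun _ hz => Q.image_eq ▸ mem_image_of_mem _ hz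

theorem card_inv_ne_top : (Nat.card Q.G : ℝ≥0∞)⁻¹ ≠ ⊤ := by
  have := Q.finite_G
  simp [Nat.card_pos.ne']

theorem card_inv_ne_zero : (Nat.card Q.G : ℝ≥0∞)⁻¹ ≠ 0 := by simp

/-- `(1 / |G|) sup_{0 < r < 1} ∫_Γ |f (Φ (r ζ))|² |g (r ζ)|² dσ(ζ)`. -/
def hardyNormSqΩ (g f : EuclideanSpace ℂ (Fin n) → ℂ) : ℝ≥0∞ :=
  (Nat.card Q.G : ℝ≥0∞)⁻¹ *
    ⨆ r ∈ Ioo (0 : ℝ) 1, ∫⁻ ζ, ‖f (Q.Φ (r • ζ))‖ₑ ^ 2 * ‖g (r • ζ)‖ₑ ^ 2 ∂Q.σ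

theorem hardyNormSqΩ_lt_top_iff (g f : EuclideanSpace ℂ (Fin n) → ℂ) :
    Q.hardyNormSqΩ g f < ⊤ ↔ Q.hardyNormSq (fun z => f (Q.Φ z) * g z) < ⊤ := by
  have h : Q.hardyNormSqΩ g f =
      (Nat.card Q.G : ℝ≥0∞)⁻¹ * Q.hardyNormSq (fun z => f (Q.Φ z) * g z) := by
    simp only [hardyNormSqΩ, ModelDomain.hardyNormSq, enorm_mul, mul_pow]
  rw [h]
  refine ⟨fun h1 => ?_, fun h1 => ENNReal.mul_lt_top Q.card_inv_ne_top.lt_top h1⟩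
  by_contra h2
  rw [not_lt, top_le_iff] at h2
  rw [h2, ENNReal.mul_top Q.card_inv_ne_zero] at h1
  exact lt_irrefl _ h1

/-- `f` belongs to the Hardy space `H²(Ω)` of holomorphic functions. -/
def MemHardyΩ (g f : EuclideanSpace ℂ (Fin n) → ℂ) : Prop :=
  DifferentiableOn ℂ f Q.Ω ∧ Q.hardyNormSqΩ g f < ⊤

/-- `f ∈ H²(Ω)` and `u ∈ L²(Γ_Ω)` is its boundary function, `f*(Φ ξ) = lim_{r → 1⁻} f (Φ (r ξ))`. -/
def IsHardyExtensionΩ (g : EuclideanSpace ℂ (Fin n) → ℂ) (u : Lp ℂ 2 Q.m)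
    (f : EuclideanSpace ℂ (Fin n) → ℂ) : Prop :=
  Q.MemHardyΩ g f ∧ ∀ᵐ η ∂Q.m, ∀ ξ ∈ Q.Γ, Q.Φ ξ = η →
    Tendsto (fun r : ℝ => f (Q.Φ (r • ξ))) (𝓝[<] 1) (𝓝 (u η))

/-- `H²(Ω)`, identified with the space of its boundary functions in `L²(Γ_Ω)`. -/
def hardySpaceΩ {w : EuclideanSpace ℂ (Fin n) → ℝ} {g : EuclideanSpace ℂ (Fin n) → ℂ}
    (hg : Q.IsAdmissible w g) : Submodule ℂ (Lp ℂ 2 Q.m) where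
  carrier := {u | ∃ f, Q.IsHardyExtensionΩ g u f}
  zero_mem' := by
    refine ⟨fun _ => 0, ⟨differentiableOn_const 0, by simp [hardyNormSqΩ]⟩, ?_⟩
    filter_upwards [Lp.coeFn_zero ℂ 2 Q.m] with η h ξ _ _
    change Tendsto _ _ (𝓝 ((0 : Lp ℂ 2 Q.m) η))
    rw [h]
    exact tendsto_const_nhds
  add_mem' := by
    rintro u v ⟨F, ⟨hF, hF'⟩, hu⟩ ⟨H, ⟨hH, hH'⟩, hv⟩
    refine ⟨fun z => F z + H z, ⟨hF.add hH, ?_⟩, ?_⟩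
    · rw [hardyNormSqΩ_lt_top_iff] at hF' hH' ⊢
      simp only [add_mul]
      exact Q.hardyNormSq_add_lt_top ((hF.continuousOn.comp Q.holomorphic.continuousOn
        Q.mapsTo).mul hg.holomorphic.continuousOn) hF' hH'
    · filter_upwards [hu, hv, Lp.coeFn_add u v] with η h1 h2 h3 ξ hξ hη
      rw [h3]
      exact (h1 ξ hξ hη).add (h2 ξ hξ hη)
  smul_mem' := by
    rintro c u ⟨F, ⟨hF, hF'⟩, hu⟩
    refine ⟨fun z => c * F z, ⟨hF.const_mul c, ?_⟩, ?_⟩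
    · rw [hardyNormSqΩ_lt_top_iff] at hF' ⊢
      simp only [mul_assoc]
      exact Q.hardyNormSq_const_mul_lt_top c hF'
    · filter_upwards [hu, Lp.coeFn_smul c u] with η h1 h3 ξ hξ hη
      rw [h3]
      exact (h1 ξ hξ hη).const_mul c

/-- The Szegő projection of `Ω`: the orthogonal projection of `L²(Γ_Ω)` onto `H²(Ω)`. -/
def szegoProjectionΩ {w : EuclideanSpace ℂ (Fin n) → ℝ} {g : EuclideanSpace ℂ (Fin n) → ℂ}
    (hg : Q.IsAdmissible w g) [(Q.hardySpaceΩ hg).HasOrthogonalProjection] :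
    Lp ℂ 2 Q.m →L[ℂ] Lp ℂ 2 Q.m :=
  (Q.hardySpaceΩ hg).starProjection

/-- The push-forward `Φ_* h` of a function `h` on `X`: the sum of `h` over the fiber of `Φ`, with
multiplicities, that is, the sum over the `G`-orbit of a preimage. -/
def pushforward (h : EuclideanSpace ℂ (Fin n) → ℂ) (y : EuclideanSpace ℂ (Fin n)) : ℂ :=
  ∑ᶠ τ : Q.G, h (τ.1 (Function.invFunOn Q.Φ Q.X y))

/-- The push-forward does not depend on the choice of the preimage. -/
theorem pushforward_apply (h : EuclideanSpace ℂ (Fin n) → ℂ) {z : EuclideanSpace ℂ (Fin n)}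
    (hz : z ∈ Q.X) : Q.pushforward h (Q.Φ z) = ∑ᶠ τ : Q.G, h (τ.1 z) := by
  have hex : ∃ a ∈ Q.X, Q.Φ a = Q.Φ z := ⟨z, hz, rfl⟩
  obtain ⟨τ₀, hτ₀, he⟩ := (Q.fiber z hz _ (Function.invFunOn_mem hex)).mp
    (Function.invFunOn_eq hex)
  unfold pushforward
  rw [← he]
  exact finsum_eq_of_bijective (fun τ : Q.G => τ * ⟨τ₀, hτ₀⟩)
    (Group.mulRight_bijective _) fun τ => rfl

end QuotientQuadruple

end

/-! The proof rests on the lift $u\mapsto g^*\cdot(u\circ\Phi)$ from $L^2(\Gamma_\Omega)$ to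
$L^2(\Gamma_X)$. Since $|g^*|^2=w$ and $w/|G|$ is the density of the pulled-back measure, the lift
multiplies inner products by $|G|$ (`inner_lift`). Its range consists of the $G$-invariant elements
(`translate_lift`, `exists_lift_eq`), and $u\in H^2(\Omega)$ exactly when its lift is in $H^2(X)$
(`hardySpaceΩ_eq_comap`). The group acts on $L^2(\Gamma_X)$ by isometries that preserve $H^2(X)$, so
$S_X$ commutes with it. Hence $S_X$ of the lift of $f$ is invariant, so it is the lift of some $v\in
H^2(\Omega)$, and the inner product identity shows that $f-v\perp H^2(\Omega)$. Thus $v=S_\Omega f$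
(`lift_szegoProjectionΩ`). Inside $X$ this says that $g\cdot(S_\Omega f\circ\Phi)$ is the
holomorphic extension of $S_X$ of the lift. After division by $g$ the function is constant on
orbits, and $|G|^{-1}\Phi_*$ recovers $S_\Omega f$. The kernel formula is the reproducing property
together with $w=g^*\overline{g^*}$.

Three analytic facts carry this argument.

Hardy theory on $X$. The phase rotations $\zeta\mapsto e^{i\theta}\zeta$ preserve $\sigma$, so
integrals over $\Gamma_X$ are averages of integrals over circles, and Fatou's theorem in the disc
gives radial limits almost everywhere and the equality of the Hardy norm with the $L^2$ norm of the
boundary function (`IsHardyExtension.hardyNormSq_eq`). Point evaluations are bounded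
(`exists_enorm_sq_le`) by applying the estimate for the disc to one coordinate at a time. Hence
$H^2(X)$ is closed and has a reproducing kernel.

Null sets. Statements that hold almost everywhere pass between $\Gamma_X$ and $\Gamma_\Omega$ only
because $w>0$ almost everywhere (`IsPullbackDensity.ae_pos`). The Jacobian of $\Phi$ extends
continuously to the boundary and, by a boundary uniqueness theorem, is nonzero almost everywhere
there. Where it is nonzero $\Phi$ is antilipschitz at the point, so a set with null image is null,
and the image of $\{w=0\}$, after removal of an invariant null set, is null.

Descent. A function on $\Omega$ with holomorphic pullback is holomorphic
(`differentiableOn_of_comp_Φ`). It is continuous by properness and holomorphic off the critical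
values by the inverse function theorem. The critical values are zeros of $D(\Phi(z))=\prod_{\tau\in
G} J(\tau z)^4$. A quantitative inverse function theorem bounds $|J|^2$ by the distance to a
critical value, so that $D$ is itself holomorphic; a continuous function that is holomorphic off the
zeros of $D$ is holomorphic by a mean value formula on complex lines. -/

noncomputable section

/-! ### Holomorphic maps in several variables: Cauchy estimates and holomorphy of derivatives. -/

section SeveralVariables

open Metric

variable {E F : Type*} [NormedAddCommGroup E] [NormedSpace ℂ E] [NormedAddCommGroup F]
  [NormedSpace ℂ F]

/-- Cauchy's estimate for the derivative of a bounded holomorphic map. -/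
theorem norm_fderiv_le_of_norm_le_ball {f : E → F} {c : E} {R M : ℝ} (hR : 0 < R)
    (hd : DifferentiableOn ℂ f (ball c R)) (hM : ∀ z ∈ ball c R, ‖f z‖ ≤ M) :
    ‖fderiv ℂ f c‖ ≤ 2 * M / R := by
  refine Complex.norm_fderiv_le_div_of_mapsTo_ball hd (fun z hz => ?_) hR
  rw [mem_closedBall, dist_eq_norm]
  have := norm_sub_le (f z) (f c)
  linarith [hM z hz, hM c (mem_ball_self hR)]

/-- The second order Taylor estimate for a bounded holomorphic map. -/
theorem norm_sub_sub_fderiv_le_of_norm_le_ball {f : E → F} {c h : E} {R M : ℝ}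
    (hd : DifferentiableOn ℂ f (ball c R)) (hM : ∀ z ∈ ball c R, ‖f z‖ ≤ M) (hh : ‖h‖ < R) :
    ‖f (c + h) - f c - fderiv ℂ f c h‖ ≤ 4 * M * (‖h‖ / R) ^ 2 := by
  have hR : 0 < R := (norm_nonneg h).trans_lt hh
  have hb : DifferentiableAt ℂ f c := hd.differentiableAt (ball_mem_nhds c hR)
  -- The Schwarz lemma is applied to `k`, which differs from its value at `c` by a term of second
  -- order. The bound `4 * M` is `2 * M` for `f z - f c` plus `2 * M` for the linear part.
  set k : E → F := fun z => f z - fderiv ℂ f c (z - c) with hk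
  have hkc : k c = f c := by simp [hk]
  have h1 := Complex.dist_le_mul_div_pow_of_mapsTo_ball_of_isLittleO (f := k) (c := c)
    (z := c + h) (R₁ := R) (R₂ := 4 * M) (n := 1) ?_ ?_ ?_ ?_
  · rw [dist_eq_norm, hkc, dist_eq_norm, add_sub_cancel_left] at h1
    have h2 : f (c + h) - f c - fderiv ℂ f c h = k (c + h) - f c := by
      simp only [hk, add_sub_cancel_left]
      abel
    rw [h2]
    exact h1
  · exact hd.sub (((fderiv ℂ f c).differentiable.comp
      (differentiable_id.sub_const c)).differentiableOn)
  · intro z hz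
    rw [mem_closedBall, hkc, dist_eq_norm]
    have hz' : ‖z - c‖ < R := by rwa [← dist_eq_norm]
    have h2 : ‖fderiv ℂ f c (z - c)‖ ≤ 2 * M := by
      have hM0 : 0 ≤ M := (norm_nonneg _).trans (hM c (mem_ball_self hR))
      calc _ ≤ ‖fderiv ℂ f c‖ * ‖z - c‖ := (fderiv ℂ f c).le_opNorm _
        _ ≤ 2 * M / R * R := by
          gcongr
          exact norm_fderiv_le_of_norm_le_ball hR hd hM
        _ = 2 * M := by field_simp
    calc ‖k z - f c‖ ≤ ‖f z‖ + ‖fderiv ℂ f c (z - c)‖ + ‖f c‖ :=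
          (norm_sub_le _ _).trans (by gcongr; exact norm_sub_le _ _)
      _ ≤ _ := by linarith [hM z hz, hM c (mem_ball_self hR)]
  · have h3 := hb.hasFDerivAt.isLittleO
    simp only [pow_one]
    refine h3.norm_right.congr_left fun z => ?_
    simp only [hk, sub_self, map_zero, sub_zero]
    abel
  · simpa [mem_ball, dist_eq_norm] using hh

theorem DifferentiableOn.exists_norm_le_ball {f : E → F} {U : Set E} (hU : IsOpen U)
    (hf : DifferentiableOn ℂ f U) {x : E} (hx : x ∈ U) :
    ∃ r > 0, ball x r ⊆ U ∧ ∃ M, ∀ z ∈ ball x r, ‖f z‖ ≤ M := by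
  have hc : ContinuousAt f x := (hf.differentiableAt (hU.mem_nhds hx)).continuousAt
  have h1 : ∀ᶠ z in 𝓝 x, ‖f z‖ < ‖f x‖ + 1 :=
    hc.norm.eventually_lt continuousAt_const (by simp)
  obtain ⟨r, hr, hr'⟩ := Metric.mem_nhds_iff.mp (inter_mem h1 (hU.mem_nhds hx))
  exact ⟨r, hr, fun z hz => (hr' hz).2, ‖f x‖ + 1, fun z hz => (hr' hz).1.le⟩

/-- A uniform limit of holomorphic maps on a ball is holomorphic at the centre. -/
theorem differentiableAt_of_tendstoUniformlyOn_ball [CompleteSpace F] {f : ℕ → E → F} {g : E → F}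
    {x : E} {r : ℝ} (hr : 0 < r) (hf : ∀ k, DifferentiableOn ℂ (f k) (ball x r))
    (hlim : TendstoUniformlyOn f g atTop (ball x r)) : DifferentiableAt ℂ g x := by
  have hr2 : 0 < r / 2 := by positivity
  have hsub : ∀ y ∈ ball x (r / 2), ball y (r / 2) ⊆ ball x r := fun y hy =>
    ball_subset_ball' (by have := mem_ball.mp hy; linarith)
  have hC : UniformCauchySeqOn (fun k => fderiv ℂ (f k)) atTop (ball x (r / 2)) := by
    rw [Metric.uniformCauchySeqOn_iff]
    intro ε hε
    -- Cauchy's estimate on balls of radius `r / 2` turns the bound `ε * r / 8` for the difference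
    -- of two maps into `ε / 2` for that of their derivatives.
    obtain ⟨N, hN⟩ := Metric.uniformCauchySeqOn_iff.mp hlim.uniformCauchySeqOn (ε * r / 8)
      (by positivity)
    refine ⟨N, fun k hk l hl y hy => ?_⟩
    have hd : ∀ k, DifferentiableOn ℂ (f k) (ball y (r / 2)) := fun k => (hf k).mono (hsub y hy)
    have h1 := norm_fderiv_le_of_norm_le_ball (f := fun z => f k z - f l z) (M := ε * r / 8) hr2
      ((hd k).sub (hd l)) fun z hz => by
        rw [← dist_eq_norm]; exact (hN k hk l hl z (hsub y hy hz)).le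
    rw [fderiv_fun_sub ((hd k).differentiableAt (ball_mem_nhds y hr2))
      ((hd l).differentiableAt (ball_mem_nhds y hr2))] at h1
    rw [dist_eq_norm]
    refine h1.trans_lt ?_
    have : 2 * (ε * r / 8) / (r / 2) = ε / 2 := by field_simp; norm_num
    rw [this]
    linarith
  have hex : ∀ y ∈ ball x (r / 2), ∃ L, Tendsto (fun k => fderiv ℂ (f k) y) atTop (𝓝 L) :=
    fun y hy => cauchySeq_tendsto_of_complete (hC.cauchySeq hy)
  choose! g' hg' using hex
  have h1 := hC.tendstoUniformlyOn_of_tendsto hg'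
  have hsub' : ball x (r / 2) ⊆ ball x r := ball_subset_ball (by linarith)
  exact (hasFDerivAt_of_tendstoUniformlyOn isOpen_ball h1
    (fun k y hy => ((hf k).differentiableAt (isOpen_ball.mem_nhds (hsub' hy))).hasFDerivAt)
    (fun y hy => hlim.tendsto_at (hsub' hy)) (mem_ball_self hr2)).differentiableAt

/-- Directional derivatives of holomorphic maps are holomorphic. -/
theorem DifferentiableOn.fderiv_apply [CompleteSpace F] {f : E → F} {U : Set E} (hU : IsOpen U)
    (hf : DifferentiableOn ℂ f U) (v : E) : DifferentiableOn ℂ (fun z => fderiv ℂ f z v) U := by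
  intro x hx
  refine DifferentiableAt.differentiableWithinAt ?_
  obtain ⟨r, hr, hrU, M, hM⟩ := hf.exists_norm_le_ball hU hx
  have hr2 : 0 < r / 2 := by positivity
  have hM0 : 0 ≤ M := (norm_nonneg _).trans (hM x (mem_ball_self hr))
  -- The directional derivative is the limit of difference quotients with real steps `s k`, uniform
  -- by the second order Taylor estimate. The scaling keeps `s k * ‖v‖` below `r / 2`, so the
  -- shifted points stay in the larger ball.
  set s : ℕ → ℝ := fun k => r / 2 / (‖v‖ + 1) / (k + 1) with hs
  have hs0 : ∀ k, 0 < s k := fun k => by positivity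
  have hsv : ∀ k, s k * ‖v‖ < r / 2 := fun k => by
    have h1 : s k ≤ r / 2 / (‖v‖ + 1) := div_le_self (by positivity) (by linarith [k.cast_nonneg (α := ℝ)])
    calc s k * ‖v‖ ≤ r / 2 / (‖v‖ + 1) * ‖v‖ := by gcongr
      _ < r / 2 / (‖v‖ + 1) * (‖v‖ + 1) := by gcongr; linarith
      _ = r / 2 := by field_simp
  have hsub : ∀ y ∈ ball x (r / 2), ball y (r / 2) ⊆ ball x r := fun y hy =>
    ball_subset_ball' (by have := mem_ball.mp hy; linarith)
  have hslim : Tendsto s atTop (𝓝 0) := by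
    have := (tendsto_one_div_add_atTop_nhds_zero_nat (𝕜 := ℝ)).const_mul (r / 2 / (‖v‖ + 1))
    simpa [hs, div_eq_mul_inv] using this
  refine differentiableAt_of_tendstoUniformlyOn_ball hr2
    (f := fun k z => ((s k : ℂ))⁻¹ • (f (z + (s k : ℂ) • v) - f z)) (fun k => ?_) ?_
  · refine DifferentiableOn.const_smul (DifferentiableOn.sub ?_ (hf.mono ?_)) _
    · refine hf.comp (by fun_prop) fun z hz => hrU ?_
      refine hsub z hz ?_
      simpa [mem_ball, dist_eq_norm, norm_smul, abs_of_pos (hs0 k)] using hsv k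
    · exact (ball_subset_ball (by linarith)).trans hrU
  · rw [Metric.tendstoUniformlyOn_iff]
    intro ε hε
    have hlim2 : Tendsto (fun k => s k * (4 * M * (‖v‖ / (r / 2)) ^ 2)) atTop (𝓝 0) := by
      simpa using hslim.mul_const (4 * M * (‖v‖ / (r / 2)) ^ 2)
    filter_upwards [hlim2.eventually (gt_mem_nhds hε)] with k hk y hy
    have h1 := norm_sub_sub_fderiv_le_of_norm_le_ball (c := y) (h := (s k : ℂ) • v)
      ((hf.mono hrU).mono (hsub y hy)) (fun z hz => hM z (hsub y hy hz))
      (by simpa [norm_smul, abs_of_pos (hs0 k)] using hsv k)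
    have hne : (s k : ℂ) ≠ 0 := by exact_mod_cast (hs0 k).ne'
    rw [dist_comm, dist_eq_norm]
    have h2 : ((s k : ℂ))⁻¹ • (f (y + (s k : ℂ) • v) - f y) - fderiv ℂ f y v =
        ((s k : ℂ))⁻¹ • (f (y + (s k : ℂ) • v) - f y - fderiv ℂ f y ((s k : ℂ) • v)) := by
      rw [smul_sub _ (_ - _), map_smul, smul_smul, inv_mul_cancel₀ hne, one_smul]
    rw [h2, norm_smul]
    refine lt_of_le_of_lt ?_ hk
    have h3 : ‖((s k : ℂ))⁻¹‖ = (s k)⁻¹ := by simp [abs_of_pos (hs0 k)]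
    have h4 : ‖(s k : ℂ) • v‖ = s k * ‖v‖ := by simp [norm_smul, abs_of_pos (hs0 k)]
    rw [h3]
    rw [h4] at h1
    calc (s k)⁻¹ * _ ≤ (s k)⁻¹ * (4 * M * (s k * ‖v‖ / (r / 2)) ^ 2) := by
          gcongr
      _ = _ := by have := (hs0 k).ne'; field_simp

/-- In a basis the derivative is a finite sum of constant operators applied to directional
derivatives, which are already holomorphic. -/
theorem DifferentiableOn.fderiv_of_finiteDimensional [CompleteSpace F] [FiniteDimensional ℂ E]
    {f : E → F} {U : Set E} (hU : IsOpen U) (hf : DifferentiableOn ℂ f U) :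
    DifferentiableOn ℂ (fderiv ℂ f) U := by
  let b := Module.finBasis ℂ E
  let B : Fin (Module.finrank ℂ E) → F →L[ℂ] E →L[ℂ] F := fun i =>
    ContinuousLinearMap.smulRightL ℂ E F (b.coord i).toContinuousLinearMap
  have h1 : ∀ z, fderiv ℂ f z = ∑ i, B i (fderiv ℂ f z (b i)) := by
    intro z
    ext v
    have h2 : fderiv ℂ f z v = ∑ i, b.repr v i • fderiv ℂ f z (b i) := by
      conv_lhs => rw [← b.sum_repr v]
      simp only [map_sum, map_smul]
    rw [h2]
    simp [B]
  refine DifferentiableOn.congr ?_ fun z _ => h1 z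
  exact DifferentiableOn.fun_sum fun i _ =>
    (B i).differentiable.comp_differentiableOn (hf.fderiv_apply hU (b i))

/-- A holomorphic map is strictly differentiable. -/
theorem DifferentiableOn.hasStrictFDerivAt_of_finiteDimensional [CompleteSpace F]
    [FiniteDimensional ℂ E] {f : E → F} {U : Set E} (hU : IsOpen U) (hf : DifferentiableOn ℂ f U)
    {x : E} (hx : x ∈ U) : HasStrictFDerivAt f (fderiv ℂ f x) x :=
  hasStrictFDerivAt_of_hasFDerivAt_of_continuousAt
    (by filter_upwards [hU.mem_nhds hx] with y hy using
      (hf.differentiableAt (hU.mem_nhds hy)).hasFDerivAt)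
    ((hf.fderiv_of_finiteDimensional hU).differentiableAt (hU.mem_nhds hx)).continuousAt

/-- The Jacobian determinant of a holomorphic map. -/
def jacobian (f : E → E) (z : E) : ℂ := (fderiv ℂ f z).det

/-- By the Leibniz formula the determinant is a polynomial in the coordinates of the directional
derivatives. -/
theorem DifferentiableOn.jacobian [FiniteDimensional ℂ E] {f : E → E} {U : Set E}
    (hU : IsOpen U) (hf : DifferentiableOn ℂ f U) : DifferentiableOn ℂ (jacobian f) U := by
  have : CompleteSpace E := FiniteDimensional.complete ℂ E
  let b := Module.finBasis ℂ E
  have h1 : ∀ z, _root_.jacobian f z = ∑ σ : Equiv.Perm (Fin (Module.finrank ℂ E)),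
      ((Equiv.Perm.sign σ : ℤ) : ℂ) * ∏ i, b.repr (fderiv ℂ f z (b i)) (σ i) := by
    intro z
    rw [_root_.jacobian, ContinuousLinearMap.det, ← LinearMap.det_toMatrix b, Matrix.det_apply']
    simp [LinearMap.toMatrix_apply]
  refine DifferentiableOn.congr ?_ fun z _ => h1 z
  refine DifferentiableOn.fun_sum fun σ _ => DifferentiableOn.const_mul ?_ _
  have h2 : ∀ i, DifferentiableOn ℂ (fun z => b.repr (fderiv ℂ f z (b i)) (σ i)) U := fun i => ((b.coord (σ i)).toContinuousLinearMap.differentiable.comp_differentiableOn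
    (hf.fderiv_apply hU (b i)))
  exact fun x hx => (HasFDerivWithinAt.finsetProd (u := Finset.univ)
    fun i _ => (h2 i x hx).hasFDerivWithinAt).differentiableWithinAt.congr
      (fun y _ => by simp) (by simp)

end SeveralVariables

end

/-! ### Descent along a proper map: continuity and behaviour near critical values. -/

noncomputable section

section Descent

open Metric

/-- A map continuous on `X` and constant on the fibers of a proper map descends to a continuous
map. -/
theorem continuousOn_of_comp_proper {E F : Type*} [MetricSpace E] [MetricSpace F]
    {X Ω : Set E} {Φ : E → E} {f : E → F} (hΦ : ContinuousOn Φ X)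
    (hproper : ∀ K ⊆ Ω, IsCompact K → IsCompact (X ∩ Φ ⁻¹' K)) (himage : Φ '' X = Ω)
    (hf : ContinuousOn (fun z => f (Φ z)) X) : ContinuousOn f Ω := by
  rw [continuousOn_iff_continuous_domRestrict, continuous_iff_continuousAt]
  rintro ⟨y, hy⟩
  refine tendsto_of_subseq_tendsto fun u hu => ?_
  have hu' : Tendsto (fun k => (u k : E)) atTop (𝓝 y) :=
    (continuous_subtype_val.tendsto _).comp hu
  -- A convergent sequence with its limit is compact, so by properness its chosen preimages have a
  -- subsequence that converges in `X`, and the limit lies over `y`. Convergence along a subsequence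
  -- of every sequence suffices.
  have hK : IsCompact (insert y (range fun k => (u k : E))) := hu'.isCompact_insert_range
  have hKΩ : insert y (range fun k => (u k : E)) ⊆ Ω := by
    rintro _ (rfl | ⟨k, rfl⟩)
    · exact hy
    · exact (u k).2
  have hex : ∀ k, ∃ z ∈ X, Φ z = u k := fun k => himage.ge (u k).2
  choose z hzX hz using hex
  obtain ⟨a, ⟨haX, -⟩, φ, hφ, hlim⟩ := (hproper _ hKΩ hK).tendsto_subseq
    (x := z) fun k => ⟨hzX k, by rw [mem_preimage, hz]; exact Or.inr ⟨k, rfl⟩⟩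
  have hlim' : Tendsto (z ∘ φ) atTop (𝓝[X] a) :=
    tendsto_nhdsWithin_iff.mpr ⟨hlim, Eventually.of_forall fun k => hzX _⟩
  refine ⟨φ, ?_⟩
  have h1 := (hΦ a haX).tendsto.comp hlim'
  have h2 := (hf a haX).tendsto.comp hlim'
  have h3 : Φ a = y := by
    refine tendsto_nhds_unique h1 ?_
    have := hu'.comp hφ.tendsto_atTop
    refine this.congr fun k => ?_
    simp [hz]
  rw [h3] at h2
  refine h2.congr fun k => ?_
  simp [hz, Set.domRestrict]

variable {E : Type*} [NormedAddCommGroup E] [NormedSpace ℂ E] [FiniteDimensional ℂ E]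

/-- The adjugate of a linear endomorphism, depending continuously on the endomorphism. -/
theorem exists_continuous_adjugate (E : Type*) [NormedAddCommGroup E] [NormedSpace ℂ E]
    [FiniteDimensional ℂ E] : ∃ A : (E →L[ℂ] E) → (E →L[ℂ] E), Continuous A ∧
      ∀ (L : E →L[ℂ] E) (v : E), L (A L v) = L.det • v := by
  let b := Module.finBasis ℂ E
  let T : (E →L[ℂ] E) →ₗ[ℂ] Matrix (Fin (Module.finrank ℂ E)) (Fin (Module.finrank ℂ E)) ℂ :=
    (LinearMap.toMatrix b b).toLinearMap ∘ₗ ContinuousLinearMap.coeLM ℂ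
  let S : Matrix (Fin (Module.finrank ℂ E)) (Fin (Module.finrank ℂ E)) ℂ →ₗ[ℂ] (E →L[ℂ] E) :=
    LinearMap.toContinuousLinearMap.toLinearMap ∘ₗ (Matrix.toLin b b).toLinearMap
  refine ⟨fun L => S (T L).adjugate, ?_, fun L v => ?_⟩
  · exact S.continuous_of_finiteDimensional.comp
      (Continuous.matrix_adjugate T.continuous_of_finiteDimensional)
  · have h1 : L (S (T L).adjugate v) = Matrix.toLin b b (T L * (T L).adjugate) v := by
      rw [Matrix.toLin_mul b b b]
      simp [S, T]
    rw [h1, Matrix.mul_adjugate, map_smul, Matrix.toLin_one]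
    simp [T, ContinuousLinearMap.det]

variable {X Ω : Set E} {Φ : E → E}

/-- A quantitative form of the inverse function theorem: a critical value is at distance at least
of order `|J z|²` from `Φ z`. -/
theorem exists_norm_jacobian_sq_le (hX : IsOpen X) (hΦ : DifferentiableOn ℂ Φ X)
    (hcrit : ∀ x ∈ X, ∀ x' ∈ X, Φ x = Φ x' → jacobian Φ x = 0 → jacobian Φ x' = 0)
    {z₀ : E} (hz₀ : z₀ ∈ X) :
    ∃ U ∈ 𝓝 z₀, ∃ C > 0, ∀ z ∈ U, ∀ z' ∈ X, jacobian Φ z' = 0 →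
      ‖jacobian Φ z‖ ^ 2 ≤ C * ‖Φ z - Φ z'‖ := by
  have : CompleteSpace E := FiniteDimensional.complete ℂ E
  obtain ⟨A, hA, hAL⟩ := exists_continuous_adjugate E
  have hD := hΦ.fderiv_of_finiteDimensional hX
  have hJ := hΦ.jacobian hX
  obtain ⟨r₁, hr₁, hr₁X, M₁, hM₁⟩ :=
    (hD.fderiv_of_finiteDimensional hX).exists_norm_le_ball hX hz₀
  obtain ⟨r₂, hr₂, -, M₂, hM₂⟩ :=
    (hJ.fderiv_of_finiteDimensional hX).exists_norm_le_ball hX hz₀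
  obtain ⟨r₃, hr₃, -, M₃, hM₃⟩ := hJ.exists_norm_le_ball hX hz₀
  obtain ⟨B, hB, r₄, hr₄, hB4⟩ : ∃ B : ℝ, 1 ≤ B ∧ ∃ r > 0, ∀ z ∈ ball z₀ r,
      ‖A (fderiv ℂ Φ z)‖ ≤ B := by
    have hc : ContinuousAt (fun z => ‖A (fderiv ℂ Φ z)‖) z₀ :=
      (hA.continuousAt.comp (hD.differentiableAt (hX.mem_nhds hz₀)).continuousAt).norm
    have h1 := hc.eventually_lt (g := fun _ => ‖A (fderiv ℂ Φ z₀)‖ + 1) continuousAt_const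
      (by simp)
    obtain ⟨r, hr, hr'⟩ := Metric.mem_nhds_iff.mp h1
    exact ⟨‖A (fderiv ℂ Φ z₀)‖ + 1, by linarith [norm_nonneg (A (fderiv ℂ Φ z₀))], r, hr,
      fun z hz => (hr' hz).le⟩
  set r := min (min r₁ r₂) (min r₃ r₄) / 2 with hr
  have hr0 : 0 < r := by positivity
  have hrr₁ : 2 * r ≤ r₁ := by
    rw [hr]; linarith [(min_le_left (min r₁ r₂) (min r₃ r₄)).trans (min_le_left r₁ r₂)]
  have hrr₂ : 2 * r ≤ r₂ := by
    rw [hr]; linarith [(min_le_left (min r₁ r₂) (min r₃ r₄)).trans (min_le_right r₁ r₂)]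
  have hrr₃ : 2 * r ≤ r₃ := by
    rw [hr]; linarith [(min_le_right (min r₁ r₂) (min r₃ r₄)).trans (min_le_left r₃ r₄)]
  have hrr₄ : 2 * r ≤ r₄ := by
    rw [hr]; linarith [(min_le_right (min r₁ r₂) (min r₃ r₄)).trans (min_le_right r₃ r₄)]
  set M := max (max M₁ M₂) (max M₃ 1) with hM
  have hM1 : 1 ≤ M := (le_max_right M₃ 1).trans (le_max_right _ _)
  have hMM₁ : M₁ ≤ M := (le_max_left _ _).trans (le_max_left _ _)
  have hMM₂ : M₂ ≤ M := (le_max_right _ _).trans (le_max_left _ _)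
  have hMM₃ : M₃ ≤ M := (le_max_left _ _).trans (le_max_right _ _)
  have hb2X : ball z₀ (2 * r) ⊆ X := (ball_subset_ball hrr₁).trans hr₁X
  -- The inverse function theorem is used on the ball of radius `ρ = t * j` about `z`, where `j` is
  -- the modulus of the Jacobian. The first entry keeps this ball where the bounds `M` hold. The
  -- second makes `M * ρ` at most `j / (2 * B)`, hence the Jacobian nonzero on the ball and the
  -- linearization error at most half of `j / B`.
  set t := min (r / (2 * M)) (1 / (2 * B * M)) with ht
  have ht0 : 0 < t := by positivity
  have htr : t * M ≤ r / 2 := by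
    calc t * M ≤ r / (2 * M) * M := by gcongr; exact min_le_left _ _
      _ = r / 2 := by field_simp
  have htB : t * M ≤ 1 / (2 * B) := by
    calc t * M ≤ 1 / (2 * B * M) * M := by gcongr; exact min_le_right _ _
      _ = _ := by field_simp
  refine ⟨ball z₀ r, ball_mem_nhds _ hr0, 2 * B / t, by positivity, fun z hz z' hz' hJz' => ?_⟩
  have hzd : dist z z₀ < r := hz
  have hz2 : z ∈ ball z₀ (2 * r) := by rw [mem_ball]; linarith
  set j := ‖jacobian Φ z‖ with hj
  rcases eq_or_lt_of_le (norm_nonneg (jacobian Φ z)) with h0 | hjpos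
  · rw [hj, ← h0, zero_pow two_ne_zero]; positivity
  change 0 < j at hjpos
  have hjM : j ≤ M := (hM₃ z (ball_subset_ball hrr₃ hz2)).trans hMM₃
  set ρ := t * j with hρ
  have hρ0 : 0 < ρ := by positivity
  have hρr : ρ ≤ r / 2 := (by rw [hρ]; gcongr : ρ ≤ t * M).trans htr
  have hsub : closedBall z ρ ⊆ ball z₀ (2 * r) := fun x hx => by
    have h1 := mem_closedBall.mp hx
    have h2 := dist_triangle x z z₀
    rw [mem_ball]; linarith
  have hzρ : z ∈ closedBall z ρ := mem_closedBall_self hρ0.le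
  -- the Jacobian does not vanish on the small ball
  have hJne : ∀ x ∈ closedBall z ρ, jacobian Φ x ≠ 0 := by
    intro x hx hx0
    have h1 : ‖jacobian Φ x - jacobian Φ z‖ ≤ M * ‖x - z‖ :=
      (convex_closedBall z ρ).norm_image_sub_le_of_norm_fderiv_le
        (fun y hy => hJ.differentiableAt (hX.mem_nhds (hb2X (hsub hy))))
        (fun y hy => (hM₂ y (ball_subset_ball hrr₂ (hsub hy))).trans hMM₂) hzρ hx
    rw [hx0, zero_sub, norm_neg] at h1
    have h2 : ‖x - z‖ ≤ ρ := by rw [← dist_eq_norm]; exact hx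
    have h3 : M * ‖x - z‖ ≤ (t * M) * j := by
      calc M * ‖x - z‖ ≤ M * ρ := by gcongr
        _ = _ := by rw [hρ]; ring
    have h4 : t * M ≤ 1 / 2 := htB.trans (by
      rw [div_le_div_iff₀ (by positivity) (by positivity)]; linarith)
    have h5 : t * M * j ≤ 1 / 2 * j := by gcongr
    have h6 : j ≤ M * ‖x - z‖ := h1
    linarith
  have hjz : jacobian Φ z ≠ 0 := norm_pos_iff.mp hjpos
  -- The inverse is the adjugate over the determinant, so its norm is at most `B / j`: the loss near
  -- critical points is only one power of `j`.
  let inv : (fderiv ℂ Φ z).NonlinearRightInverse :=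
    { toFun := fun v => (jacobian Φ z)⁻¹ • A (fderiv ℂ Φ z) v
      nnnorm := ⟨B / j, by positivity⟩
      bound' := fun v => by
        rw [norm_smul, norm_inv]
        calc (‖jacobian Φ z‖)⁻¹ * ‖A (fderiv ℂ Φ z) v‖ ≤ j⁻¹ * (B * ‖v‖) := by
              rw [← hj]
              gcongr
              exact (A _).le_of_opNorm_le (hB4 z (ball_subset_ball hrr₄ hz2)) v
          _ = B / j * ‖v‖ := by ring
      right_inv' := fun v => by
        rw [map_smul, hAL, smul_smul]
        change ((jacobian Φ z)⁻¹ * jacobian Φ z) • v = v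
        rw [inv_mul_cancel₀ hjz, one_smul] }
  have happrox : ApproximatesLinearOn Φ (fderiv ℂ Φ z) (closedBall z ρ)
      ⟨M * ρ, by positivity⟩ := by
    intro x hx y hy
    refine (convex_closedBall z ρ).norm_image_sub_le_of_norm_fderiv_le'
      (fun w hw => hΦ.differentiableAt (hX.mem_nhds (hb2X (hsub hw)))) (fun w hw => ?_) hy hx
    have h1 : ‖fderiv ℂ Φ w - fderiv ℂ Φ z‖ ≤ M * ‖w - z‖ :=
      (convex_closedBall z ρ).norm_image_sub_le_of_norm_fderiv_le
        (fun y hy => hD.differentiableAt (hX.mem_nhds (hb2X (hsub hy))))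
        (fun y hy => (hM₁ y (ball_subset_ball hrr₁ (hsub hy))).trans hMM₁) hzρ hw
    refine h1.trans ?_
    change M * ‖w - z‖ ≤ M * ρ
    gcongr
    rw [← dist_eq_norm]; exact hw
  -- The image of the ball contains a ball of radius at least `(j / B - j / (2 * B)) * ρ = t / (2 *
  -- B) * j ^ 2` about `Φ z`. A critical value there would also be the value at a noncritical point,
  -- against `hcrit`.
  have hsurj := happrox.surjOn_closedBall_of_nonlinearRightInverse inv hρ0.le subset_rfl
  by_contra hcon
  rw [not_le] at hcon
  have hmem : Φ z' ∈ closedBall (Φ z) ((((inv.nnnorm : ℝ))⁻¹ - (M * ρ)) * ρ) := by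
    rw [mem_closedBall, dist_comm, dist_eq_norm]
    have h1 : ((inv.nnnorm : ℝ))⁻¹ = j / B := by
      change (B / j)⁻¹ = j / B
      rw [inv_div]
    rw [h1]
    have h2 : M * ρ ≤ j / (2 * B) := by
      calc M * ρ = (t * M) * j := by rw [hρ]; ring
        _ ≤ 1 / (2 * B) * j := by gcongr
        _ = _ := by ring
    have h3 : ‖Φ z - Φ z'‖ ≤ t / (2 * B) * j ^ 2 := by
      have : ‖Φ z - Φ z'‖ = t / (2 * B) * (2 * B / t * ‖Φ z - Φ z'‖) := by field_simp
      rw [this]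
      gcongr
    calc ‖Φ z - Φ z'‖ ≤ t / (2 * B) * j ^ 2 := h3
      _ = (j / B - j / (2 * B)) * ρ := by rw [hρ]; field_simp; ring
      _ ≤ _ := by gcongr
  obtain ⟨x, hx, hxe⟩ := hsurj hmem
  exact hJne x hx (hcrit z' hz' x (hb2X (hsub hx)) hxe.symm hJz')

/-- Away from the critical points of `Φ` a function on the image is holomorphic if its pull-back
is. -/
theorem differentiableAt_of_comp_of_jacobian_ne_zero {f : E → ℂ} (hX : IsOpen X)
    (hΦ : DifferentiableOn ℂ Φ X) (hf : DifferentiableOn ℂ (fun z => f (Φ z)) X) {z : E}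
    (hz : z ∈ X) (hJ : jacobian Φ z ≠ 0) : DifferentiableAt ℂ f (Φ z) := by
  have : CompleteSpace E := FiniteDimensional.complete ℂ E
  have hs := hΦ.hasStrictFDerivAt_of_finiteDimensional hX hz
  let e : E ≃L[ℂ] E := (fderiv ℂ Φ z).toContinuousLinearEquivOfDetNeZero hJ
  have hs' : HasStrictFDerivAt Φ (e : E →L[ℂ] E) z := by
    have : (e : E →L[ℂ] E) = fderiv ℂ Φ z :=
      ContinuousLinearMap.coe_toContinuousLinearEquivOfDetNeZero _ hJ
    rwa [this]
  have hinv := hs'.to_localInverse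
  have hfz : hs'.localInverse Φ e z (Φ z) = z := hs'.localInverse_apply_image
  have h1 : ∀ᶠ y in 𝓝 (Φ z), Φ (hs'.localInverse Φ e z y) = y := hs'.eventually_right_inverse
  have h2 : DifferentiableAt ℂ (fun y => f (Φ (hs'.localInverse Φ e z y))) (Φ z) := by
    refine DifferentiableAt.comp (g := fun z => f (Φ z)) (Φ z) ?_
      hinv.hasFDerivAt.differentiableAt
    rw [hfz]
    exact hf.differentiableAt (hX.mem_nhds hz)
  exact h2.congr_of_eventuallyEq (by filter_upwards [h1] with y hy; rw [hy])

/-- A function on the image whose pull-back is holomorphic and divisible by the fourth power of the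
Jacobian determinant is holomorphic. -/
theorem differentiableOn_of_comp_eq_jacobian_pow_mul {f k : E → ℂ} (hX : IsOpen X)
    (hΩ : IsOpen Ω) (hΦ : DifferentiableOn ℂ Φ X)
    (hproper : ∀ K ⊆ Ω, IsCompact K → IsCompact (X ∩ Φ ⁻¹' K)) (himage : Φ '' X = Ω)
    (hcrit : ∀ x ∈ X, ∀ x' ∈ X, Φ x = Φ x' → jacobian Φ x = 0 → jacobian Φ x' = 0)
    (hk : DifferentiableOn ℂ k X) (hf : ∀ z ∈ X, f (Φ z) = jacobian Φ z ^ 4 * k z) :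
    DifferentiableOn ℂ f Ω := by
  intro y hy
  refine DifferentiableAt.differentiableWithinAt ?_
  rw [← himage] at hy
  obtain ⟨z₀, hz₀, rfl⟩ := hy
  by_cases hJ : jacobian Φ z₀ = 0
  swap
  · exact differentiableAt_of_comp_of_jacobian_ne_zero hX hΦ
      ((((hΦ.jacobian hX).pow 4).mul hk).congr hf) hz₀ hJ
  have : ProperSpace E := FiniteDimensional.proper ℂ E
  have hyΩ : Φ z₀ ∈ Ω := himage ▸ mem_image_of_mem _ hz₀
  obtain ⟨ε, hε, hεΩ⟩ := Metric.nhds_basis_closedBall.mem_iff.mp (hΩ.mem_nhds hyΩ)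
  have hK := hproper _ hεΩ (isCompact_closedBall (Φ z₀) ε)
  -- The local constants become uniform because properness makes the preimage of the closed ball
  -- compact.
  obtain ⟨C, hC0, hC⟩ : ∃ C > 0, ∀ z ∈ X ∩ Φ ⁻¹' closedBall (Φ z₀) ε,
      ∀ z' ∈ X, jacobian Φ z' = 0 → ‖jacobian Φ z‖ ^ 2 ≤ C * ‖Φ z - Φ z'‖ := by
    refine hK.induction_on (p := fun S => ∃ C > 0, ∀ z ∈ S,
      ∀ z' ∈ X, jacobian Φ z' = 0 → ‖jacobian Φ z‖ ^ 2 ≤ C * ‖Φ z - Φ z'‖) ?_ ?_ ?_ ?_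
    · exact ⟨1, one_pos, by simp⟩
    · rintro S T hST ⟨C, hC0, hC⟩
      exact ⟨C, hC0, fun z hz => hC z (hST hz)⟩
    · rintro S T ⟨C, hC0, hC⟩ ⟨C', hC0', hC'⟩
      refine ⟨max C C', lt_max_of_lt_left hC0, ?_⟩
      rintro z (hz | hz) z' hz' hJz'
      · exact (hC z hz z' hz' hJz').trans (by gcongr; exact le_max_left _ _)
      · exact (hC' z hz z' hz' hJz').trans (by gcongr; exact le_max_right _ _)
    · intro z hz
      obtain ⟨U, hU, C, hC0, hC⟩ := exists_norm_jacobian_sq_le hX hΦ hcrit hz.1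
      exact ⟨U, mem_nhdsWithin_of_mem_nhds hU, C, hC0, hC⟩
  obtain ⟨B, hB⟩ := hK.exists_bound_of_continuousOn (hk.continuousOn.mono inter_subset_left)
  have hB0 : 0 ≤ B := (norm_nonneg _).trans (hB z₀ ⟨hz₀, mem_closedBall_self hε.le⟩)
  have h0 : f (Φ z₀) = 0 := by rw [hf z₀ hz₀, hJ]; simp
  -- Since the square of the Jacobian is bounded by a multiple of the distance to the critical
  -- value, its fourth power is of second order there and the derivative of `f` is zero.
  refine (HasFDerivAt.of_isLittleO (f' := (0 : E →L[ℂ] ℂ)) ?_).differentiableAt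
  have hO : (fun y => f y - f (Φ z₀) - (0 : E →L[ℂ] ℂ) (y - Φ z₀)) =O[𝓝 (Φ z₀)]
      fun y => ‖y - Φ z₀‖ ^ 2 := by
    refine Asymptotics.IsBigO.of_bound (C ^ 2 * B) ?_
    filter_upwards [closedBall_mem_nhds (Φ z₀) hε] with y hy
    have hyΩ := hεΩ hy
    rw [← himage] at hyΩ
    obtain ⟨z, hz, rfl⟩ := hyΩ
    have h1 := hC z ⟨hz, hy⟩ z₀ hz₀ hJ
    rw [h0, hf z hz]
    simp only [sub_zero, zero_apply, norm_mul, norm_pow, norm_norm]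
    calc ‖jacobian Φ z‖ ^ 4 * ‖k z‖ = (‖jacobian Φ z‖ ^ 2) ^ 2 * ‖k z‖ := by ring
      _ ≤ (C * ‖Φ z - Φ z₀‖) ^ 2 * B := by
        gcongr
        exact hB z ⟨hz, hy⟩
      _ = _ := by ring
  refine hO.trans_isLittleO ?_
  have h2 : (fun y : E => ‖y - Φ z₀‖ ^ 2) =o[𝓝 (Φ z₀)] fun y => ‖y - Φ z₀‖ ^ 1 :=
    (Asymptotics.isLittleO_pow_pow (𝕜 := ℝ) (by norm_num)).comp_tendsto
      (tendsto_norm_sub_self _)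
  exact (h2.congr_right fun y => by simp).of_norm_right

/-- The set of critical points of a holomorphic map has no interior in the preimage of an open
set. -/
theorem exists_jacobian_ne_zero {U V : Set E} (hU : IsOpen U) (hΦ : DifferentiableOn ℂ Φ U)
    (hV : IsOpen V) (hVne : V.Nonempty) (himage : Φ '' U = V) : ∃ z ∈ U, jacobian Φ z ≠ 0 := by
  by_contra! hcon
  borelize E
  have : FiniteDimensional ℝ E := FiniteDimensional.complexToReal E
  -- The easy case of Sard's theorem: if the Jacobian vanished identically, the open set `V` would
  -- be a null set. The real determinant vanishes because it is the norm over the reals of the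
  -- complex one.
  have h1 := addHaar_image_eq_zero_of_det_fderivWithin_eq_zero (Measure.addHaar (G := E))
    (f := Φ) (s := U) (f' := fun z => (fderiv ℂ Φ z).restrictScalars ℝ)
    (fun z hz => ((hΦ.differentiableAt (hU.mem_nhds hz)).hasFDerivAt.restrictScalars
      ℝ).hasFDerivWithinAt) (fun z hz => by
      have h2 : (fderiv ℂ Φ z).det = 0 := hcon z hz
      have h3 : ((fderiv ℂ Φ z).restrictScalars ℝ).det =
        LinearMap.det (LinearMap.restrictScalars ℝ (fderiv ℂ Φ z : E →ₗ[ℂ] E)) := rfl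
      rw [ContinuousLinearMap.det] at h2
      rw [h3, LinearMap.det_restrictScalars, h2]
      exact Algebra.norm_zero)
  rw [himage] at h1
  exact (hV.measure_pos _ hVne).ne' h1

end Descent

end

/-! ### Descent along a proper map: removing the zeros of a holomorphic function. -/

noncomputable section

section Descent

open Metric Real

/-- A continuous function of one variable that is holomorphic off the zeros of a non-trivial
holomorphic function has the mean value property. -/
theorem circleAverage_eq_of_differentiableAt_of_ne_zero {φ h : ℂ → ℂ} {ρ : ℝ} (hρ : 0 < ρ)
    {U : Set ℂ} (hU : IsOpen U) (hρU : closedBall 0 ρ ⊆ U)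
    (hh : DifferentiableOn ℂ h U) (hne : ∀ t ∈ sphere (0 : ℂ) ρ, h t ≠ 0)
    (hφ : ContinuousOn φ U) (hd : ∀ t ∈ U, h t ≠ 0 → DifferentiableAt ℂ φ t) :
    circleAverage φ 0 ρ = φ 0 := by
  have hsph : (ρ : ℂ) ∈ sphere (0 : ℂ) ρ := by simp [abs_of_pos hρ]
  have han : AnalyticOnNhd ℂ h (closedBall 0 ρ) := (hh.analyticOnNhd hU).mono hρU
  -- The zeros are discrete, hence finitely many in the compact disc, and the mean value property of
  -- a continuous function tolerates countably many exceptional points.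
  have hcod := han.preimage_zero_mem_codiscreteWithin (hne _ hsph) (sphere_subset_closedBall hsph)
    (isConnected_closedBall hρ.le)
  have hfin := (isCompact_closedBall (0 : ℂ) ρ).finite_sdiff_of_mem_codiscreteWithin hcod
  refine circleAverage_of_differentiable_on_off_countable hfin.countable ?_ ?_
  · rw [abs_of_pos hρ]; exact hφ.mono hρU
  · rw [abs_of_pos hρ]
    intro t ht
    have ht' := ball_subset_closedBall ht.1
    refine hd t (hρU ht') fun h0 => ht.2 ⟨ht', by simp [h0]⟩

variable {E : Type*} [NormedAddCommGroup E] [NormedSpace ℂ E] [FiniteDimensional ℂ E]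

/-- A continuous function that is holomorphic off the zeros of a holomorphic function without
interior zeros is holomorphic. -/
theorem differentiableOn_of_continuousOn_of_ne_zero {Ω : Set E} (hΩ : IsOpen Ω) {f D : E → ℂ}
    (hD : DifferentiableOn ℂ D Ω) (hf : ContinuousOn f Ω)
    (hd : ∀ y ∈ Ω, D y ≠ 0 → DifferentiableAt ℂ f y)
    (hdense : ∀ V ⊆ Ω, IsOpen V → V.Nonempty → ∃ y ∈ V, D y ≠ 0) : DifferentiableOn ℂ f Ω := by
  intro y₀ hy₀
  refine DifferentiableAt.differentiableWithinAt ?_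
  have : ProperSpace E := FiniteDimensional.proper ℂ E
  have : CompleteSpace E := FiniteDimensional.complete ℂ E
  obtain ⟨R, hR, hRΩ⟩ := Metric.isOpen_iff.mp hΩ y₀ hy₀
  -- The point `y₁` fixes a direction in which `D` does not vanish identically on the complex line
  -- through `y₀`; it is reached at parameter `1`.
  obtain ⟨y₁, hy₁, hDy₁⟩ := hdense _ hRΩ isOpen_ball ⟨y₀, mem_ball_self hR⟩
  set v := y₁ - y₀ with hv
  have hvR : ‖v‖ < R := by rw [hv, ← dist_eq_norm]; exact hy₁
  -- the line through `y₀` in direction `v`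
  have hseg : ∀ t : ℂ, ‖t‖ ≤ 1 → y₀ + t • v ∈ ball y₀ R := fun t ht => by
    rw [mem_ball, dist_eq_norm, add_sub_cancel_left, norm_smul]
    exact (mul_le_of_le_one_left (norm_nonneg v) ht).trans_lt hvR
  set L : Set ℂ := (fun t : ℂ => y₀ + t • v) ⁻¹' ball y₀ R with hL
  have hLo : IsOpen L := isOpen_ball.preimage (by fun_prop)
  have hline : DifferentiableOn ℂ (fun t : ℂ => D (y₀ + t • v)) L :=
    hD.comp (by fun_prop) fun t ht => hRΩ ht
  have hcl : closedBall (0 : ℂ) 1 ⊆ L := fun t ht => hseg t (by simpa using ht)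
  have han : AnalyticOnNhd ℂ (fun t : ℂ => D (y₀ + t • v)) (closedBall 0 1) :=
    (hline.analyticOnNhd hLo).mono hcl
  have hev : ∀ᶠ t in 𝓝[≠] (0 : ℂ), D (y₀ + t • v) ≠ 0 := by
    refine (han 0 (by simp)).eventually_eq_zero_or_eventually_ne_zero.resolve_left fun h0 => ?_
    have h1 := han.eqOn_zero_of_preconnected_of_eventuallyEq_zero
      (convex_closedBall (0 : ℂ) 1).isPreconnected (by simp) h0 (x := 1) (by simp)
    simp only [one_smul, hv, add_sub_cancel, Pi.zero_apply] at h1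
    exact hDy₁ h1
  rw [eventually_nhdsWithin_iff, Metric.eventually_nhds_iff] at hev
  obtain ⟨δ₀, hδ₀, hδ₀'⟩ := hev
  set ρ := min (δ₀ / 2) (1 / 2) with hρ
  have hρ0 : 0 < ρ := by positivity
  have hρ1 : ρ ≤ 1 / 2 := min_le_right _ _
  have hρδ : ρ < δ₀ := (min_le_left _ _).trans_lt (by linarith)
  have hDρ : ∀ t : ℂ, ‖t‖ = ρ → D (y₀ + t • v) ≠ 0 := fun t ht =>
    hδ₀' (by simpa [ht] using hρδ) fun h0 => by
      rw [mem_singleton_iff] at h0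
      rw [h0, norm_zero] at ht
      exact hρ0.ne ht
  set W : Set E := {y | y ∈ ball y₀ R ∧ D y ≠ 0} with hW
  have hWo : IsOpen W := (hD.continuousOn.mono hRΩ).isOpen_inter_preimage isOpen_ball
    isOpen_compl_singleton
  have hfW : DifferentiableOn ℂ f W := fun y hy => (hd y (hRΩ hy.1) hy.2).differentiableWithinAt
  set S : Set E := (fun t : ℂ => y₀ + t • v) '' sphere 0 ρ with hS
  have hSc : IsCompact S := (isCompact_sphere _ _).image (by fun_prop)
  have hSW : S ⊆ W := by
    rintro _ ⟨t, ht, rfl⟩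
    have ht' : ‖t‖ = ρ := by simpa using ht
    exact ⟨hseg t (by linarith), hDρ t ht'⟩
  -- The circle of radius `ρ` avoids the zeros of `D`, and by compactness so do its translates
  -- through all nearby points.
  obtain ⟨δ₁, hδ₁, hδ₁W⟩ := hSc.exists_cthickening_subset_open hWo hSW
  have hcomp : IsCompact (cthickening δ₁ S) := hSc.cthickening
  obtain ⟨B, hB⟩ := hcomp.exists_bound_of_continuousOn
    (((hfW.fderiv_of_finiteDimensional hWo).continuousOn).mono hδ₁W)
  set δ := min δ₁ ((R - ‖v‖) / 2) with hδ
  have hδ0 : 0 < δ := lt_min hδ₁ (by linarith)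
  have hthick : ∀ y ∈ ball y₀ δ, ∀ t : ℂ, ‖t‖ = ρ → y + t • v ∈ cthickening δ₁ S := by
    intro y hy t ht
    refine mem_cthickening_of_dist_le _ (y₀ + t • v) _ _ ⟨t, by simpa using ht, rfl⟩ ?_
    rw [dist_add_right]
    exact (mem_ball.mp hy).le.trans (min_le_left _ _)
  have hmemR : ∀ y ∈ ball y₀ δ, ∀ t : ℂ, ‖t‖ ≤ 1 → y + t • v ∈ ball y₀ R := by
    intro y hy t ht
    have h1 : dist y y₀ < (R - ‖v‖) / 2 := (mem_ball.mp hy).trans_le (min_le_right _ _)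
    have h2 : dist (y + t • v) y ≤ ‖v‖ := by
      rw [dist_eq_norm, add_sub_cancel_left, norm_smul]
      exact mul_le_of_le_one_left (norm_nonneg v) ht
    have h3 := dist_triangle (y + t • v) y y₀
    rw [mem_ball]; linarith
  have hnorm : ∀ θ : ℝ, ‖circleMap 0 ρ θ‖ = ρ := fun θ => by simp [abs_of_pos hρ0]
  have hcirc : ∀ y ∈ ball y₀ δ, ∀ θ : ℝ, y + circleMap 0 ρ θ • v ∈ W := fun y hy θ =>
    hδ₁W (hthick y hy _ (hnorm θ))
  have hcont : ∀ y ∈ ball y₀ δ, Continuous fun θ : ℝ => f (y + circleMap 0 ρ θ • v) :=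
    fun y hy => hfW.continuousOn.comp_continuous
      (continuous_const.add ((continuous_circleMap 0 ρ).smul continuous_const)) (hcirc y hy)
  -- On each parallel line the value at `y` is the mean over a circle contained in `W`, where `f` is
  -- known to be holomorphic. Differentiation under the integral then gives differentiability at
  -- `y₀`.
  have hmean : ∀ y ∈ ball y₀ δ,
      f y = (2 * π)⁻¹ • ∫ θ in (0 : ℝ)..2 * π, f (y + circleMap 0 ρ θ • v) := by
    intro y hy
    have hUy : IsOpen ((fun t : ℂ => y + t • v) ⁻¹' ball y₀ R) :=
      isOpen_ball.preimage (by fun_prop)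
    have h1 := circleAverage_eq_of_differentiableAt_of_ne_zero
      (φ := fun t : ℂ => f (y + t • v)) (h := fun t : ℂ => D (y + t • v)) hρ0 hUy
      (fun t ht => hmemR y hy t (by
        have : ‖t‖ ≤ ρ := by simpa using ht
        linarith))
      (hD.comp (by fun_prop) fun t ht => hRΩ ht)
      (fun t ht => (hδ₁W (hthick y hy t (by simpa using ht))).2)
      (hf.comp (by fun_prop) fun t ht => hRΩ ht)
      (fun t ht hDt => (hd _ (hRΩ ht) hDt).comp t (by fun_prop))
    rw [circleAverage_def] at h1
    simp only [zero_smul, add_zero] at h1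
    exact h1.symm
  have hint : HasFDerivAt (fun y => ∫ θ in (0 : ℝ)..2 * π, f (y + circleMap 0 ρ θ • v))
      (∫ θ in (0 : ℝ)..2 * π, fderiv ℂ f (y₀ + circleMap 0 ρ θ • v)) y₀ := by
    have hy₀' : y₀ ∈ ball y₀ δ := mem_ball_self hδ0
    refine intervalIntegral.hasFDerivAt_integral_of_dominated_of_fderiv_le
      (F' := fun y θ => fderiv ℂ f (y + circleMap 0 ρ θ • v)) (bound := fun _ => B)
      (ball_mem_nhds y₀ hδ0) ?_ ((hcont y₀ hy₀').intervalIntegrable _ _) ?_ ?_ (by simp) ?_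
    · filter_upwards [ball_mem_nhds y₀ hδ0] with y hy
      exact (hcont y hy).aestronglyMeasurable
    · exact ((hfW.fderiv_of_finiteDimensional hWo).continuousOn.comp_continuous
        (continuous_const.add ((continuous_circleMap 0 ρ).smul continuous_const))
        (hcirc y₀ hy₀')).aestronglyMeasurable
    · exact Eventually.of_forall fun θ _ y hy => hB _ (hthick y hy _ (hnorm θ))
    · refine Eventually.of_forall fun θ _ y hy => ?_
      have h1 := (hfW.differentiableAt (hWo.mem_nhds (hcirc y hy θ))).hasFDerivAt
      exact (hasFDerivAt_comp_add_right _).mpr h1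
  refine ((hint.const_smul (2 * π)⁻¹).differentiableAt).congr_of_eventuallyEq ?_
  filter_upwards [ball_mem_nhds y₀ hδ0] with y hy
  exact hmean y hy

/-- Holomorphic functions that are constant on the fibers of a proper holomorphic map descend to
holomorphic functions. -/
theorem differentiableOn_of_comp_proper {X Ω : Set E} {Φ : E → E} {f D h : E → ℂ}
    (hX : IsOpen X) (hΩ : IsOpen Ω) (hΦ : DifferentiableOn ℂ Φ X)
    (hproper : ∀ K ⊆ Ω, IsCompact K → IsCompact (X ∩ Φ ⁻¹' K)) (himage : Φ '' X = Ω)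
    (hcrit : ∀ x ∈ X, ∀ x' ∈ X, Φ x = Φ x' → jacobian Φ x = 0 → jacobian Φ x' = 0)
    (hh : DifferentiableOn ℂ h X) (hD : ∀ z ∈ X, D (Φ z) = jacobian Φ z ^ 4 * h z)
    (hDne : ∀ z ∈ X, jacobian Φ z ≠ 0 → D (Φ z) ≠ 0)
    (hf : DifferentiableOn ℂ (fun z => f (Φ z)) X) : DifferentiableOn ℂ f Ω := by
  -- The factor with the fourth power makes `D` holomorphic on `Ω`, so that its zero set can serve
  -- as the exceptional set for `f`.
  have hDhol := differentiableOn_of_comp_eq_jacobian_pow_mul hX hΩ hΦ hproper himage hcrit hh hD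
  refine differentiableOn_of_continuousOn_of_ne_zero hΩ hDhol
    (continuousOn_of_comp_proper hΦ.continuousOn hproper himage hf.continuousOn) ?_ ?_
  · intro y hy hDy
    rw [← himage] at hy
    obtain ⟨z, hz, rfl⟩ := hy
    refine differentiableAt_of_comp_of_jacobian_ne_zero hX hΦ hf hz fun hJ => hDy ?_
    rw [hD z hz, hJ]; simp
  · intro V hVΩ hV hVne
    have hU : IsOpen (X ∩ Φ ⁻¹' V) := hΦ.continuousOn.isOpen_inter_preimage hX hV
    obtain ⟨z, hz, hJ⟩ := exists_jacobian_ne_zero hU (hΦ.mono inter_subset_left) hV hVne (by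
      rw [image_inter_preimage, himage, inter_eq_right.mpr hVΩ])
    exact ⟨Φ z, hz.2, hDne z hz.1 hJ⟩

end Descent

end

/-! ### The Poisson kernel of the disc. -/

noncomputable section

section Poisson

open Metric Real

/-- The Poisson kernel of the unit disc at distance `R` from the centre and angle `s`. -/
def diskPoisson (R s : ℝ) : ℝ := (1 - R ^ 2) / (1 - 2 * R * cos s + R ^ 2)

theorem diskPoisson_denom_pos {R : ℝ} (hR : R ∈ Ioo (0 : ℝ) 1) (s : ℝ) :
    0 < 1 - 2 * R * cos s + R ^ 2 := by
  nlinarith [cos_le_one s, hR.1, hR.2, mul_pos hR.1 hR.1, sq_nonneg (1 - R),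
    mul_nonneg hR.1.le (sub_nonneg.mpr (cos_le_one s)), mul_pos (sub_pos.mpr hR.2) (sub_pos.mpr hR.2)]

theorem diskPoisson_nonneg {R : ℝ} (hR : R ∈ Ioo (0 : ℝ) 1) (s : ℝ) : 0 ≤ diskPoisson R s :=
  div_nonneg (by nlinarith [hR.1, hR.2]) (diskPoisson_denom_pos hR s).le

theorem contDiff_diskPoisson {R : ℝ} (hR : R ∈ Ioo (0 : ℝ) 1) : ContDiff ℝ 1 (diskPoisson R) :=
  contDiff_const.div (by fun_prop) fun s => (diskPoisson_denom_pos hR s).ne'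

theorem continuous_diskPoisson {R : ℝ} (hR : R ∈ Ioo (0 : ℝ) 1) : Continuous (diskPoisson R) :=
  (contDiff_diskPoisson hR).continuous

theorem hasDerivAt_diskPoisson {R : ℝ} (hR : R ∈ Ioo (0 : ℝ) 1) (s : ℝ) :
    HasDerivAt (diskPoisson R)
      (-((1 - R ^ 2) * (2 * R * sin s)) / (1 - 2 * R * cos s + R ^ 2) ^ 2) s := by
  have h1 : HasDerivAt (fun s => 1 - 2 * R * cos s + R ^ 2) (2 * R * sin s) s := by
    exact ((((hasDerivAt_cos s).const_mul (2 * R)).const_sub 1).add_const (R ^ 2)).congr_deriv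
      (by ring)
  exact ((hasDerivAt_const s (1 - R ^ 2)).div h1 (diskPoisson_denom_pos hR s).ne').congr_deriv
    (by ring)

theorem cos_le_cos_of_abs {η s : ℝ} (hη : 0 ≤ η) (h1 : η ≤ |s|) (h2 : |s| ≤ 2 * π - η) :
    cos s ≤ cos η := by
  rw [← cos_abs s]
  rcases le_total |s| π with h | h
  · exact cos_le_cos_of_nonneg_of_le_pi hη h h1
  · rw [← cos_two_pi_sub |s|]
    exact cos_le_cos_of_nonneg_of_le_pi hη (by linarith) (by linarith)

/-- The denominator is `(1 - R) ^ 2 + 2 * R * (1 - cos s)`, and `2 * R ≥ 1`. -/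
theorem diskPoisson_denom_ge {R : ℝ} (hR : R ∈ Ioo (1 / 2 : ℝ) 1) {η s : ℝ} (hη : 0 ≤ η)
    (h1 : η ≤ |s|) (h2 : |s| ≤ 2 * π - η) : 1 - cos η ≤ 1 - 2 * R * cos s + R ^ 2 := by
  have h3 := cos_le_cos_of_abs hη h1 h2
  have h4 : 0 ≤ (1 - R) ^ 2 := sq_nonneg _
  have h5 : 0 ≤ 1 - cos s := sub_nonneg.mpr (cos_le_one s)
  nlinarith [hR.1, hR.2]

theorem eventually_mem_Ioo_one {a : ℝ} (ha : a < 1) : ∀ᶠ R in 𝓝[<] (1 : ℝ), R ∈ Ioo a 1 :=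
  Ioo_mem_nhdsLT ha

theorem tendsto_one_sub_sq : Tendsto (fun R : ℝ => 1 - R ^ 2) (𝓝[<] 1) (𝓝 0) := by
  have : Tendsto (fun R : ℝ => 1 - R ^ 2) (𝓝 1) (𝓝 (1 - 1 ^ 2)) := by
    exact (by fun_prop : Continuous fun R : ℝ => 1 - R ^ 2).tendsto 1
  simpa using this.mono_left nhdsWithin_le_nhds

theorem one_sub_cos_pos {η : ℝ} (hη : 0 < η) (hηπ : η ≤ π) : 0 < 1 - cos η := by
  have := cos_lt_cos_of_nonneg_of_le_pi le_rfl hηπ hη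
  rw [cos_zero] at this
  linarith

/-- The Poisson kernel tends to zero uniformly off neighbourhoods of the pole. -/
theorem eventually_diskPoisson_le {η ε : ℝ} (hη : 0 < η) (hηπ : η ≤ π) (hε : 0 < ε) :
    ∀ᶠ R in 𝓝[<] (1 : ℝ), ∀ s, η ≤ |s| → |s| ≤ 2 * π - η → diskPoisson R s ≤ ε := by
  have hc := one_sub_cos_pos hη hηπ
  filter_upwards [tendsto_one_sub_sq.eventually (gt_mem_nhds (mul_pos hε hc)),
    eventually_mem_Ioo_one (by norm_num : (1 / 2 : ℝ) < 1)] with R h1 hR s hs hs'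
  have hR0 : R ∈ Ioo (0 : ℝ) 1 := ⟨by linarith [hR.1], hR.2⟩
  rw [diskPoisson, div_le_iff₀ (diskPoisson_denom_pos hR0 s)]
  have := diskPoisson_denom_ge hR hη.le hs hs'
  nlinarith

theorem poissonKernel_circleMap {R : ℝ} (hR : R ∈ Ioo (0 : ℝ) 1) (θ t : ℝ) :
    poissonKernel 0 (circleMap 0 R θ) (circleMap 0 1 t) = diskPoisson R (t - θ) := by
  rw [poissonKernel_def, diskPoisson]
  simp only [sub_zero, norm_circleMap_zero, abs_one, one_pow, abs_of_pos hR.1]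
  congr 1
  rw [← Complex.normSq_eq_norm_sq, Complex.normSq_apply]
  simp only [circleMap_zero, Complex.sub_re, Complex.sub_im, Complex.mul_re, Complex.mul_im,
    Complex.ofReal_re, Complex.ofReal_im, Complex.exp_ofReal_mul_I_re,
    Complex.exp_ofReal_mul_I_im, cos_sub]
  nlinarith [sin_sq_add_cos_sq t, sin_sq_add_cos_sq θ]

/-- The Poisson formula on the interval `(-π, π]`. -/
theorem integral_diskPoisson_mul {g : ℂ → ℂ} (hg : DiffContOnCl ℂ g (ball 0 1)) {R : ℝ}
    (hR : R ∈ Ioo (0 : ℝ) 1) (θ : ℝ) :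
    ∫ t in -π..π, (diskPoisson R (t - θ) : ℂ) * g (circleMap 0 1 t) =
      2 * π * g (circleMap 0 R θ) := by
  have h1 := hg.circleAverage_poissonKernel_smul (w := circleMap 0 R θ) (by
    simp [abs_of_pos hR.1, hR.2])
  rw [circleAverage_def] at h1
  have hper : Function.Periodic
      (fun t => (diskPoisson R (t - θ) : ℂ) * g (circleMap 0 1 t)) (2 * π) := by
    intro t
    have h2 : diskPoisson R (t + 2 * π - θ) = diskPoisson R (t - θ) := by
      rw [diskPoisson, diskPoisson, show t + 2 * π - θ = t - θ + 2 * π by ring, cos_add_two_pi]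
    have h3 : circleMap 0 1 (t + 2 * π) = circleMap 0 1 t := periodic_circleMap 0 1 t
    simp only [h2, h3]
  have h4 := hper.intervalIntegral_add_eq (-π) 0
  rw [show -π + 2 * π = π by ring, zero_add] at h4
  rw [h4]
  simp only [Pi.smul_apply', poissonKernel_circleMap hR, Complex.real_smul] at h1
  rw [← h1]
  push_cast
  field_simp

theorem integral_diskPoisson {R : ℝ} (hR : R ∈ Ioo (0 : ℝ) 1) (θ : ℝ) :
    ∫ t in -π..π, diskPoisson R (t - θ) = 2 * π := by
  have h := integral_diskPoisson_mul (g := fun _ => 1) diffContOnCl_const hR θ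
  simp only [mul_one] at h
  rw [intervalIntegral.integral_ofReal] at h
  exact_mod_cast h

/-- The mass of the Poisson kernel concentrates at the pole. -/
theorem tendsto_integral_diskPoisson {δ : ℝ} (hδ : 0 < δ) (hδπ : δ ≤ π) :
    Tendsto (fun R => ∫ s in -δ..δ, diskPoisson R s) (𝓝[<] 1) (𝓝 (2 * π)) := by
  rw [Metric.tendsto_nhds]
  intro ε hε
  filter_upwards [eventually_diskPoisson_le hδ hδπ (by positivity : 0 < ε / (4 * π)),
    eventually_mem_Ioo_one (by norm_num : (0 : ℝ) < 1)] with R h1 hR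
  have hi : ∀ a b, IntervalIntegrable (diskPoisson R) volume a b :=
    fun a b => (continuous_diskPoisson hR).intervalIntegrable a b
  have h2 := integral_diskPoisson hR 0
  simp only [sub_zero] at h2
  have h3 : (∫ s in -π..-δ, diskPoisson R s) + (∫ s in -δ..δ, diskPoisson R s) +
      (∫ s in δ..π, diskPoisson R s) = 2 * π := by
    rw [intervalIntegral.integral_add_adjacent_intervals (hi _ _) (hi _ _),
      intervalIntegral.integral_add_adjacent_intervals (hi _ _) (hi _ _), h2]
  have hpi := pi_pos
  have h4 : ‖∫ s in -π..-δ, diskPoisson R s‖ ≤ ε / (4 * π) * |-δ - -π| := by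
    refine intervalIntegral.norm_integral_le_of_norm_le_const fun s hs => ?_
    rw [uIoc_of_le (by linarith)] at hs
    rw [norm_of_nonneg (diskPoisson_nonneg hR s)]
    have : |s| = -s := abs_of_nonpos (by linarith [hs.2])
    exact h1 s (by rw [this]; linarith [hs.2]) (by rw [this]; linarith [hs.1])
  have h5 : ‖∫ s in δ..π, diskPoisson R s‖ ≤ ε / (4 * π) * |π - δ| := by
    refine intervalIntegral.norm_integral_le_of_norm_le_const fun s hs => ?_
    rw [uIoc_of_le (by linarith)] at hs
    rw [norm_of_nonneg (diskPoisson_nonneg hR s)]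
    have : |s| = s := abs_of_nonneg (by linarith [hs.1])
    exact h1 s (by rw [this]; linarith [hs.1]) (by rw [this]; linarith [hs.2])
  have h6 : |-δ - -π| = π - δ := by rw [abs_of_nonneg] <;> linarith
  have h7 : |π - δ| = π - δ := abs_of_nonneg (by linarith)
  rw [h6] at h4
  rw [h7] at h5
  rw [Real.norm_eq_abs, abs_le] at h4 h5
  have h8 : ε / (4 * π) * (π - δ) ≤ ε / 4 := by
    calc ε / (4 * π) * (π - δ) ≤ ε / (4 * π) * π := by gcongr; linarith
      _ = ε / 4 := by field_simp
  rw [Real.dist_eq, abs_lt]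
  constructor <;> linarith [h4.1, h4.2, h5.1, h5.2]

/-- The Poisson integral of a function recovers its value where the function is the derivative of
its primitive. -/
theorem tendsto_integral_diskPoisson_mul {δ : ℝ} (hδ : 0 < δ) (hδπ : δ ≤ π) {u : ℝ → ℝ} {c : ℝ}
    (hu : IntervalIntegrable u volume (-δ) δ) (hc : HasDerivAt (fun s => ∫ x in (0 : ℝ)..s,
        u x) c 0) :
    Tendsto (fun R => ∫ s in -δ..δ, diskPoisson R s * u s) (𝓝[<] 1) (𝓝 (2 * π * c)) := by
  -- Integration by parts moves the derivative to the kernel, so only the derivative of the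
  -- primitive at `0` matters.
  set V : ℝ → ℝ := fun s => ∫ x in (0 : ℝ)..s, u x with hV
  have hV0 : V 0 = 0 := by simp [hV]
  have hle : -δ ≤ δ := by linarith
  have h0mem : (0 : ℝ) ∈ uIcc (-δ) δ := by rw [uIcc_of_le hle]; constructor <;> linarith
  have hVac : AbsolutelyContinuousOnInterval V (-δ) δ :=
    hu.absolutelyContinuousOnInterval_intervalIntegral h0mem
  have hVderiv : ∀ᵐ s, s ∈ uIcc (-δ) δ → deriv V s = u s := by
    filter_upwards [hu.ae_hasDerivAt_integral] with s hs hmem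
    exact (hs hmem 0 h0mem).deriv
  have hVc : ContinuousOn V (Icc (-δ) δ) := by
    have := hVac.continuousOn
    rwa [uIcc_of_le hle] at this
  -- The quotient `V s / s`, extended by `c` at `0`, is continuous and carries the hypothesis on the
  -- derivative.
  set g := dslope V 0 with hg
  have hgc : ContinuousOn g (Icc (-δ) δ) :=
    (continuousOn_dslope (Icc_mem_nhds (by linarith) hδ)).mpr ⟨hVc, hc.differentiableAt⟩
  have hg0 : g 0 = c := by rw [hg, dslope_same, hc.deriv]
  have hgV : ∀ s, s * g s = V s := fun s => by
    have := sub_smul_dslope V 0 s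
    simpa [hV0] using this
  -- integration by parts
  have hparts : ∀ R ∈ Ioo (0 : ℝ) 1, ∀ v : ℝ → ℝ, AbsolutelyContinuousOnInterval v (-δ) δ →
      ∫ s in -δ..δ, diskPoisson R s * deriv v s =
        diskPoisson R δ * (v δ - v (-δ)) - ∫ s in -δ..δ, deriv (diskPoisson R) s * v s := by
    intro R hR v hv
    have h1 := (contDiff_diskPoisson hR).contDiffOn.absolutelyContinuousOnInterval
      (a := -δ) (b := δ) |>.integral_mul_deriv_eq_deriv_mul hv
    rw [h1]
    have : diskPoisson R (-δ) = diskPoisson R δ := by simp [diskPoisson]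
    rw [this]
    ring
  -- After integration by parts the kernel that acts on `g` is `-s` times the derivative of the
  -- Poisson kernel, normalized. It is nonnegative and concentrates at `0`, so it reproduces `g 0 =
  -- c`.
  set φ : ℝ → ℝ → ℝ := fun R s => (2 * π)⁻¹ * (-(deriv (diskPoisson R) s) * s) with hφ
  have hφeq : ∀ R ∈ Ioo (0 : ℝ) 1, ∀ s, φ R s =
      (2 * π)⁻¹ * ((1 - R ^ 2) * (2 * R * (sin s * s)) / (1 - 2 * R * cos s + R ^ 2) ^ 2) := by
    intro R hR s
    simp only [hφ, (hasDerivAt_diskPoisson hR s).deriv]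
    ring
  have hφc : ∀ R ∈ Ioo (0 : ℝ) 1, Continuous (φ R) := fun R hR => by
    have := (contDiff_diskPoisson hR).continuous_deriv le_rfl
    fun_prop
  have hss : ∀ s, |s| ≤ π → 0 ≤ sin s * s := by
    intro s hs
    rcases le_total 0 s with h | h
    · exact mul_nonneg (sin_nonneg_of_nonneg_of_le_pi h (by rwa [abs_of_nonneg h] at hs)) h
    · rw [abs_of_nonpos h] at hs
      exact mul_nonneg_of_nonpos_of_nonpos (sin_nonpos_of_nonpos_of_neg_pi_le h (by linarith)) h
  have habs : ∀ s ∈ Ioc (-δ) δ, |s| ≤ δ := fun s hs => abs_le.mpr ⟨hs.1.le, hs.2⟩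
  have hbdry : Tendsto (fun R => diskPoisson R δ) (𝓝[<] 1) (𝓝 0) := by
    rw [Metric.tendsto_nhds]
    intro ε hε
    filter_upwards [eventually_diskPoisson_le hδ hδπ (half_pos hε),
      eventually_mem_Ioo_one (by norm_num : (0 : ℝ) < 1)] with R h1 hR
    have h2 := h1 δ (le_abs_self δ) (by rw [abs_of_pos hδ]; linarith)
    rw [Real.dist_eq, sub_zero, abs_of_nonneg (diskPoisson_nonneg hR δ)]
    linarith
  -- The total mass comes from the same integration by parts with the identity in place of `V`.
  have hmass : Tendsto (fun R => ∫ s in Ioc (-δ) δ, φ R s) (𝓝[<] 1) (𝓝 1) := by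
    have h1 : Tendsto (fun R => (2 * π)⁻¹ * ((∫ s in -δ..δ, diskPoisson R s) -
        diskPoisson R δ * (δ - (-δ)))) (𝓝[<] 1) (𝓝 ((2 * π)⁻¹ * (2 * π - 0 * (δ - (-δ))))) :=
      ((tendsto_integral_diskPoisson hδ hδπ).sub (hbdry.mul_const _)).const_mul _
    have hpi : (2 * π)⁻¹ * (2 * π - 0 * (δ - (-δ))) = 1 := by
      have := pi_pos; field_simp; ring
    rw [hpi] at h1
    refine h1.congr' ?_
    filter_upwards [eventually_mem_Ioo_one (by norm_num : (0 : ℝ) < 1)] with R hR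
    have h2 := hparts R hR id (contDiff_id.contDiffOn (n := 1)).absolutelyContinuousOnInterval
    simp only [id, deriv_id, mul_one] at h2
    rw [h2, ← intervalIntegral.integral_of_le hle]
    simp only [hφ, intervalIntegral.integral_const_mul, neg_mul, intervalIntegral.integral_neg]
    ring
  have hpeak := tendsto_setIntegral_peak_smul_of_integrableOn_of_tendsto (μ := volume)
    (s := Ioc (-δ) δ) (t := Ioc (-δ) δ) (x₀ := (0 : ℝ)) (φ := φ) (l := 𝓝[<] (1 : ℝ)) (g := g)
    (a := c) measurableSet_Ioc measurableSet_Ioc subset_rfl self_mem_nhdsWithin (by simp) ?_ ?_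
    hmass ?_ ?_ ?_
  · have h1 : Tendsto (fun R => diskPoisson R δ * (V δ - V (-δ)) +
        2 * π * ∫ s in Ioc (-δ) δ, φ R s • g s) (𝓝[<] 1)
        (𝓝 (0 * (V δ - V (-δ)) + 2 * π * c)) :=
      (hbdry.mul_const _).add (hpeak.const_mul _)
    rw [zero_mul, zero_add] at h1
    refine h1.congr' ?_
    filter_upwards [eventually_mem_Ioo_one (by norm_num : (0 : ℝ) < 1)] with R hR
    have h2 := hparts R hR V hVac
    have h3 : ∫ s in -δ..δ, diskPoisson R s * deriv V s =
        ∫ s in -δ..δ, diskPoisson R s * u s := by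
      refine intervalIntegral.integral_congr_ae ?_
      filter_upwards [hVderiv] with s hs hmem
      rw [hs (uIoc_subset_uIcc hmem)]
    have h4 : ∀ s, φ R s • g s = (2 * π)⁻¹ * (-(deriv (diskPoisson R) s * V s)) := fun s => by
      simp only [hφ, smul_eq_mul]
      rw [← hgV s]
      ring
    rw [← h3, h2, ← intervalIntegral.integral_of_le hle]
    simp only [h4, intervalIntegral.integral_const_mul, intervalIntegral.integral_neg]
    have := pi_pos
    field_simp
    ring
  · filter_upwards [eventually_mem_Ioo_one (by norm_num : (0 : ℝ) < 1)] with R hR s hs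
    rw [hφeq R hR]
    have h1 := hss s ((habs s hs).trans hδπ)
    have h2 := hR.1
    have h3 : 0 ≤ 1 - R ^ 2 := by nlinarith [hR.1, hR.2]
    have := pi_pos
    positivity
  · intro U hU h0U
    obtain ⟨η₀, hη₀, hη₀U⟩ := Metric.isOpen_iff.mp hU 0 h0U
    set η := min η₀ π with hη
    have hη0 : 0 < η := lt_min hη₀ pi_pos
    have hηπ : η ≤ π := min_le_right _ _
    have hcos := one_sub_cos_pos hη0 hηπ
    rw [Metric.tendstoUniformlyOn_iff]
    intro ε hε
    have hlim : Tendsto (fun R : ℝ => (2 * π)⁻¹ * ((1 - R ^ 2) * (2 * δ) / (1 - cos η) ^ 2))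
        (𝓝[<] 1) (𝓝 0) := by
      have := ((tendsto_one_sub_sq.mul_const (2 * δ)).div_const ((1 - cos η) ^ 2)).const_mul
        (2 * π)⁻¹
      simpa using this
    filter_upwards [hlim.eventually (gt_mem_nhds hε),
      eventually_mem_Ioo_one (by norm_num : (1 / 2 : ℝ) < 1)] with R h1 hR s hs
    have hR0 : R ∈ Ioo (0 : ℝ) 1 := ⟨by linarith [hR.1], hR.2⟩
    have hs1 : η ≤ |s| := by
      by_contra hcon
      rw [not_le] at hcon
      refine hs.2 (hη₀U ?_)
      rw [mem_ball, Real.dist_eq, sub_zero]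
      exact hcon.trans_le (min_le_left _ _)
    have hs2 := habs s hs.1
    have hden := diskPoisson_denom_ge hR hη0.le hs1 (by linarith)
    rw [Pi.zero_apply, dist_comm, Real.dist_eq, sub_zero, hφeq R hR0]
    refine lt_of_le_of_lt ?_ h1
    have hR2 : 0 ≤ 1 - R ^ 2 := by nlinarith [hR0.1, hR0.2]
    have hs3 := hss s (hs2.trans hδπ)
    have hsin : sin s * s ≤ δ := by
      calc sin s * s ≤ |sin s * s| := le_abs_self _
        _ = |sin s| * |s| := abs_mul _ _
        _ ≤ 1 * δ := by gcongr; exact abs_sin_le_one s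
        _ = δ := one_mul δ
    have hpi := pi_pos
    rw [abs_of_nonneg (by have := hR0.1; positivity)]
    gcongr
    · have := hR0.2
      have h3 : 2 * R * (sin s * s) ≤ 2 * 1 * δ := by gcongr
      linarith
  · filter_upwards [eventually_mem_Ioo_one (by norm_num : (0 : ℝ) < 1)] with R hR
    exact (hφc R hR).aestronglyMeasurable
  · exact (hgc.integrableOn_Icc).mono_set Ioc_subset_Icc_self
  · rw [← hg0]
    exact (hgc.continuousAt (Icc_mem_nhds (by linarith) hδ)).tendsto.mono_left nhdsWithin_le_nhds

end Poisson

end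

/-! ### Fatou's theorem in the disc. -/

noncomputable section

section Fatou

open Metric Real

/-- Fatou's theorem for Poisson integrals of real functions. -/
theorem tendsto_integral_diskPoisson_sub_mul {v : ℝ → ℝ} (hv : IntervalIntegrable v volume (-π) π)
    {θ : ℝ} (hθ : θ ∈ Ioo (-π) π) (hd : HasDerivAt (fun x => ∫ t in θ..x, v t) (v θ) θ) :
    Tendsto (fun R => ∫ t in -π..π, diskPoisson R (t - θ) * v t) (𝓝[<] 1)
      (𝓝 (2 * π * v θ)) := by
  set δ := min (θ + π) (π - θ) with hδdef
  have hδ : 0 < δ := lt_min (by linarith [hθ.1]) (by linarith [hθ.2])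
  have hδ1 : δ ≤ θ + π := min_le_left _ _
  have hδ2 : δ ≤ π - θ := min_le_right _ _
  have hδπ : δ ≤ π := by linarith
  have hpi := pi_pos
  have hvsub : ∀ a ∈ Icc (-π) π, ∀ b ∈ Icc (-π) π, IntervalIntegrable v volume a b :=
    fun a ha b hb => hv.mono_set (uIcc_subset_uIcc (by rwa [uIcc_of_le (by linarith)])
      (by rwa [uIcc_of_le (by linarith)]))
  have hm1 : θ - δ ∈ Icc (-π) π := ⟨by linarith, by linarith⟩
  have hm2 : θ + δ ∈ Icc (-π) π := ⟨by linarith, by linarith⟩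
  have hmπ : π ∈ Icc (-π) π := ⟨by linarith, le_rfl⟩
  have hmπ' : -π ∈ Icc (-π) π := ⟨le_rfl, by linarith⟩
  have hshift : IntervalIntegrable (fun s => v (s + θ)) volume (-δ) δ := by
    have := (hvsub _ hm1 _ hm2).comp_add_right θ
    convert this using 1 <;> ring
  have hinner := tendsto_integral_diskPoisson_mul (c := v θ) hδ hδπ hshift (by
    have h1 : (fun s => ∫ x in (0 : ℝ)..s, v (x + θ)) = fun s => ∫ t in θ..s + θ, v t := by
      ext s
      rw [intervalIntegral.integral_comp_add_right (fun x => v x), zero_add]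
    rw [h1]
    have h2 : HasDerivAt (fun s : ℝ => s + θ) 1 0 := (hasDerivAt_id 0).add_const θ
    have h3 := HasDerivAt.scomp (0 : ℝ) (g₁ := fun x => ∫ t in θ..x, v t) (h := fun s => s + θ)
      (by rw [zero_add]; exact hd) h2
    rw [one_smul] at h3
    exact h3)
  -- Outside `(θ - δ, θ + δ)` the kernel is uniformly small, so that part is at most a small
  -- multiple of the integral `B` of `‖v‖`.
  have hdiff : Tendsto (fun R => (∫ t in -π..π, diskPoisson R (t - θ) * v t) -
      ∫ s in -δ..δ, diskPoisson R s * v (s + θ)) (𝓝[<] 1) (𝓝 0) := by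
    set B := ∫ t in -π..π, ‖v t‖ with hB
    have hB0 : 0 ≤ B := intervalIntegral.integral_nonneg (by linarith) fun _ _ => norm_nonneg _
    rw [Metric.tendsto_nhds]
    intro ε hε
    filter_upwards [eventually_diskPoisson_le hδ hδπ (by positivity : 0 < ε / (2 * B + 1)),
      eventually_mem_Ioo_one (by norm_num : (0 : ℝ) < 1)] with R h1 hR
    have hPc : Continuous fun t => diskPoisson R (t - θ) :=
      (continuous_diskPoisson hR).comp (continuous_id.sub continuous_const)
    have hi : ∀ a ∈ Icc (-π) π, ∀ b ∈ Icc (-π) π,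
        IntervalIntegrable (fun t => diskPoisson R (t - θ) * v t) volume a b :=
      fun a ha b hb => (hvsub a ha b hb).continuousOn_mul hPc.continuousOn
    have hs : ∫ s in -δ..δ, diskPoisson R s * v (s + θ) =
        ∫ t in θ - δ..θ + δ, diskPoisson R (t - θ) * v t := by
      have := intervalIntegral.integral_comp_add_right (a := -δ) (b := δ)
        (fun t => diskPoisson R (t - θ) * v t) θ
      simp only [add_sub_cancel_right] at this
      rw [this]
      congr 1 <;> ring
    have hsplit := intervalIntegral.integral_add_adjacent_intervals (hi _ hmπ' _ hm1)
      (hi _ hm1 _ hm2)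
    have hsplit2 := intervalIntegral.integral_add_adjacent_intervals (hi _ hmπ' _ hm2)
      (hi _ hm2 _ hmπ)
    have hbound : ∀ a ∈ Icc (-π) π, ∀ b ∈ Icc (-π) π, a ≤ b →
        (∀ t ∈ Ioc a b, δ ≤ |t - θ| ∧ |t - θ| ≤ 2 * π - δ) →
        ‖∫ t in a..b, diskPoisson R (t - θ) * v t‖ ≤ ε / (2 * B + 1) * B := by
      intro a ha b hb hab ht
      calc ‖∫ t in a..b, diskPoisson R (t - θ) * v t‖
          ≤ ∫ t in a..b, ε / (2 * B + 1) * ‖v t‖ := by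
            refine intervalIntegral.norm_integral_le_of_norm_le hab ?_
              (((hvsub a ha b hb).norm).const_mul _)
            refine Eventually.of_forall fun t htm => ?_
            rw [norm_mul, norm_of_nonneg (diskPoisson_nonneg hR _)]
            gcongr
            exact h1 _ (ht t htm).1 (ht t htm).2
        _ = ε / (2 * B + 1) * ∫ t in a..b, ‖v t‖ := intervalIntegral.integral_const_mul _ _
        _ ≤ ε / (2 * B + 1) * B := by
            gcongr
            refine intervalIntegral.integral_mono_interval ha.1 hab hb.2
              (Eventually.of_forall fun _ => norm_nonneg _) hv.norm
    have hb1 := hbound _ hmπ' _ hm1 hm1.1 fun t ht => by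
      rw [abs_of_nonpos (by linarith [ht.2])]
      constructor <;> linarith [ht.1, ht.2]
    have hb2 := hbound _ hm2 _ hmπ hm2.2 fun t ht => by
      rw [abs_of_nonneg (by linarith [ht.1])]
      constructor <;> linarith [ht.1, ht.2]
    rw [hs, ← hsplit2, ← hsplit, dist_zero_right]
    have h4 : ε / (2 * B + 1) * B + ε / (2 * B + 1) * B < ε := by
      have : ε / (2 * B + 1) * B + ε / (2 * B + 1) * B = ε * (2 * B / (2 * B + 1)) := by ring
      rw [this]
      have h5 : 2 * B / (2 * B + 1) < 1 := by rw [div_lt_one (by positivity)]; linarith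
      nlinarith
    refine lt_of_le_of_lt ?_ h4
    refine le_trans (le_of_eq ?_) ((norm_add_le _ _).trans (add_le_add hb1 hb2))
    congr 1
    ring
  have := hdiff.add hinner
  simpa using this

/-- Bounded families in a Hilbert space have weak limits along ultrafilters. -/
theorem exists_weak_limit {ι H : Type*} [NormedAddCommGroup H] [InnerProductSpace ℂ H]
    [CompleteSpace H] (U : Ultrafilter ι) (v : ι → H) {C : ℝ} (hv : ∀ᶠ i in U, ‖v i‖ ≤ C) :
    ∃ u : H, ∀ ψ : H, Tendsto (fun i => inner ℂ ψ (v i)) U (𝓝 (inner ℂ ψ u)) := by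
  -- Banach–Alaoglu in the dual space; the Riesz isomorphism is antilinear, which accounts for the
  -- conjugations.
  set K := (WeakDual.toStrongDual (𝕜 := ℂ) (E := H)) ⁻¹' closedBall 0 C with hK
  have hKc : IsCompact K := WeakDual.isCompact_closedBall 0 C
  let Λ : ι → WeakDual ℂ H := fun i =>
    StrongDual.toWeakDual (InnerProductSpace.toDual ℂ H (v i))
  have hΛ : ∀ᶠ i in U, Λ i ∈ K := by
    filter_upwards [hv] with i hi
    change InnerProductSpace.toDual ℂ H (v i) ∈ closedBall 0 C
    simpa using hi
  obtain ⟨l, -, hl⟩ := hKc.ultrafilter_le_nhds (U.map Λ) (by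
    rw [le_principal_iff]; exact hΛ)
  refine ⟨(InnerProductSpace.toDual ℂ H).symm (WeakDual.toStrongDual l), fun ψ => ?_⟩
  have h1 : Tendsto (fun i => Λ i ψ) U (𝓝 (l ψ)) :=
    ((WeakDual.eval_continuous ψ).tendsto l).comp hl
  have h2 := (Complex.continuous_conj.tendsto _).comp h1
  have h3 : conj (l ψ) =
      inner ℂ ψ ((InnerProductSpace.toDual ℂ H).symm (WeakDual.toStrongDual l)) := by
    rw [← inner_conj_symm, InnerProductSpace.toDual_symm_apply]
    rfl
  rw [← h3]
  refine h2.congr fun i => ?_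
  change conj (inner ℂ (v i) ψ) = _
  rw [inner_conj_symm]

/-- The arc-length measure on `(-π, π]`. -/
abbrev arcMeasure : Measure ℝ := volume.restrict (Ioc (-π) π)

theorem continuous_dilate_circleMap {f : ℂ → ℂ} (hf : ContinuousOn f (ball 0 1)) {r : ℝ}
    (hr : r ∈ Ioo (0 : ℝ) 1) : Continuous fun θ => f (circleMap 0 r θ) :=
  hf.comp_continuous (continuous_circleMap 0 r) fun θ => by simp [abs_of_pos hr.1, hr.2]

theorem memLp_arcMeasure_of_continuous {u : ℝ → ℂ} (hu : Continuous u) :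
    MemLp u 2 arcMeasure := by
  obtain ⟨C, hC⟩ := (isCompact_Icc (a := -π) (b := π)).exists_bound_of_continuousOn hu.continuousOn
  refine MemLp.of_bound hu.aestronglyMeasurable C ?_
  rw [ae_restrict_iff' measurableSet_Ioc]
  exact Eventually.of_forall fun t ht => hC t (Ioc_subset_Icc_self ht)

/-- A holomorphic function on the disc with bounded square means is the Poisson integral of a
square integrable function. -/
theorem exists_poisson_representation {f : ℂ → ℂ} (hf : DifferentiableOn ℂ f (ball 0 1))
    {C : ℝ≥0∞} (hC : C ≠ ⊤) (hbdd : ∃ᶠ r in 𝓝[<] (1 : ℝ),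
      ∫⁻ θ, ‖f (circleMap 0 r θ)‖ₑ ^ 2 ∂arcMeasure ≤ C) :
    ∃ u : Lp ℂ 2 arcMeasure, ∀ R ∈ Ioo (0 : ℝ) 1, ∀ θ,
      ∫ t in -π..π, (diskPoisson R (t - θ) : ℂ) * u t = 2 * π * f (circleMap 0 R θ) := by
  have hneg : -π ≤ π := by linarith [pi_pos]
  have hIoo : ∀ᶠ r in 𝓝[<] (1 : ℝ), r ∈ Ioo (0 : ℝ) 1 := eventually_mem_Ioo_one one_pos
  -- It suffices that the means be bounded for radii arbitrarily close to `1`: the ultrafilter is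
  -- chosen along those radii. On slices of a domain only a bound on a lower limit is available.
  set l := 𝓝[<] (1 : ℝ) ⊓ 𝓟 {r | ∫⁻ θ, ‖f (circleMap 0 r θ)‖ₑ ^ 2 ∂arcMeasure ≤ C} with hl
  have hlne : l.NeBot := Filter.frequently_iff_neBot.mp hbdd
  set U := Ultrafilter.of l with hU
  have hUl : (U : Filter ℝ) ≤ l := Ultrafilter.of_le l
  have hU1 : (U : Filter ℝ) ≤ 𝓝[<] 1 := hUl.trans inf_le_left
  have hUC : ∀ᶠ r in (U : Filter ℝ), ∫⁻ θ, ‖f (circleMap 0 r θ)‖ₑ ^ 2 ∂arcMeasure ≤ C :=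
    hUl (mem_inf_of_right (mem_principal_self _))
  have hmem : ∀ r ∈ Ioo (0 : ℝ) 1, MemLp (fun θ => f (circleMap 0 r θ)) 2 arcMeasure :=
    fun r hr => memLp_arcMeasure_of_continuous (continuous_dilate_circleMap hf.continuousOn hr)
  classical
  let v : ℝ → Lp ℂ 2 arcMeasure := fun r =>
    if hr : r ∈ Ioo (0 : ℝ) 1 then (hmem r hr).toLp _ else 0
  obtain ⟨u, hu⟩ := exists_weak_limit U v (C := (C ^ (1 / 2 : ℝ)).toReal) (by
    filter_upwards [hU1 hIoo, hUC] with r hr hrC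
    simp only [v, dif_pos hr]
    rw [Lp.norm_toLp]
    refine ENNReal.toReal_mono (ENNReal.rpow_ne_top_of_nonneg (by norm_num) hC) ?_
    rw [eLpNorm_eq_lintegral_rpow_enorm_toReal two_ne_zero ENNReal.ofNat_ne_top]
    simp only [ENNReal.toReal_ofNat, ENNReal.rpow_ofNat]
    gcongr)
  refine ⟨u, fun R hR θ => ?_⟩
  have hPc : Continuous fun t => ((diskPoisson R (t - θ) : ℝ) : ℂ) :=
    Complex.continuous_ofReal.comp ((continuous_diskPoisson hR).comp (by fun_prop))
  have hP := memLp_arcMeasure_of_continuous hPc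
  have hinner : ∀ w : Lp ℂ 2 arcMeasure, inner ℂ (hP.toLp _) w =
      ∫ t in -π..π, (diskPoisson R (t - θ) : ℂ) * w t := by
    intro w
    rw [intervalIntegral.integral_of_le hneg, L2.inner_def]
    refine integral_congr_ae ?_
    filter_upwards [hP.coeFn_toLp] with t ht
    rw [ht, RCLike.inner_apply]
    simp [mul_comm]
  -- The dilates satisfy the Poisson formula on the closed disc. Along the ultrafilter one side
  -- converges by weak convergence against the kernel, the other by continuity of `f` inside.
  have h1 := hu (hP.toLp _)
  rw [hinner] at h1
  have h2 : Tendsto (fun r : ℝ => 2 * π * f (circleMap 0 (r * R) θ)) U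
      (𝓝 (2 * π * f (circleMap 0 R θ))) := by
    refine Tendsto.mono_left ?_ (hU1.trans nhdsWithin_le_nhds)
    refine Tendsto.const_mul _ ?_
    have hc : ContinuousAt f (circleMap 0 R θ) :=
      hf.continuousOn.continuousAt (isOpen_ball.mem_nhds (by simp [abs_of_pos hR.1, hR.2]))
    have h3 : Tendsto (fun r : ℝ => circleMap 0 (r * R) θ) (𝓝 1) (𝓝 (circleMap 0 R θ)) := by
      have : Continuous fun r : ℝ => circleMap 0 (r * R) θ := by
        simp only [circleMap]; fun_prop
      simpa using this.tendsto 1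
    exact hc.tendsto.comp h3
  refine tendsto_nhds_unique h1 (h2.congr' ?_)
  filter_upwards [hU1 hIoo] with r hr
  simp only [v, dif_pos hr]
  rw [hinner]
  have hg : DiffContOnCl ℂ (fun z => f (r * z)) (ball 0 1) := by
    refine DifferentiableOn.diffContOnCl (hf.comp (by fun_prop) fun z hz => ?_)
    rw [closure_ball _ one_ne_zero] at hz
    have hz' : ‖z‖ ≤ 1 := by simpa using hz
    rw [mem_ball_zero_iff, norm_mul, Complex.norm_real, norm_of_nonneg hr.1.le]
    nlinarith [hr.1, hr.2, norm_nonneg z]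
  have h3 := integral_diskPoisson_mul hg hR θ
  have h4 : ∀ ρ t : ℝ, (r : ℂ) * circleMap 0 ρ t = circleMap 0 (r * ρ) t := fun ρ t => by
    simp [circleMap, mul_assoc]
  simp only [h4, mul_one] at h3
  rw [← h3, intervalIntegral.integral_of_le hneg, intervalIntegral.integral_of_le hneg]
  refine integral_congr_ae ?_
  filter_upwards [(hmem r hr).coeFn_toLp] with t ht
  rw [ht]

/-- The Cauchy-Schwarz inequality for weighted square means. -/
theorem sq_lintegral_mul_le {α : Type*} [MeasurableSpace α] {μ : Measure α} {p h : α → ℝ≥0∞}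
    (hp : AEMeasurable p μ) (hh : AEMeasurable h μ) :
    (∫⁻ a, p a * h a ∂μ) ^ 2 ≤ (∫⁻ a, p a ∂μ) * ∫⁻ a, p a * h a ^ 2 ∂μ := by
  have h1 := ENNReal.lintegral_mul_le_Lp_mul_Lq μ Real.HolderConjugate.two_two
    (f := fun a => p a ^ (1 / 2 : ℝ)) (g := fun a => p a ^ (1 / 2 : ℝ) * h a)
    (hp.pow_const _) ((hp.pow_const _).mul hh)
  have h2 : ∀ x : ℝ≥0∞, (x ^ (1 / 2 : ℝ)) ^ (2 : ℝ) = x := fun x => by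
    rw [← ENNReal.rpow_mul]; norm_num
  have h3 : ∀ x : ℝ≥0∞, x ^ (1 / 2 : ℝ) * x ^ (1 / 2 : ℝ) = x := fun x => by
    rw [← ENNReal.rpow_add_of_nonneg _ _ (by norm_num) (by norm_num)]; norm_num
  simp only [Pi.mul_apply, ← mul_assoc, h3, ENNReal.mul_rpow_of_nonneg _ _ zero_le_two, h2] at h1
  have h4 : ∀ x : ℝ≥0∞, x ^ (2 : ℝ) = x ^ 2 := fun x => by norm_cast
  simp only [h4] at h1
  calc (∫⁻ a, p a * h a ∂μ) ^ 2
      ≤ ((∫⁻ a, p a ∂μ) ^ (1 / 2 : ℝ) * (∫⁻ a, p a * h a ^ 2 ∂μ) ^ (1 / 2 : ℝ)) ^ 2 := by gcongr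
    _ = _ := by rw [mul_pow, ← h4, ← h4, h2, h2]

theorem lintegral_diskPoisson {R : ℝ} (hR : R ∈ Ioo (0 : ℝ) 1) (θ : ℝ) :
    ∫⁻ t, ENNReal.ofReal (diskPoisson R (t - θ)) ∂arcMeasure = ENNReal.ofReal (2 * π) := by
  have hneg : -π ≤ π := by linarith [pi_pos]
  have hc : Continuous fun t => diskPoisson R (t - θ) :=
    (continuous_diskPoisson hR).comp (by fun_prop)
  rw [← integral_diskPoisson hR θ, intervalIntegral.integral_of_le hneg,
    ofReal_integral_eq_lintegral_ofReal]
  · exact (hc.integrableOn_Icc (a := -π) (b := π)).mono_set Ioc_subset_Icc_self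
  · exact Eventually.of_forall fun t => diskPoisson_nonneg hR _

/-- The square of a Poisson integral is at most the Poisson integral of the square. -/
theorem enorm_sq_le_of_poisson {u : ℝ → ℂ} (hu : AEStronglyMeasurable u arcMeasure) {R θ : ℝ}
    (hR : R ∈ Ioo (0 : ℝ) 1) {z : ℂ}
    (hz : ∫ t in -π..π, (diskPoisson R (t - θ) : ℂ) * u t = 2 * π * z) :
    ENNReal.ofReal (2 * π) * ‖z‖ₑ ^ 2 ≤
      ∫⁻ t, ENNReal.ofReal (diskPoisson R (t - θ)) * ‖u t‖ₑ ^ 2 ∂arcMeasure := by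
  have hneg : -π ≤ π := by linarith [pi_pos]
  have hpi : ‖(2 * π : ℂ)‖ₑ = ENNReal.ofReal (2 * π) := by
    rw [show (2 * π : ℂ) = ((2 * π : ℝ) : ℂ) by push_cast; ring, ← ofReal_norm,
      Complex.norm_real, norm_of_nonneg (by positivity)]
  have h1 : ENNReal.ofReal (2 * π) * ‖z‖ₑ ≤
      ∫⁻ t, ENNReal.ofReal (diskPoisson R (t - θ)) * ‖u t‖ₑ ∂arcMeasure := by
    rw [← hpi, ← enorm_mul, ← hz, intervalIntegral.integral_of_le hneg]
    refine (enorm_integral_le_lintegral_enorm _).trans (le_of_eq ?_)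
    refine lintegral_congr fun t => ?_
    rw [enorm_mul, ← ofReal_norm, Complex.norm_real,
      norm_of_nonneg (diskPoisson_nonneg hR _)]
  have hc : Continuous fun t => diskPoisson R (t - θ) :=
    (continuous_diskPoisson hR).comp (by fun_prop)
  have h2 := sq_lintegral_mul_le (μ := arcMeasure)
    (p := fun t => ENNReal.ofReal (diskPoisson R (t - θ))) (h := fun t => ‖u t‖ₑ)
    (ENNReal.measurable_ofReal.comp hc.measurable).aemeasurable hu.enorm
  rw [lintegral_diskPoisson hR] at h2
  have h3 : (ENNReal.ofReal (2 * π) * ‖z‖ₑ) ^ 2 ≤ _ := (by gcongr : _ ≤ _).trans h2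
  rw [mul_pow, sq (ENNReal.ofReal (2 * π)), mul_assoc] at h3
  have hpos : ENNReal.ofReal (2 * π) ≠ 0 := by simp [pi_pos]
  exact (ENNReal.mul_le_mul_iff_right hpos ENNReal.ofReal_ne_top).mp h3

/-- **Fatou's theorem** for the Hardy space `H²` of the disc. -/
theorem exists_radial_limit_of_frequently_bounded {f : ℂ → ℂ}
    (hf : DifferentiableOn ℂ f (ball 0 1)) {C : ℝ≥0∞} (hC : C ≠ ⊤)
    (hbdd : ∃ᶠ r in 𝓝[<] (1 : ℝ), ∫⁻ θ, ‖f (circleMap 0 r θ)‖ₑ ^ 2 ∂arcMeasure ≤ C) :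
    ∃ u : Lp ℂ 2 arcMeasure,
      (∀ᵐ θ ∂arcMeasure, Tendsto (fun r : ℝ => f (circleMap 0 r θ)) (𝓝[<] 1) (𝓝 (u θ))) ∧
      ∀ r ∈ Ioo (0 : ℝ) 1, ∫⁻ θ, ‖f (circleMap 0 r θ)‖ₑ ^ 2 ∂arcMeasure ≤
        ∫⁻ θ, ‖u θ‖ₑ ^ 2 ∂arcMeasure := by
  have hneg : -π ≤ π := by linarith [pi_pos]
  have hpi := pi_pos
  obtain ⟨u, hu⟩ := exists_poisson_representation hf hC hbdd
  refine ⟨u, ?_, fun R hR => ?_⟩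
  · have hi : IntervalIntegrable u volume (-π) π := by
      rw [intervalIntegrable_iff_integrableOn_Ioc_of_le hneg]
      exact (Lp.memLp u).integrable one_le_two
    have hre : IntervalIntegrable (fun t => (u t).re) volume (-π) π :=
      ⟨hi.1.re, hi.2.re⟩
    have him : IntervalIntegrable (fun t => (u t).im) volume (-π) π :=
      ⟨hi.1.im, hi.2.im⟩
    -- The endpoint is excluded because the local argument needs a two-sided neighbourhood inside
    -- the interval.
    have hne : ∀ᵐ θ ∂(volume : Measure ℝ), θ ≠ π := by simp [ae_iff, measure_singleton]
    rw [ae_restrict_iff' measurableSet_Ioc]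
    filter_upwards [hre.ae_hasDerivAt_integral, him.ae_hasDerivAt_integral, hne]
      with θ h1 h2 hθπ hθ
    have hmem : θ ∈ uIcc (-π) π := by rw [uIcc_of_le hneg]; exact Ioc_subset_Icc_self hθ
    have hθ' : θ ∈ Ioo (-π) π := ⟨hθ.1, lt_of_le_of_ne hθ.2 hθπ⟩
    have h3 := tendsto_integral_diskPoisson_sub_mul hre hθ' (h1 hmem θ hmem)
    have h4 := tendsto_integral_diskPoisson_sub_mul him hθ' (h2 hmem θ hmem)
    have h5 : Tendsto (fun R : ℝ => (2 * π : ℂ)⁻¹ *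
        (((∫ t in -π..π, diskPoisson R (t - θ) * (u t).re : ℝ) : ℂ) +
          ((∫ t in -π..π, diskPoisson R (t - θ) * (u t).im : ℝ) : ℂ) * Complex.I)) (𝓝[<] 1)
        (𝓝 ((2 * π : ℂ)⁻¹ * (((2 * π * (u θ).re : ℝ) : ℂ) +
          ((2 * π * (u θ).im : ℝ) : ℂ) * Complex.I))) :=
      (((Complex.continuous_ofReal.tendsto _).comp h3).add
        (((Complex.continuous_ofReal.tendsto _).comp h4).mul_const _)).const_mul _
    have h6 : (2 * π : ℂ)⁻¹ * (((2 * π * (u θ).re : ℝ) : ℂ) +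
          ((2 * π * (u θ).im : ℝ) : ℂ) * Complex.I) = u θ := by
      have : (π : ℂ) ≠ 0 := by exact_mod_cast hpi.ne'
      conv_rhs => rw [← Complex.re_add_im (u θ)]
      push_cast
      field_simp
    rw [h6] at h5
    refine h5.congr' ?_
    filter_upwards [eventually_mem_Ioo_one one_pos] with R hR
    have h7 := hu R hR θ
    have hPc : Continuous fun t => diskPoisson R (t - θ) :=
      (continuous_diskPoisson hR).comp (by fun_prop)
    have h8 : ∫ t in -π..π, (diskPoisson R (t - θ) : ℂ) * u t =
        ((∫ t in -π..π, diskPoisson R (t - θ) * (u t).re : ℝ) : ℂ) +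
          ((∫ t in -π..π, diskPoisson R (t - θ) * (u t).im : ℝ) : ℂ) * Complex.I := by
      rw [← intervalIntegral.integral_ofReal, ← intervalIntegral.integral_ofReal,
        ← intervalIntegral.integral_mul_const, ← intervalIntegral.integral_add]
      · refine intervalIntegral.integral_congr fun t _ => ?_
        simp only [Complex.ofReal_mul]
        conv_lhs => rw [← Complex.re_add_im (u t)]
        ring
      · have := hre.continuousOn_mul hPc.continuousOn
        exact ⟨this.1.ofReal, this.2.ofReal⟩
      · have := him.continuousOn_mul hPc.continuousOn
        exact ⟨this.1.ofReal.mul_const _, this.2.ofReal.mul_const _⟩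
    rw [← h8, h7]
    have : (π : ℂ) ≠ 0 := by exact_mod_cast hpi.ne'
    field_simp
  · have hpos : ENNReal.ofReal (2 * π) ≠ 0 := by simp [pi_pos]
    have hum : AEMeasurable (fun t => ‖u t‖ₑ ^ 2) arcMeasure :=
      ((Lp.aestronglyMeasurable u).enorm).pow_const 2
    have hc : Continuous fun x : ℝ × ℝ => diskPoisson R (x.2 - x.1) :=
      (continuous_diskPoisson hR).comp (by fun_prop)
    rw [← ENNReal.mul_le_mul_iff_right hpos ENNReal.ofReal_ne_top,
      ← lintegral_const_mul' _ _ ENNReal.ofReal_ne_top]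
    -- The Poisson integral is a contraction in `L²`: pointwise Cauchy–Schwarz, Tonelli, and the
    -- symmetry of the kernel, whose integral in either variable is `2 * π`.
    calc ∫⁻ θ, ENNReal.ofReal (2 * π) * ‖f (circleMap 0 R θ)‖ₑ ^ 2 ∂arcMeasure
        ≤ ∫⁻ θ, ∫⁻ t, ENNReal.ofReal (diskPoisson R (t - θ)) * ‖u t‖ₑ ^ 2 ∂arcMeasure
            ∂arcMeasure :=
          lintegral_mono fun θ =>
            enorm_sq_le_of_poisson (Lp.aestronglyMeasurable u) hR (hu R hR θ)
      _ = ∫⁻ t, ∫⁻ θ, ENNReal.ofReal (diskPoisson R (t - θ)) * ‖u t‖ₑ ^ 2 ∂arcMeasure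
            ∂arcMeasure := by
          refine lintegral_lintegral_swap ?_
          exact (ENNReal.measurable_ofReal.comp hc.measurable).aemeasurable.mul hum.comp_snd
      _ = ∫⁻ t, ENNReal.ofReal (2 * π) * ‖u t‖ₑ ^ 2 ∂arcMeasure := by
          refine lintegral_congr fun t => ?_
          have hct : Continuous fun θ => diskPoisson R (t - θ) :=
            (continuous_diskPoisson hR).comp (by fun_prop)
          have hm : Measurable fun θ => ENNReal.ofReal (diskPoisson R (t - θ)) :=
            ENNReal.measurable_ofReal.comp hct.measurable
          rw [lintegral_mul_const _ hm]
          congr 1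
          rw [← lintegral_diskPoisson hR t]
          refine lintegral_congr fun θ => ?_
          rw [diskPoisson, diskPoisson, ← cos_neg, neg_sub]
      _ = _ := lintegral_const_mul' _ _ ENNReal.ofReal_ne_top

end Fatou

end

/-! ### Point evaluations and boundary uniqueness in the disc. -/

noncomputable section

section DiscEstimates

open Metric Real

/-- The kernel is largest at `s = 0`, where it equals `(1 + R) / (1 - R)`. -/
theorem diskPoisson_le {R c : ℝ} (hR : R ∈ Ioo (0 : ℝ) 1) (hRc : R ≤ c) (hc : c < 1) (s : ℝ) :
    diskPoisson R s ≤ 2 / (1 - c) := by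
  have h1 : 0 < 1 - R := by linarith [hR.2]
  have h2 : (1 - R) ^ 2 ≤ 1 - 2 * R * cos s + R ^ 2 := by
    nlinarith [cos_le_one s, hR.1]
  calc diskPoisson R s ≤ (1 - R ^ 2) / (1 - R) ^ 2 := by
        unfold diskPoisson
        gcongr
        nlinarith [hR.1, hR.2]
    _ = (1 + R) / (1 - R) := by field_simp; ring
    _ ≤ 2 / (1 - c) := by
        gcongr
        all_goals linarith [hR.2]

/-- Point evaluations are bounded by square means over the unit circle. -/
theorem enorm_sq_le_lintegral_circle {g : ℂ → ℂ} (hg : DiffContOnCl ℂ g (ball 0 1)) {c : ℝ}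
    (hc0 : 0 < c) (hc : c < 1) {w : ℂ} (hw : ‖w‖ ≤ c) :
    ‖g w‖ₑ ^ 2 ≤ ENNReal.ofReal (2 / (1 - c)) *
      ∫⁻ t, ‖g (circleMap 0 1 t)‖ₑ ^ 2 ∂arcMeasure := by
  have hgc : ContinuousOn g (closedBall 0 1) := by
    have := hg.continuousOn
    rwa [closure_ball _ one_ne_zero] at this
  have hgm : Continuous fun t => g (circleMap 0 1 t) :=
    hgc.comp_continuous (continuous_circleMap 0 1) fun t => by simp
  have hpi : (1 : ℝ≥0∞) ≤ ENNReal.ofReal (2 * π) := by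
    rw [ENNReal.one_le_ofReal]; linarith [pi_gt_three]
  -- The Poisson formula above requires a positive radius; the centre is recovered at the end by
  -- continuity.
  have key : ∀ w : ℂ, w ≠ 0 → ‖w‖ ≤ c → ‖g w‖ₑ ^ 2 ≤ ENNReal.ofReal (2 / (1 - c)) *
      ∫⁻ t, ‖g (circleMap 0 1 t)‖ₑ ^ 2 ∂arcMeasure := by
    intro w hw0 hw
    have hR : ‖w‖ ∈ Ioo (0 : ℝ) 1 := ⟨norm_pos_iff.mpr hw0, by linarith⟩
    have hwc : circleMap 0 ‖w‖ w.arg = w := by simp [circleMap]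
    have h1 := enorm_sq_le_of_poisson hgm.aestronglyMeasurable hR
      (integral_diskPoisson_mul hg hR w.arg)
    rw [hwc] at h1
    calc ‖g w‖ₑ ^ 2 ≤ ENNReal.ofReal (2 * π) * ‖g w‖ₑ ^ 2 := le_mul_of_one_le_left' hpi
      _ ≤ _ := h1
      _ ≤ ∫⁻ t, ENNReal.ofReal (2 / (1 - c)) * ‖g (circleMap 0 1 t)‖ₑ ^ 2 ∂arcMeasure := by
        gcongr with t
        exact diskPoisson_le hR hw hc _
      _ = _ := lintegral_const_mul' _ _ ENNReal.ofReal_ne_top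
  rcases ne_or_eq w 0 with hw0 | rfl
  · exact key w hw0 hw
  have hcont : Tendsto (fun r : ℝ => ‖g (r : ℂ)‖ₑ ^ 2) (𝓝[>] 0) (𝓝 (‖g 0‖ₑ ^ 2)) := by
    have h1 : ContinuousAt g 0 := hgc.continuousAt (closedBall_mem_nhds _ one_pos)
    have h2 : Tendsto (fun r : ℝ => (r : ℂ)) (𝓝[>] 0) (𝓝 0) := by
      have := Complex.continuous_ofReal.tendsto 0
      rw [Complex.ofReal_zero] at this
      exact this.mono_left nhdsWithin_le_nhds
    exact ((ENNReal.continuous_pow 2).tendsto _).comp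
      ((continuous_enorm.tendsto _).comp (h1.tendsto.comp h2))
  refine le_of_tendsto hcont ?_
  filter_upwards [Ioo_mem_nhdsGT hc0] with r hr
  refine key _ (by exact_mod_cast hr.1.ne') ?_
  rw [Complex.norm_real, norm_of_nonneg hr.1.le]
  exact hr.2.le

/-- A lower bound for the mean of `log |h|` over circles close to the unit circle. -/
theorem exists_le_circleAverage_log_norm {h : ℂ → ℂ} (hd : DifferentiableOn ℂ h (ball 0 1)) :
    ∃ M : ℝ, ∀ r ∈ Ioo (1 / 2 : ℝ) 1, M ≤ circleAverage (fun z => log ‖h z‖) 0 r := by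
  have han : AnalyticOnNhd ℂ h (ball 0 1) := hd.analyticOnNhd isOpen_ball
  refine ⟨((meromorphicOrderAt h 0).untop₀ : ℝ) * log (1 / 2) +
    log ‖meromorphicTrailingCoeffAt h 0‖, fun r hr => ?_⟩
  have hr0 : 0 < r := by linarith [hr.1]
  have hsub : closedBall (0 : ℂ) |r| ⊆ ball 0 1 := by
    rw [abs_of_pos hr0]; exact closedBall_subset_ball hr.2
  have hanr := han.mono hsub
  have hnn : ∀ u, 0 ≤ MeromorphicOn.divisor h (closedBall 0 |r|) u :=
    fun u => MeromorphicOn.AnalyticOnNhd.divisor_nonneg hanr u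
  -- Jensen's formula. The sum over the zeros is nonnegative because `h` has no poles, and the
  -- remaining terms depend on `r` only through `log r ≥ log (1 / 2)`.
  rw [MeromorphicOn.circleAverage_log_norm hr0.ne' hanr.meromorphicOn, add_assoc]
  have h1 : 0 ≤ ∑ᶠ u, (MeromorphicOn.divisor h (closedBall 0 |r|) u : ℝ) *
      log (r * ‖0 - u‖⁻¹) := by
    refine finsum_nonneg fun u => ?_
    by_cases hu : u ∈ closedBall (0 : ℂ) |r|
    · refine mul_nonneg (by exact_mod_cast hnn u) ?_
      -- At the centre the conventions `0⁻¹ = 0` and `log 0 = 0` make the term vanish; its true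
      -- contribution is the separate term with the order at `0`.
      rcases eq_or_ne u 0 with rfl | hu0
      · simp
      · refine log_nonneg ?_
        have : 0 < ‖u‖ := norm_pos_iff.mpr hu0
        rw [abs_of_pos hr0, mem_closedBall_zero_iff] at hu
        rw [zero_sub, norm_neg, ← div_eq_mul_inv, one_le_div this]
        exact hu
    · simp [hu]
  have h2 : MeromorphicOn.divisor h (closedBall 0 |r|) 0 = (meromorphicOrderAt h 0).untop₀ :=
    MeromorphicOn.divisor_apply hanr.meromorphicOn (by simp)
  have h3 := hnn 0
  rw [h2] at h3 ⊢
  have h4 : log (1 / 2) ≤ log r := log_le_log (by norm_num) hr.1.le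
  have h5 : (0 : ℝ) ≤ ((meromorphicOrderAt h 0).untop₀ : ℝ) := by exact_mod_cast h3
  nlinarith

/-- The boundary uniqueness theorem in the disc. -/
theorem eqOn_zero_of_arcMeasure_pos {h : ℂ → ℂ} (hc : ContinuousOn h (closedBall 0 1))
    (hd : DifferentiableOn ℂ h (ball 0 1))
    (hpos : arcMeasure {θ | h (circleMap 0 1 θ) = 0} ≠ 0) : EqOn h 0 (closedBall 0 1) := by
  have hpi := pi_pos
  suffices hball : EqOn h 0 (ball 0 1) by
    have := hball.of_subset_closure hc continuousOn_const ball_subset_closedBall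
      (by rw [closure_ball _ one_ne_zero])
    exact this
  by_contra hne
  have han : AnalyticOnNhd ℂ h (ball 0 1) := hd.analyticOnNhd isOpen_ball
  -- The lower bound `M` persists for the truncated logarithm up to the unit circle. There the part
  -- of positive measure where `h = 0` contributes a multiple of `log δ`, which is unbounded below
  -- as `δ` tends to `0`.
  obtain ⟨M, hM⟩ := exists_le_circleAverage_log_norm hd
  obtain ⟨C, hC⟩ := (isCompact_closedBall (0 : ℂ) 1).exists_bound_of_continuousOn hc
  set C' := max C 1 with hC'
  have hC1 : 1 ≤ C' := le_max_right _ _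
  have hCb : ∀ z ∈ closedBall (0 : ℂ) 1, ‖h z‖ ≤ C' := fun z hz => (hC z hz).trans (le_max_left _ _)
  have hmap : ∀ r ∈ Ioc (0 : ℝ) 1, ∀ θ, circleMap 0 r θ ∈ closedBall (0 : ℂ) 1 := fun r hr θ => by
    simp [abs_of_pos hr.1, hr.2]
  have hcirc : ∀ r ∈ Ioc (0 : ℝ) 1, Continuous fun θ => h (circleMap 0 r θ) := fun r hr =>
    hc.comp_continuous (continuous_circleMap 0 r) (hmap r hr)
  have hlog : ∀ δ ∈ Ioo (0 : ℝ) 1, ∀ r ∈ Ioc (0 : ℝ) 1,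
      Continuous fun θ => log (max ‖h (circleMap 0 r θ)‖ δ) := fun δ hδ r hr =>
    Continuous.log (((hcirc r hr).norm).max continuous_const) fun θ =>
      (lt_of_lt_of_le hδ.1 (le_max_right _ _)).ne'
  -- the means of `log (max |h| δ)` on circles inside
  have hstep : ∀ δ ∈ Ioo (0 : ℝ) 1, ∀ r ∈ Ioo (1 / 2 : ℝ) 1,
      M ≤ circleAverage (fun z => log (max ‖h z‖ δ)) 0 r := by
    intro δ hδ r hr
    have hr0 : 0 < r := by linarith [hr.1]
    have hr' : r ∈ Ioc (0 : ℝ) 1 := ⟨hr0, hr.2.le⟩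
    have hanz : ∀ᶠ z in codiscreteWithin (sphere (0 : ℂ) |r|), h z ≠ 0 := by
      obtain ⟨z0, hz0, hz0'⟩ : ∃ z ∈ ball (0 : ℂ) 1, h z ≠ 0 := by
        by_contra hcon
        push Not at hcon
        exact hne fun z hz => hcon z hz
      have h1 := han.preimage_zero_mem_codiscreteWithin hz0' hz0
        (isConnected_ball one_pos)
      have hs : sphere (0 : ℂ) |r| ⊆ ball 0 1 := by
        rw [abs_of_pos hr0]; exact sphere_subset_ball hr.2
      exact codiscreteWithin_mono hs h1
    -- With `log 0 = 0` the inequality `log ‖h‖ ≤ log (max ‖h‖ δ)` fails at zeros of `h`. Redefining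
    -- the value on this discrete set repairs it without changing the mean.
    have h2 : circleAverage (fun z => log ‖h z‖) 0 r =
        circleAverage (fun z => if h z = 0 then log δ else log ‖h z‖) 0 r := by
      refine circleAverage_congr_codiscreteWithin ?_ hr0.ne'
      filter_upwards [hanz] with z hz
      simp [hz]
    have h3 := hM r hr
    have hint : CircleIntegrable (fun z => log ‖h z‖) 0 r := by
      refine MeromorphicOn.circleIntegrable_log_norm (han.mono ?_).meromorphicOn
      rw [abs_of_pos hr0]; exact sphere_subset_ball hr.2
    have hint2 : CircleIntegrable (fun z => if h z = 0 then log δ else log ‖h z‖) 0 r := by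
      refine hint.congr_codiscreteWithin ?_
      filter_upwards [hanz] with z hz
      simp [hz]
    have hint3 : CircleIntegrable (fun z => log (max ‖h z‖ δ)) 0 r :=
      (hlog δ hδ r hr').intervalIntegrable _ _
    have h4 : circleAverage (fun z => if h z = 0 then log δ else log ‖h z‖) 0 r ≤
        circleAverage (fun z => log (max ‖h z‖ δ)) 0 r := by
      refine circleAverage_mono hint2 hint3 fun z _ => ?_
      split_ifs with hz
      · exact log_le_log hδ.1 (le_max_right _ _)
      · exact log_le_log (norm_pos_iff.mpr hz) (le_max_left _ _)
    rw [h2] at h3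
    exact h3.trans h4
  have hstep1 : ∀ δ ∈ Ioo (0 : ℝ) 1, M ≤ circleAverage (fun z => log (max ‖h z‖ δ)) 0 1 := by
    intro δ hδ
    have hcon : ContinuousOn (circleAverage (fun z => log (max ‖h z‖ δ)) 0) (Icc 0 1) := by
      refine ContinuousOn.circleAverage ?_ fun r hr => hr.1
      have hs : {z : ℂ | ‖z - 0‖ ∈ Icc (0 : ℝ) 1} = closedBall 0 1 := by
        ext z; simp
      rw [hs]
      exact ContinuousOn.log (hc.norm.sup continuousOn_const) fun z _ =>
        (lt_of_lt_of_le hδ.1 (le_max_right _ _)).ne'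
    have h1 := (hcon 1 (by simp)).mono_left (nhdsWithin_mono 1 Ioo_subset_Icc_self)
    rw [nhdsWithin_Ioo_eq_nhdsLT one_pos] at h1
    refine ge_of_tendsto h1 ?_
    filter_upwards [eventually_mem_Ioo_one (by norm_num : (1 / 2 : ℝ) < 1)] with r hr
    exact hstep δ hδ r hr
  have h1mem : (1 : ℝ) ∈ Ioc (0 : ℝ) 1 := by simp
  set A := {θ | h (circleMap 0 1 θ) = 0} with hA
  have hAm : MeasurableSet A := (isClosed_eq (hcirc 1 h1mem) continuous_const).measurableSet
  have ha : 0 < arcMeasure.real A :=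
    ENNReal.toReal_pos hpos (measure_ne_top _ _)
  have hbound : ∀ δ ∈ Ioo (0 : ℝ) 1, 2 * π * M ≤ 2 * π * log C' + arcMeasure.real A * log δ := by
    intro δ hδ
    have h1 := hstep1 δ hδ
    have hper : Function.Periodic (fun θ => log (max ‖h (circleMap 0 1 θ)‖ δ)) (2 * π) := fun θ => by
      simp [periodic_circleMap 0 1 θ]
    have h2 := hper.intervalIntegral_add_eq 0 (-π)
    rw [zero_add, show -π + 2 * π = π by ring] at h2
    rw [circleAverage_def, h2, intervalIntegral.integral_of_le (by linarith), smul_eq_mul,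
      inv_mul_eq_div, le_div_iff₀ (by positivity)] at h1
    have h3 : ∫ θ, log (max ‖h (circleMap 0 1 θ)‖ δ) ∂arcMeasure ≤
        ∫ θ, (log C' + A.indicator (fun _ => log δ) θ) ∂arcMeasure := by
      refine integral_mono ?_ ?_ fun θ => ?_
      · exact ((hlog δ hδ 1 h1mem).integrableOn_Icc (a := -π) (b := π)).mono_set Ioc_subset_Icc_self
      · exact (integrable_const _).add ((integrable_const _).indicator hAm)
      · by_cases hθ : θ ∈ A
        · have h0 : h (circleMap 0 1 θ) = 0 := hθ
          simp only [h0, norm_zero, max_eq_right hδ.1.le, indicator_of_mem hθ]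
          linarith [log_nonneg hC1]
        · simp only [indicator_of_notMem hθ, add_zero]
          exact log_le_log (lt_of_lt_of_le hδ.1 (le_max_right _ _))
            (max_le (hCb _ (hmap 1 h1mem θ)) (hδ.2.le.trans hC1))
    rw [integral_add (integrable_const _) ((integrable_const _).indicator hAm), integral_const,
      integral_indicator_const _ hAm] at h3
    have h4 : arcMeasure.real univ = 2 * π := by
      simp [measureReal_def]; rw [ENNReal.toReal_ofReal (by linarith)]; ring
    rw [h4, smul_eq_mul, smul_eq_mul] at h3
    linarith
  -- For `δ = exp (-max K 1)` the bound would give `2 * π * M ≤ 2 * π * M - arcMeasure.real A`; the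
  -- maximum with `1` ensures `δ < 1`.
  set K := (2 * π * log C' - 2 * π * M) / arcMeasure.real A + 1 with hK
  have hKpos : 0 < max K 1 := lt_max_of_lt_right one_pos
  have h1 := hbound (exp (-max K 1)) ⟨exp_pos _, by rw [exp_lt_one_iff]; linarith⟩
  rw [log_exp] at h1
  have h2 : arcMeasure.real A * K ≤ arcMeasure.real A * max K 1 := by
    gcongr; exact le_max_left _ _
  have h3 : arcMeasure.real A * K = 2 * π * log C' - 2 * π * M + arcMeasure.real A := by
    rw [hK]; field_simp
  linarith

end DiscEstimates

end

/-! ### Hausdorff measure of level sets and of sets with large projection. -/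

noncomputable section

set_option linter.unusedSectionVars false

section HausdorffMeasure

open Metric
open scoped NNReal

theorem LipschitzOnWith.euclideanHausdorffMeasure_image_le {X Y : Type*} [EMetricSpace X]
    [EMetricSpace Y] [MeasurableSpace X] [BorelSpace X] [MeasurableSpace Y] [BorelSpace Y]
    {K : ℝ≥0} {f : X → Y} {s : Set X} (h : LipschitzOnWith K f s) (d : ℕ) :
    Measure.euclideanHausdorffMeasure d (f '' s) ≤
      (K : ℝ≥0∞) ^ d * Measure.euclideanHausdorffMeasure d s := by
  simp_rw [Measure.euclideanHausdorffMeasure_def, Measure.smul_apply, ENNReal.smul_def, smul_eq_mul]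
  rw [mul_left_comm]
  gcongr
  simpa using h.hausdorffMeasure_image_le (d := d) (by positivity)

/-- A map that is antilipschitz on `s` does not decrease Hausdorff measure by more than a
constant. -/
theorem euclideanHausdorffMeasure_le_of_antilipschitz {X Y : Type*} [MetricSpace X]
    [MetricSpace Y] [MeasurableSpace X] [BorelSpace X] [MeasurableSpace Y] [BorelSpace Y]
    {K : ℝ≥0} {f : X → Y} {s : Set X}
    (h : ∀ x ∈ s, ∀ y ∈ s, dist x y ≤ K * dist (f x) (f y)) (d : ℕ) :
    Measure.euclideanHausdorffMeasure d s ≤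
      (K : ℝ≥0∞) ^ d * Measure.euclideanHausdorffMeasure d (f '' s) := by
  rcases s.eq_empty_or_nonempty with rfl | ⟨x0, hx0⟩
  · simp
  have : Nonempty X := ⟨x0⟩
  have hinv : ∀ x ∈ s, Function.invFunOn f s (f x) = x := fun x hx => by
    have h1 := Function.invFunOn_mem (f := f) (s := s) ⟨x, hx, rfl⟩
    have h2 := Function.invFunOn_eq (f := f) (s := s) ⟨x, hx, rfl⟩
    have h3 := h _ h1 _ hx
    rw [h2, dist_self, mul_zero] at h3
    exact dist_le_zero.mp h3
  have hlip : LipschitzOnWith K (Function.invFunOn f s) (f '' s) := by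
    refine LipschitzOnWith.of_dist_le_mul ?_
    rintro _ ⟨x, hx, rfl⟩ _ ⟨y, hy, rfl⟩
    rw [hinv x hx, hinv y hy]
    exact h x hx y hy
  have h1 := hlip.euclideanHausdorffMeasure_image_le d
  rwa [image_image, image_congr (g := id) hinv, image_id] at h1

variable {F : Type*} [NormedAddCommGroup F] [NormedSpace ℝ F] [FiniteDimensional ℝ F]
  [MeasurableSpace F] [BorelSpace F]

/-- The projection onto the kernel of `ℓ` along `v`. -/
def kerProjection (ℓ : F →L[ℝ] ℝ) (v : F) (hv : ℓ v = 1) : F →L[ℝ] ℓ.ker :=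
  (ContinuousLinearMap.id ℝ F - ℓ.smulRight v).codRestrict ℓ.ker fun x => by
    simp [hv]

theorem coe_kerProjection (ℓ : F →L[ℝ] ℝ) (v : F) (hv : ℓ v = 1) (x : F) :
    (kerProjection ℓ v hv x : F) = x - ℓ x • v := rfl

theorem finrank_ker_add_one (ℓ : F →L[ℝ] ℝ) (v : F) (hv : ℓ v = 1) :
    Module.finrank ℝ ℓ.ker + 1 = Module.finrank ℝ F := by
  have h1 := LinearMap.finrank_range_add_finrank_ker (ℓ : F →ₗ[ℝ] ℝ)
  have h2 : LinearMap.range (ℓ : F →ₗ[ℝ] ℝ) = ⊤ := by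
    rw [LinearMap.range_eq_top]
    intro c
    exact ⟨c • v, by simp [hv]⟩
  rw [h2, finrank_top, Module.finrank_self] at h1
  rw [← h1, add_comm]

/-- A piece of a level set of a strictly differentiable function with nonzero differential has
finite measure near the base point. -/
theorem exists_ball_euclideanHausdorffMeasure_lt_top {d : ℕ} (hd : Module.finrank ℝ F = d + 1)
    {ρ : F → ℝ} {p : F} {ℓ : F →L[ℝ] ℝ} (hρ : HasStrictFDerivAt ρ ℓ p) (hℓ : ℓ ≠ 0) {S : Set F}
    {U : Set F} (hU : U ∈ 𝓝 p) (hS : ∀ q ∈ S ∩ U, ρ q = 0) :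
    ∃ V ∈ 𝓝 p, Measure.euclideanHausdorffMeasure d (S ∩ V) < ⊤ := by
  obtain ⟨v0, hv0⟩ : ∃ v, ℓ v ≠ 0 := by
    by_contra hcon
    push Not at hcon
    exact hℓ (ContinuousLinearMap.ext hcon)
  set v := (ℓ v0)⁻¹ • v0 with hvdef
  have hv : ℓ v = 1 := by simp [hvdef, hv0]
  have hvne : v ≠ 0 := fun h => by simp [h] at hv
  have hvpos : 0 < ‖v‖ := norm_pos_iff.mpr hvne
  have hfin : Module.finrank ℝ ℓ.ker = d := by
    have := finrank_ker_add_one ℓ v hv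
    omega
  -- On the level set this precision gives `‖ℓ (x - y) • v‖ ≤ ‖x - y‖ / 2`, so the projection along
  -- `v` onto the kernel of `ℓ` is antilipschitz with constant `2`. The projected piece is bounded
  -- in dimension `d`, hence of finite measure.
  have hε : 0 < 1 / (2 * ‖v‖) := by positivity
  have h1 := hρ.isLittleO.def hε
  rw [nhds_prod_eq] at h1
  obtain ⟨W, hW, hWb'⟩ := mem_prod_self_iff.mp h1
  have hWb : ∀ x ∈ W, ∀ y ∈ W, ‖ρ x - ρ y - ℓ (x - y)‖ ≤ 1 / (2 * ‖v‖) * ‖x - y‖ :=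
    fun x hx y hy => hWb' (mk_mem_prod hx hy)
  refine ⟨ball p 1 ∩ (U ∩ W), inter_mem (ball_mem_nhds p one_pos) (inter_mem hU hW), ?_⟩
  set A := S ∩ (ball p 1 ∩ (U ∩ W)) with hA
  have hanti : ∀ x ∈ A, ∀ y ∈ A, dist x y ≤ (2 : ℝ≥0) *
      dist (kerProjection ℓ v hv x) (kerProjection ℓ v hv y) := by
    intro x hx y hy
    have h2 := hWb x hx.2.2.2 y hy.2.2.2
    rw [hS x ⟨hx.1, hx.2.2.1⟩, hS y ⟨hy.1, hy.2.2.1⟩, sub_self, zero_sub, norm_neg,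
      Real.norm_eq_abs] at h2
    have h3 : dist (kerProjection ℓ v hv x) (kerProjection ℓ v hv y) =
        ‖(x - y) - ℓ (x - y) • v‖ := by
      rw [dist_eq_norm, ← map_sub]; rfl
    rw [h3, dist_eq_norm]
    have h4 : ‖x - y‖ ≤ ‖(x - y) - ℓ (x - y) • v‖ + ‖ℓ (x - y) • v‖ := by
      simpa using norm_add_le ((x - y) - ℓ (x - y) • v) (ℓ (x - y) • v)
    have h5 : ‖ℓ (x - y) • v‖ ≤ 1 / 2 * ‖x - y‖ := by
      rw [norm_smul, Real.norm_eq_abs]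
      calc |ℓ (x - y)| * ‖v‖ ≤ (1 / (2 * ‖v‖) * ‖x - y‖) * ‖v‖ := by gcongr
        _ = 1 / 2 * ‖x - y‖ := by field_simp
    push_cast
    linarith
  refine (euclideanHausdorffMeasure_le_of_antilipschitz hanti d).trans_lt ?_
  refine ENNReal.mul_lt_top (by simp) ?_
  rw [← hfin]
  have hbdd : Bornology.IsBounded (kerProjection ℓ v hv '' A) :=
    (kerProjection ℓ v hv).lipschitz.isBounded_image
      (isBounded_ball.subset (inter_subset_right.trans inter_subset_left))
  exact hbdd.measure_lt_top

/-- A set whose projection along `v` contains a neighbourhood has positive measure. -/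
theorem euclideanHausdorffMeasure_pos_of_projection {d : ℕ} (hd : Module.finrank ℝ F = d + 1)
    (ℓ : F →L[ℝ] ℝ) (v : F) (hv : ℓ v = 1) {S : Set F} {δ : ℝ} (hδ : 0 < δ)
    (hS : ∀ y : F, ℓ y = 0 → ‖y‖ < δ → ∃ s : ℝ, y + s • v ∈ S) :
    Measure.euclideanHausdorffMeasure d S ≠ 0 := by
  intro h0
  have hfin : Module.finrank ℝ ℓ.ker = d := by
    have := finrank_ker_add_one ℓ v hv
    omega
  have h1 := (kerProjection ℓ v hv).lipschitz.lipschitzOnWith (s := S)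
    |>.euclideanHausdorffMeasure_image_le d
  rw [h0, mul_zero, nonpos_iff_eq_zero, ← hfin] at h1
  have h2 : ball (0 : ℓ.ker) δ ⊆ kerProjection ℓ v hv '' S := by
    intro y hy
    have hy0 : ℓ (y : F) = 0 := y.2
    obtain ⟨s, hs⟩ := hS y hy0 (by simpa using hy)
    refine ⟨_, hs, Subtype.ext ?_⟩
    rw [coe_kerProjection]
    simp [hy0, hv]
  exact (isOpen_ball.measure_pos (Measure.euclideanHausdorffMeasure (Module.finrank ℝ ℓ.ker))
    ⟨0, mem_ball_self hδ⟩).ne' (measure_mono_null h2 h1)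

/-- Subspaces of smaller dimension are null sets. -/
theorem euclideanHausdorffMeasure_submodule_eq_zero (K : Submodule ℝ F) {d : ℕ}
    (hd : Module.finrank ℝ K < d) : Measure.euclideanHausdorffMeasure d (K : Set F) = 0 := by
  have h1 : (K : Set F) = ⋃ k : ℕ, (Subtype.val : K → F) '' ball 0 k := by
    rw [← image_iUnion, iUnion_ball_nat, image_univ, Subtype.range_coe]
  rw [h1, measure_iUnion_null_iff]
  intro k
  rw [isometry_subtype_coe.euclideanHausdorffMeasure_image]
  rcases Measure.euclideanHausdorffMeasure_zero_or_top hd (ball (0 : K) k) with h | h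
  · exact h
  · exact absurd h isBounded_ball.measure_lt_top.ne

end HausdorffMeasure

end

/-! ### Rotations and the measure on the boundary of a model domain. -/

noncomputable section

/-- Rotation of the coordinates by the angles `t j`. -/
def diagRotation {n : ℕ} (t : Fin n → ℝ) :
    EuclideanSpace ℂ (Fin n) ≃ₗᵢ[ℝ] EuclideanSpace ℂ (Fin n) :=
  LinearIsometryEquiv.piLpCongrRight 2 fun j => rotation (Circle.exp (t j))

theorem diagRotation_apply {n : ℕ} (t : Fin n → ℝ) (z : EuclideanSpace ℂ (Fin n)) (j : Fin n) :
    diagRotation t z j = Complex.exp (t j * Complex.I) * z j := by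
  simp [diagRotation, LinearIsometryEquiv.piLpCongrRight_apply, rotation_apply, Circle.coe_exp]

theorem norm_diagRotation_apply {n : ℕ} (t : Fin n → ℝ) (z : EuclideanSpace ℂ (Fin n))
    (j : Fin n) : ‖diagRotation t z j‖ = ‖z j‖ := by
  rw [diagRotation_apply, norm_mul, Complex.norm_exp_ofReal_mul_I, one_mul]

theorem continuous_diagRotation {n : ℕ} :
    Continuous fun p : (Fin n → ℝ) × EuclideanSpace ℂ (Fin n) => diagRotation p.1 p.2 := by
  have h : (fun p : (Fin n → ℝ) × EuclideanSpace ℂ (Fin n) => diagRotation p.1 p.2) =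
      fun p => WithLp.toLp 2 fun j => Complex.exp (p.1 j * Complex.I) * p.2 j := by
    ext p j
    exact diagRotation_apply p.1 p.2 j
  rw [h]
  exact (PiLp.continuous_toLp 2 _).comp (continuous_pi fun j => by fun_prop)

/-- Averaging over a measure preserving circle action. -/
theorem lintegral_lintegral_arcMeasure {E : Type*} [MeasurableSpace E] {μ : Measure E} [SFinite μ]
    {R : ℝ → E → E} (hR : Measurable (Function.uncurry R)) (hμ : ∀ θ, MeasurePreserving (R θ) μ μ)
    {h : E → ℝ≥0∞} (hh : Measurable h) :
    ∫⁻ ζ, ∫⁻ θ, h (R θ ζ) ∂arcMeasure ∂μ = ENNReal.ofReal (2 * Real.pi) * ∫⁻ ζ, h ζ ∂μ := by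
  rw [lintegral_lintegral_swap]
  · simp_rw [(hμ _).lintegral_comp hh]
    rw [lintegral_const, mul_comm]
    congr 1
    rw [Measure.restrict_apply_univ, Real.volume_Ioc]
    ring_nf
  · exact (hh.comp (hR.comp measurable_swap)).aemeasurable

/-- A null set meets almost all circle orbits in null sets. -/
theorem ae_arcMeasure_preimage_eq_zero {E : Type*} [MeasurableSpace E] {μ : Measure E} [SFinite μ]
    {R : ℝ → E → E} (hR : Measurable (Function.uncurry R)) (hμ : ∀ θ, MeasurePreserving (R θ) μ μ)
    {p : E → Prop} (hp : ∀ᵐ ζ ∂μ, p ζ) : ∀ᵐ ζ ∂μ, ∀ᵐ θ ∂arcMeasure, p (R θ ζ) := by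
  obtain ⟨N, hN, hNm, hN0⟩ := exists_measurable_superset_of_null (ae_iff.mp hp)
  have h1 := lintegral_lintegral_arcMeasure hR hμ (h := N.indicator 1)
    (measurable_one.indicator hNm)
  rw [lintegral_indicator_one hNm, hN0, mul_zero] at h1
  have hm : Measurable fun ζ => ∫⁻ θ, N.indicator (1 : E → ℝ≥0∞) (R θ ζ) ∂arcMeasure :=
    Measurable.lintegral_prod_right' (f := fun q : E × ℝ => N.indicator (1 : E → ℝ≥0∞) (R q.2 q.1))
      ((measurable_one.indicator hNm).comp (hR.comp measurable_swap))
  rw [lintegral_eq_zero_iff hm] at h1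
  filter_upwards [h1] with ζ hζ
  have hm2 : Measurable fun θ => N.indicator (1 : E → ℝ≥0∞) (R θ ζ) :=
    (measurable_one.indicator hNm).comp (hR.comp measurable_prodMk_right)
  rw [Pi.zero_apply, lintegral_eq_zero_iff hm2] at hζ
  filter_upwards [hζ] with θ hθ
  by_contra hcon
  have : R θ ζ ∈ N := hN hcon
  simp [this] at hθ

namespace ModelDomain

open Metric

variable {n : ℕ} (D : ModelDomain n)

theorem isOpen_polydisc (n : ℕ) : IsOpen (polydisc n) := by
  simp only [polydisc, Set.ofPred_forall]
  exact isOpen_iInter_of_finite fun j => isOpen_lt (by fun_prop) continuous_const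

theorem isOpen_X : IsOpen D.X := by
  obtain ⟨X, Γ, d, h⟩ := D
  cases h with
  | reinhardt _ h => exact h
  | polydisc => exact isOpen_polydisc n

theorem isCompleteReinhardt_X : IsCompleteReinhardt D.X := by
  obtain ⟨X, Γ, d, h⟩ := D
  cases h with
  | reinhardt _ _ _ _ h _ => exact h
  | polydisc => exact fun a ha z hz j => (hz j).trans_lt (ha j)

theorem isBounded_X : Bornology.IsBounded D.X := by
  obtain ⟨X, Γ, d, h⟩ := D
  cases h with
  | reinhardt _ _ _ h _ _ => exact h
  | polydisc =>
    refine ((PiLp.antilipschitzWith_ofLp 2 fun _ : Fin n => ℂ).isBounded_preimage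
      (isBounded_closedBall (x := (0 : Fin n → ℂ)) (r := 1))).subset fun z hz => ?_
    rw [mem_preimage, mem_closedBall_zero_iff, pi_norm_le_iff_of_nonneg zero_le_one]
    exact fun j => (hz j).le

theorem zero_mem_X : (0 : EuclideanSpace ℂ (Fin n)) ∈ D.X := by
  have h : D.X.Nonempty := by
    obtain ⟨X, Γ, d, h⟩ := D
    cases h with
    | reinhardt _ _ h _ _ _ => exact h
    | polydisc => exact ⟨0, fun j => by simp⟩
  obtain ⟨a, ha⟩ := h
  exact D.isCompleteReinhardt_X a ha _ fun j => by simp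

theorem Γ_subset_closure : D.Γ ⊆ closure D.X := by
  intro ζ hζ
  have h1 : Tendsto (fun r : ℝ => r • ζ) (𝓝[<] 1) (𝓝 ζ) := by
    have : Tendsto (fun r : ℝ => r • ζ) (𝓝 1) (𝓝 ((1 : ℝ) • ζ)) :=
      (by fun_prop : Continuous fun r : ℝ => r • ζ).tendsto 1
    rw [one_smul] at this
    exact this.mono_left nhdsWithin_le_nhds
  refine mem_closure_of_tendsto h1 ?_
  filter_upwards [eventually_mem_Ioo_one one_pos] with r hr
  exact D.smul_mem hr hζ

theorem isCompact_Γ : IsCompact D.Γ :=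
  Metric.isCompact_of_isClosed_isBounded D.isClosed_Γ
    (D.isBounded_X.closure.subset D.Γ_subset_closure)

theorem diagRotation_mem_X (t : Fin n → ℝ) {z : EuclideanSpace ℂ (Fin n)} :
    diagRotation t z ∈ D.X ↔ z ∈ D.X :=
  ⟨fun h => D.isCompleteReinhardt_X _ h _ fun j => (norm_diagRotation_apply t z j).ge,
    fun h => D.isCompleteReinhardt_X _ h _ fun j => (norm_diagRotation_apply t z j).le⟩

theorem diagRotation_mem_Γ (t : Fin n → ℝ) {z : EuclideanSpace ℂ (Fin n)} :
    diagRotation t z ∈ D.Γ ↔ z ∈ D.Γ := by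
  obtain ⟨X, Γ, d, h⟩ := D
  have hX : diagRotation t ⁻¹' X = X := by
    ext z; exact (⟨X, Γ, d, h⟩ : ModelDomain n).diagRotation_mem_X t
  cases h with
  | reinhardt =>
    have := (diagRotation t).toHomeomorph.preimage_frontier X
    change diagRotation t ⁻¹' frontier X = frontier (diagRotation t ⁻¹' X) at this
    rw [hX] at this
    exact Set.ext_iff.mp this z
  | polydisc => exact forall_congr' fun j => by rw [norm_diagRotation_apply]

theorem measurePreserving_of_isometry (e : EuclideanSpace ℂ (Fin n) ≃ᵢ EuclideanSpace ℂ (Fin n))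
    {A : Set (EuclideanSpace ℂ (Fin n))} (hA : MeasurableSet A) (h : ∀ z, e z ∈ A ↔ z ∈ A) :
    MeasurePreserving e ((Measure.euclideanHausdorffMeasure D.dim).restrict A)
      ((Measure.euclideanHausdorffMeasure D.dim).restrict A) := by
  have h1 := (e.measurePreserving_euclideanHausdorffMeasure D.dim).restrict_preimage hA
  have h2 : e ⁻¹' A = A := by ext z; exact h z
  rwa [h2] at h1

theorem measurePreserving_diagRotation (t : Fin n → ℝ) :
    MeasurePreserving (diagRotation t) D.σ D.σ :=
  D.measurePreserving_of_isometry (diagRotation t).toIsometryEquiv D.isClosed_Γ.measurableSet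
    fun _ => D.diagRotation_mem_Γ t

/-- Every point of `X` is dominated by a point of `X` with larger coordinates. -/
theorem exists_norm_lt {a : EuclideanSpace ℂ (Fin n)} (ha : a ∈ D.X) :
    ∃ b ∈ D.X, ∀ j, ‖a j‖ < ‖b j‖ := by
  have hcont : Continuous fun ε : ℝ =>
      (WithLp.toLp 2 fun j => ((‖a j‖ + ε : ℝ) : ℂ) : EuclideanSpace ℂ (Fin n)) :=
    (PiLp.continuous_toLp 2 _).comp (continuous_pi fun j => by fun_prop)
  have h0 : (WithLp.toLp 2 fun j => ((‖a j‖ + 0 : ℝ) : ℂ) : EuclideanSpace ℂ (Fin n)) ∈ D.X :=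
    D.isCompleteReinhardt_X a ha _ fun j => by simp
  have h1 : ∀ᶠ ε in 𝓝[>] (0 : ℝ),
      (WithLp.toLp 2 fun j => ((‖a j‖ + ε : ℝ) : ℂ) : EuclideanSpace ℂ (Fin n)) ∈ D.X :=
    (hcont.tendsto 0).mono_left nhdsWithin_le_nhds (D.isOpen_X.mem_nhds h0)
  obtain ⟨ε, hε, hε0⟩ := (h1.and self_mem_nhdsWithin).exists
  refine ⟨_, hε, fun j => ?_⟩
  have h2 : 0 < ε := hε0
  change _ < ‖((‖a j‖ + ε : ℝ) : ℂ)‖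
  rw [Complex.norm_real, Real.norm_of_nonneg (by positivity)]
  linarith

theorem exists_contraction {a b : EuclideanSpace ℂ (Fin n)} (h : ∀ j, ‖a j‖ < ‖b j‖) :
    ∃ c ∈ Ioo (0 : ℝ) 1, ∀ j, ‖a j‖ < c * ‖b j‖ := by
  have h1 : ∀ᶠ c in 𝓝[<] (1 : ℝ), ∀ j, ‖a j‖ < c * ‖b j‖ := by
    rw [eventually_all]
    intro j
    have : Tendsto (fun c : ℝ => c * ‖b j‖) (𝓝 1) (𝓝 (1 * ‖b j‖)) :=
      (by fun_prop : Continuous fun c : ℝ => c * ‖b j‖).tendsto 1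
    rw [one_mul] at this
    exact this.mono_left nhdsWithin_le_nhds (lt_mem_nhds (h j))
  obtain ⟨c, hc, hc1⟩ := (h1.and (eventually_mem_Ioo_one one_pos)).exists
  exact ⟨c, hc1, hc⟩

theorem finrank_real (n : ℕ) : Module.finrank ℝ (EuclideanSpace ℂ (Fin n)) = 2 * n := by
  rw [finrank_real_of_complex]; simp

theorem rho_eq_zero_of_mem_frontier {E : Type*} [TopologicalSpace E] {X U : Set E} {ρ : E → ℝ}
    (hX : IsOpen X) (hU : IsOpen U) (hρ : ContinuousOn ρ U) (h : X ∩ U = {z | z ∈ U ∧ ρ z < 0})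
    {q : E} (hq : q ∈ frontier X) (hqU : q ∈ U) : ρ q = 0 := by
  have hqX : q ∉ X := fun hqX => by
    have : q ∈ X ∩ frontier X := ⟨hqX, hq⟩
    rwa [hX.inter_frontier_eq] at this
  refine le_antisymm ?_ ?_
  · by_contra hcon
    push Not at hcon
    have h1 : ∀ᶠ z in 𝓝 q, 0 < ρ z ∧ z ∈ U :=
      ((hρ.continuousAt (hU.mem_nhds hqU)).eventually (lt_mem_nhds hcon)).and (hU.mem_nhds hqU)
    obtain ⟨z, ⟨hz1, hz2⟩, hz3⟩ := mem_closure_iff_nhds.mp (frontier_subset_closure hq) _ h1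
    have : z ∈ {z | z ∈ U ∧ ρ z < 0} := h ▸ ⟨hz3, hz2⟩
    exact absurd this.2 (not_lt.mpr hz1.le)
  · by_contra hcon
    push Not at hcon
    have : q ∈ X ∩ U := h ▸ ⟨hqU, hcon⟩
    exact hqX this.1

theorem lipschitzWith_torus (n : ℕ) : LipschitzWith 1 fun t : EuclideanSpace ℝ (Fin n) =>
    (WithLp.toLp 2 fun j => circleMap 0 1 (t j) : EuclideanSpace ℂ (Fin n)) := by
  refine LipschitzWith.of_dist_le_mul fun x y => ?_
  rw [NNReal.coe_one, one_mul, EuclideanSpace.dist_eq, EuclideanSpace.dist_eq]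
  refine Real.sqrt_le_sqrt (Finset.sum_le_sum fun j _ => ?_)
  have h1 := (lipschitzWith_circleMap 0 1).dist_le_mul (x j) (y j)
  have h2 : dist (circleMap 0 1 (x j)) (circleMap 0 1 (y j)) ≤ dist (x j) (y j) := by
    simpa using h1
  exact pow_le_pow_left₀ dist_nonneg h2 2

/-- The boundary part is compact, so in the Reinhardt case local finiteness suffices, and it follows
from the `C²` defining functions. The torus is a Lipschitz image of a bounded cube. -/
theorem σ_univ_lt_top (hn : 0 < n) : D.σ univ < ⊤ := by
  rw [ModelDomain.σ, Measure.restrict_apply_univ]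
  have hcomp := D.isCompact_Γ
  obtain ⟨X, Γ, d, h⟩ := D
  cases h with
  | reinhardt _ hX _ _ _ hb =>
    refine hcomp.measure_lt_top_of_nhdsWithin fun p hp => ?_
    obtain ⟨U, ρ, hU, hpU, hρ, hρ', hXU⟩ := hb p hp
    have hstrict : HasStrictFDerivAt ρ (fderiv ℝ ρ p) p :=
      ((hρ.contDiffAt (hU.mem_nhds hpU)).hasStrictFDerivAt (by norm_num))
    obtain ⟨V, hV, hVfin⟩ := exists_ball_euclideanHausdorffMeasure_lt_top (d := 2 * n - 1)
      (by rw [finrank_real]; omega) hstrict hρ' (S := frontier X) (hU.mem_nhds hpU)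
      fun q hq => rho_eq_zero_of_mem_frontier hX hU hρ.continuousOn hXU hq.1 hq.2
    exact ⟨_, inter_mem_nhdsWithin _ hV, hVfin⟩
  | polydisc =>
    have hsub : unitTorus n ⊆ (fun t : EuclideanSpace ℝ (Fin n) =>
        (WithLp.toLp 2 fun j => circleMap 0 1 (t j) : EuclideanSpace ℂ (Fin n))) ''
        {t | ∀ j, |t j| ≤ Real.pi} := by
      intro z hz
      refine ⟨WithLp.toLp 2 fun j => (z j).arg, fun j => Complex.abs_arg_le_pi _, ?_⟩
      ext j
      have h1 := Complex.norm_mul_exp_arg_mul_I (z j)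
      rw [hz j] at h1
      simpa [circleMap] using h1
    refine (measure_mono hsub).trans_lt ?_
    refine ((lipschitzWith_torus n).lipschitzOnWith.euclideanHausdorffMeasure_image_le n).trans_lt ?_
    refine ENNReal.mul_lt_top (by simp) ?_
    rw [EuclideanSpace.euclideanHausdorffMeasure_eq_volume]
    refine Bornology.IsBounded.measure_lt_top ?_
    refine ((PiLp.antilipschitzWith_ofLp 2 fun _ : Fin n => ℝ).isBounded_preimage
      (isBounded_closedBall (x := (0 : Fin n → ℝ)) (r := Real.pi))).subset fun z hz => ?_
    rw [mem_preimage, mem_closedBall_zero_iff, pi_norm_le_iff_of_nonneg Real.pi_pos.le]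
    exact fun j => hz j

theorem isFiniteMeasure_σ (hn : 0 < n) : IsFiniteMeasure D.σ := ⟨D.σ_univ_lt_top hn⟩

/-- The coordinate hyperplanes meet `Γ` in null sets. -/
theorem ae_coord_ne_zero (hn : 0 < n) (j : Fin n) : ∀ᵐ ζ ∂D.σ, ζ j ≠ 0 := by
  rw [ModelDomain.σ, ae_restrict_iff' D.isClosed_Γ.measurableSet, ae_iff]
  obtain ⟨X, Γ, d, h⟩ := D
  cases h with
  | reinhardt =>
    set K : Submodule ℂ (EuclideanSpace ℂ (Fin n)) :=
      LinearMap.ker (EuclideanSpace.proj j : EuclideanSpace ℂ (Fin n) →L[ℂ] ℂ).toLinearMap with hK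
    have hKdim : Module.finrank ℂ K + 1 = n := by
      have h1 := LinearMap.finrank_range_add_finrank_ker
        (EuclideanSpace.proj j : EuclideanSpace ℂ (Fin n) →L[ℂ] ℂ).toLinearMap
      have h2 : LinearMap.range
          (EuclideanSpace.proj j : EuclideanSpace ℂ (Fin n) →L[ℂ] ℂ).toLinearMap = ⊤ := by
        rw [LinearMap.range_eq_top]
        intro c
        exact ⟨EuclideanSpace.single j c, by simp⟩
      rw [h2, finrank_top, Module.finrank_self, finrank_euclideanSpace_fin] at h1
      change 1 + Module.finrank ℂ K = n at h1
      omega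
    have hKr : Module.finrank ℝ (K.restrictScalars ℝ) = 2 * Module.finrank ℂ K :=
      finrank_real_of_complex K
    -- The complex hyperplane has real dimension `2 * n - 2`, one less than the dimension of the
    -- boundary.
    refine measure_mono_null ?_ (euclideanHausdorffMeasure_submodule_eq_zero
      (K.restrictScalars ℝ) (d := 2 * n - 1) (by rw [hKr]; omega))
    intro z hz
    simp only [mem_ofPred_eq, ne_eq, not_forall, not_not] at hz
    obtain ⟨-, hz⟩ := hz
    change z ∈ K
    simpa [hK] using hz
  | polydisc =>
    convert measure_empty (μ := Measure.euclideanHausdorffMeasure n)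
    refine eq_empty_of_forall_notMem fun z hz => ?_
    simp only [mem_ofPred_eq, ne_eq, not_forall, not_not] at hz
    obtain ⟨hz1, hz2⟩ := hz
    have := hz1 j
    simp [hz2] at this

/-- Points of `X` are dominated by a part of `Γ` of positive measure. -/
theorem exists_σ_pos (hn : 0 < n) {a : EuclideanSpace ℂ (Fin n)} (ha : a ∈ D.X) :
    ∃ c ∈ Ioo (0 : ℝ) 1, D.σ {ζ | ∀ j, ‖a j‖ ≤ c * ‖ζ j‖} ≠ 0 := by
  have hclosed : ∀ c : ℝ, IsClosed {ζ : EuclideanSpace ℂ (Fin n) | ∀ j, ‖a j‖ ≤ c * ‖ζ j‖} :=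
    fun c => by
      simp only [Set.ofPred_forall]
      exact isClosed_iInter fun j => isClosed_le continuous_const (by fun_prop)
  obtain ⟨b', hb', hab'⟩ := D.exists_norm_lt ha
  have hreal : ∀ z : EuclideanSpace ℂ (Fin n), z ∈ D.X →
      (WithLp.toLp 2 fun j => ((‖z j‖ : ℝ) : ℂ) : EuclideanSpace ℂ (Fin n)) ∈ D.X :=
    fun z hz => D.isCompleteReinhardt_X z hz _ fun j => by simp
  obtain ⟨c, hc, hcb⟩ := exists_contraction hab'
  refine ⟨c, hc, ?_⟩
  have hσ : D.σ {ζ | ∀ j, ‖a j‖ ≤ c * ‖ζ j‖} = Measure.euclideanHausdorffMeasure D.dim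
      ({ζ | ∀ j, ‖a j‖ ≤ c * ‖ζ j‖} ∩ D.Γ) := by
    rw [ModelDomain.σ, Measure.restrict_apply (hclosed c).measurableSet]
  rw [hσ]
  have hopen := D.isOpen_X
  have hbounded := D.isBounded_X
  have hcomplete := D.isCompleteReinhardt_X
  obtain ⟨X, Γ, d, h⟩ := D
  cases h with
  | reinhardt =>
    have hb0 : ∀ j, 0 < ‖b' j‖ := fun j => (norm_nonneg _).trans_lt (hab' j)
    have hbX := hreal b' hb'
    set b : EuclideanSpace ℂ (Fin n) := WithLp.toLp 2 fun j => ((‖b' j‖ : ℝ) : ℂ) with hbdef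
    have hbj : ∀ j, b j = ((‖b' j‖ : ℝ) : ℂ) := fun j => rfl
    -- The ray through the positive point `b` leaves `X` at `t0 • b`. Segments parallel to `b` near
    -- this point run from `X` to its complement, so each meets the boundary, and the projection
    -- along `b` of the part near `t0 • b` contains a ball. The functional serves to define this
    -- projection.
    set ℓ : EuclideanSpace ℂ (Fin n) →L[ℝ] ℝ := ((‖b' ⟨0, hn⟩‖)⁻¹ : ℝ) •
      (Complex.reCLM.comp ((EuclideanSpace.proj ⟨0, hn⟩ :
        EuclideanSpace ℂ (Fin n) →L[ℂ] ℂ).restrictScalars ℝ)) with hℓ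
    have hℓb : ℓ b = 1 := by
      have : ℓ b = (‖b' ⟨0, hn⟩‖)⁻¹ * (b ⟨0, hn⟩).re := rfl
      rw [this, hbj, Complex.ofReal_re, inv_mul_cancel₀ (hb0 _).ne']
    have hbne : b ≠ 0 := fun h => by rw [h, map_zero] at hℓb; exact zero_ne_one hℓb
    have hbpos : 0 < ‖b‖ := norm_pos_iff.mpr hbne
    -- the last point of the ray in `X`
    set S : Set ℝ := {t | 0 ≤ t ∧ t • b ∈ X} with hS
    have hS1 : (1 : ℝ) ∈ S := ⟨zero_le_one, by rw [one_smul]; exact hbX⟩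
    obtain ⟨M, hM⟩ := hbounded.exists_norm_le
    have hSb : BddAbove S := ⟨M / ‖b‖, fun t ht => by
      rw [le_div_iff₀ hbpos]
      have := hM _ ht.2
      rwa [norm_smul, Real.norm_of_nonneg ht.1] at this⟩
    set t0 := sSup S with ht0
    have ht01 : 1 ≤ t0 := le_csSup hSb hS1
    have hlt : ∀ t, 0 ≤ t → t < t0 → t • b ∈ X := by
      intro t ht htt
      obtain ⟨s, hs, hts⟩ := exists_lt_of_lt_csSup ⟨1, hS1⟩ htt
      refine hcomplete _ hs.2 _ fun j => ?_
      simp only [PiLp.smul_apply, norm_smul, Real.norm_of_nonneg ht, Real.norm_of_nonneg hs.1]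
      gcongr
    have hgt : ∀ t, t0 < t → t • b ∉ X := fun t htt hX =>
      absurd (le_csSup hSb (⟨by linarith, hX⟩ : t ∈ S)) (not_le.mpr htt)
    set V : Set (EuclideanSpace ℂ (Fin n)) := {ζ | ∀ j, ‖a j‖ < c * ‖ζ j‖} with hV
    have hVo : IsOpen V := by
      simp only [hV, Set.ofPred_forall]
      exact isOpen_iInter_of_finite fun j => isOpen_lt continuous_const (by fun_prop)
    have hVt : t0 • b ∈ V := fun j => by
      rw [PiLp.smul_apply, norm_smul, Real.norm_of_nonneg (by linarith), hbj, Complex.norm_real,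
        norm_norm]
      have := hcb j
      have h2 : 0 < c * ‖b' j‖ := mul_pos hc.1 (hb0 j)
      nlinarith
    obtain ⟨ε, hε, hball⟩ := Metric.isOpen_iff.mp hVo _ hVt
    obtain ⟨η, hη, hη1, hηε⟩ : ∃ η : ℝ, 0 < η ∧ η < 1 ∧ η * ‖b‖ < ε / 2 := by
      refine ⟨min (1 / 2) (ε / (4 * ‖b‖)), by positivity,
        (min_le_left _ _).trans_lt (by norm_num), ?_⟩
      calc min (1 / 2) (ε / (4 * ‖b‖)) * ‖b‖ ≤ ε / (4 * ‖b‖) * ‖b‖ := by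
            gcongr; exact min_le_right _ _
        _ = ε / 4 := by field_simp
        _ < ε / 2 := by linarith
    have hin : (t0 - η) • b ∈ X := hlt _ (by linarith) (by linarith)
    have h1 : ∀ᶠ y in 𝓝 (0 : EuclideanSpace ℂ (Fin n)), y + (t0 - η) • b ∈ X := by
      have : Tendsto (fun y : EuclideanSpace ℂ (Fin n) => y + (t0 - η) • b) (𝓝 0)
          (𝓝 (0 + (t0 - η) • b)) :=
        (by fun_prop : Continuous fun y : EuclideanSpace ℂ (Fin n) => y + (t0 - η) • b).tendsto 0
      rw [zero_add] at this
      exact this (hopen.mem_nhds hin)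
    -- The upper ends of the segments dominate `(t0 + η / 2) • b` coordinatewise. By completeness
    -- they cannot be in `X`, since that point lies beyond the end of the ray in `X`.
    have h2 : ∀ᶠ y in 𝓝 (0 : EuclideanSpace ℂ (Fin n)),
        ∀ j, (t0 + η / 2) * ‖b' j‖ < ‖(y + (t0 + η) • b) j‖ := by
      rw [eventually_all]
      intro j
      have h3 : Tendsto (fun y : EuclideanSpace ℂ (Fin n) => ‖(y + (t0 + η) • b) j‖) (𝓝 0)
          (𝓝 ‖((0 : EuclideanSpace ℂ (Fin n)) + (t0 + η) • b) j‖) :=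
        (by fun_prop : Continuous fun y : EuclideanSpace ℂ (Fin n) =>
          ‖(y + (t0 + η) • b) j‖).tendsto 0
      refine h3 (lt_mem_nhds ?_)
      rw [zero_add, PiLp.smul_apply, norm_smul, Real.norm_of_nonneg (by linarith), hbj,
        Complex.norm_real, norm_norm]
      have := hb0 j
      gcongr
      linarith
    obtain ⟨δ, hδ, hδb⟩ := Metric.eventually_nhds_iff.mp (h1.and h2)
    refine euclideanHausdorffMeasure_pos_of_projection (d := 2 * n - 1)
      (by rw [finrank_real]; omega) ℓ b hℓb (δ := min δ (ε / 2)) (by positivity) ?_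
    intro y hy hyδ
    obtain ⟨hy1, hy2⟩ := hδb (y := y) (by
      rw [dist_zero_right]; exact hyδ.trans_le (min_le_left _ _))
    have hout : y + (t0 + η) • b ∉ X := fun hX => by
      refine hgt (t0 + η / 2) (by linarith) (hcomplete _ hX _ fun j => ?_)
      refine le_trans (le_of_eq ?_) (hy2 j).le
      rw [PiLp.smul_apply, norm_smul, Real.norm_of_nonneg (by linarith), hbj, Complex.norm_real,
        norm_norm]
    have hpre : IsPreconnected ((fun s : ℝ => y + s • b) '' Icc (t0 - η) (t0 + η)) :=
      isPreconnected_Icc.image _ (by fun_prop)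
    have hfr : ∃ s ∈ Icc (t0 - η) (t0 + η), y + s • b ∈ frontier X := by
      by_contra hcon
      push Not at hcon
      have h3 : ∀ s ∈ Icc (t0 - η) (t0 + η), y + s • b ∈ X ∨ y + s • b ∈ (closure X)ᶜ := by
        intro s hs
        by_cases hX : y + s • b ∈ X
        · exact Or.inl hX
        · refine Or.inr fun hcl => ?_
          rw [closure_eq_self_union_frontier] at hcl
          exact hcl.elim hX (hcon s hs)
      obtain ⟨x, -, hx1, hx2⟩ := hpre X (closure X)ᶜ hopen isClosed_closure.isOpen_compl
        (by rintro _ ⟨s, hs, rfl⟩; exact h3 s hs)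
        ⟨_, ⟨t0 - η, ⟨le_rfl, by linarith⟩, rfl⟩, hy1⟩
        ⟨_, ⟨t0 + η, ⟨by linarith, le_rfl⟩, rfl⟩,
          (h3 _ ⟨by linarith, le_rfl⟩).resolve_left hout⟩
      exact hx2 (subset_closure hx1)
    obtain ⟨s, hs, hfs⟩ := hfr
    refine ⟨s, ⟨fun j => ?_, hfs⟩⟩
    refine (hball ?_ j).le
    rw [mem_ball, dist_eq_norm]
    calc ‖y + s • b - t0 • b‖ = ‖y + (s - t0) • b‖ := by rw [sub_smul]; congr 1; abel
      _ ≤ ‖y‖ + |s - t0| * ‖b‖ := (norm_add_le _ _).trans (by rw [norm_smul, Real.norm_eq_abs])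
      _ ≤ ‖y‖ + η * ‖b‖ := by
        gcongr
        rw [abs_le]; constructor <;> linarith [hs.1, hs.2]
      _ < ε / 2 + ε / 2 := add_lt_add (hyδ.trans_le (min_le_right _ _)) hηε
      _ = ε := by ring
  | polydisc =>
    have hsub : unitTorus n ⊆ {ζ | ∀ j, ‖a j‖ ≤ c * ‖ζ j‖} := fun z hz j => by
      rw [hz j]
      refine (hcb j).le.trans ?_
      have := hb' j
      exact mul_le_mul_of_nonneg_left this.le hc.1.le
    change Measure.euclideanHausdorffMeasure n (_ ∩ unitTorus n) ≠ 0
    rw [inter_eq_right.mpr hsub]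
    intro h0
    -- Taking real parts does not increase distances and maps the torus onto a set that contains the
    -- unit ball of `ℝⁿ`, so the torus is not a null set.
    set π : EuclideanSpace ℂ (Fin n) → EuclideanSpace ℝ (Fin n) :=
      fun z => WithLp.toLp 2 fun j => (z j).re with hπ
    have hlip : LipschitzWith 1 π := by
      refine LipschitzWith.of_dist_le_mul fun x y => ?_
      rw [NNReal.coe_one, one_mul, EuclideanSpace.dist_eq, EuclideanSpace.dist_eq]
      refine Real.sqrt_le_sqrt (Finset.sum_le_sum fun j _ => ?_)
      refine pow_le_pow_left₀ dist_nonneg ?_ 2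
      rw [Real.dist_eq, Complex.dist_eq, hπ, ← Complex.sub_re]
      exact Complex.abs_re_le_norm _
    have h1 := hlip.lipschitzOnWith (s := unitTorus n) |>.euclideanHausdorffMeasure_image_le n
    rw [h0, mul_zero, nonpos_iff_eq_zero, EuclideanSpace.euclideanHausdorffMeasure_eq_volume] at h1
    have h2 : ball (0 : EuclideanSpace ℝ (Fin n)) 1 ⊆ π '' unitTorus n := by
      intro y hy
      refine ⟨WithLp.toLp 2 fun j => Complex.exp (Real.arccos (y j) * Complex.I), fun j => ?_, ?_⟩
      · exact Complex.norm_exp_ofReal_mul_I _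
      · ext j
        have h3 : |y j| ≤ 1 := by
          have := PiLp.norm_apply_le y j
          rw [mem_ball_zero_iff] at hy
          rw [Real.norm_eq_abs] at this
          linarith
        change (Complex.exp (Real.arccos (y j) * Complex.I)).re = y j
        rw [Complex.exp_ofReal_mul_I_re, Real.cos_arccos (abs_le.mp h3).1 (abs_le.mp h3).2]
    exact (isOpen_ball.measure_pos volume ⟨0, mem_ball_self one_pos⟩).ne' (measure_mono_null h2 h1)

end ModelDomain

end

/-! ### Bounded point evaluations on the Hardy space. -/

noncomputable section

/-- The coordinates with index in `s` are taken from `z`, the others from `ζ`. -/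
def mixCoord {n : ℕ} (s : Finset (Fin n)) (z ζ : EuclideanSpace ℂ (Fin n)) :
    EuclideanSpace ℂ (Fin n) := WithLp.toLp 2 fun j => if j ∈ s then z j else ζ j

theorem mixCoord_apply {n : ℕ} (s : Finset (Fin n)) (z ζ : EuclideanSpace ℂ (Fin n)) (j : Fin n) :
    mixCoord s z ζ j = if j ∈ s then z j else ζ j := rfl

theorem continuous_mixCoord {n : ℕ} (s : Finset (Fin n)) (z : EuclideanSpace ℂ (Fin n)) :
    Continuous (mixCoord s z) := by
  refine (PiLp.continuous_toLp 2 _).comp (continuous_pi fun j => ?_)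
  by_cases h : j ∈ s
  · simp only [h, if_true]; exact continuous_const
  · simp only [h, if_false]; fun_prop

theorem MeasureTheory.Lp.enorm_sq_eq {α : Type*} [MeasurableSpace α] {μ : Measure α}
    (u : Lp ℂ 2 μ) : ‖u‖ₑ ^ 2 = ∫⁻ x, ‖u x‖ₑ ^ 2 ∂μ := by
  rw [Lp.enorm_def, eLpNorm_eq_lintegral_rpow_enorm_toReal two_ne_zero ENNReal.ofNat_ne_top]
  simp only [ENNReal.toReal_ofNat, ENNReal.rpow_ofNat]
  rw [← ENNReal.rpow_natCast, ← ENNReal.rpow_mul]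
  norm_num

/-- Limits from the left at `1` along the rationals. -/
theorem tendsto_nhdsLT_one_of_rat {h : ℝ → ℂ} (hc : ContinuousOn h (Ioo 0 1)) {c : ℂ}
    (hl : Tendsto (fun q : ℚ => h q) (comap (fun q : ℚ => (q : ℝ)) (𝓝[<] 1)) (𝓝 c)) :
    Tendsto h (𝓝[<] 1) (𝓝 c) := by
  rw [Metric.tendsto_nhds] at hl ⊢
  intro ε hε
  obtain ⟨W, hW, hWs⟩ := mem_comap.mp (hl (ε / 2) (half_pos hε))
  obtain ⟨δ, hδ, hδW⟩ := (mem_nhdsLT_iff_exists_Ioo_subset' (one_pos : (0 : ℝ) < 1)).mp hW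
  filter_upwards [eventually_mem_Ioo_one (max_lt (one_pos : (0 : ℝ) < 1) hδ)] with r hr
  have hr0 : r ∈ Ioo (0 : ℝ) 1 := ⟨(le_max_left _ _).trans_lt hr.1, hr.2⟩
  by_contra hcon
  push Not at hcon
  have h1 : ∀ᶠ s in 𝓝 r, ε / 2 < dist (h s) c :=
    ((hc.continuousAt (isOpen_Ioo.mem_nhds hr0)).dist continuousAt_const).eventually
      (lt_mem_nhds (by linarith))
  have h2 : ∀ᶠ s in 𝓝 r, s ∈ Ioo δ 1 :=
    isOpen_Ioo.mem_nhds ⟨(le_max_right _ _).trans_lt hr.1, hr.2⟩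
  obtain ⟨_, ⟨q, rfl⟩, hs1, hs2⟩ := Rat.denseRange_cast.inter_nhds_nonempty (h1.and h2)
  exact absurd (hWs (hδW hs2)) (not_lt.mpr (le_of_lt hs1))

/-- A sequence of radii that tends to `1`. -/
def radii (k : ℕ) : ℝ := 1 - 1 / (k + 2)

theorem radii_mem (k : ℕ) : radii k ∈ Ioo (0 : ℝ) 1 := by
  have h : (0 : ℝ) < k + 2 := by positivity
  refine ⟨?_, by simp only [radii]; linarith [one_div_pos.mpr h]⟩
  have : 1 / ((k : ℝ) + 2) < 1 := by
    rw [div_lt_one h]; linarith [(Nat.cast_nonneg k : (0 : ℝ) ≤ k)]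
  simp only [radii]
  linarith

theorem tendsto_radii : Tendsto radii atTop (𝓝[<] 1) := by
  refine tendsto_nhdsWithin_iff.mpr ⟨?_, Eventually.of_forall fun k => (radii_mem k).2⟩
  have h : Tendsto (fun k : ℕ => 1 - 1 / ((k + 1 : ℕ) + 1 : ℝ)) atTop (𝓝 (1 - 0)) :=
    ((tendsto_one_div_add_atTop_nhds_zero_nat (𝕜 := ℝ)).comp (tendsto_add_atTop_nat 1)).const_sub 1
  rw [sub_zero] at h
  refine h.congr fun k => ?_
  simp only [radii]
  push_cast
  ring_nf

namespace ModelDomain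

open Metric

variable {n : ℕ} (D : ModelDomain n)

theorem smul_mem_of_le {r : ℝ} (hr : r ∈ Ioo (0 : ℝ) 1) {ζ p : EuclideanSpace ℂ (Fin n)}
    (hζ : ζ ∈ D.Γ) (hp : ∀ j, ‖p j‖ ≤ ‖ζ j‖) : r • p ∈ D.X :=
  D.isCompleteReinhardt_X _ (D.smul_mem hr hζ) _ fun j => by
    simp only [PiLp.smul_apply, norm_smul]
    gcongr
    exact hp j

theorem complex_smul_mem {c : ℂ} (hc : ‖c‖ < 1) {ζ : EuclideanSpace ℂ (Fin n)} (hζ : ζ ∈ D.Γ) :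
    c • ζ ∈ D.X := by
  rcases eq_or_ne c 0 with rfl | h0
  · rw [zero_smul]; exact D.zero_mem_X
  · refine D.isCompleteReinhardt_X _ (D.smul_mem ⟨norm_pos_iff.mpr h0, hc⟩ hζ) _ fun j => ?_
    simp

/-- Extension by zero off `X` yields a Borel function on the whole space, as the Tonelli arguments
over rotations require. Dilates of points of `Γ` lie in `X`, so the integrals do not change. -/
theorem measurable_indicator_X {F : EuclideanSpace ℂ (Fin n) → ℂ} (hF : ContinuousOn F D.X) :
    Measurable (D.X.indicator F) := by
  classical
  rw [← Set.piecewise_eq_indicator]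
  exact hF.measurable_piecewise continuousOn_const D.isOpen_X.measurableSet

theorem lintegral_indicator_dilate (F : EuclideanSpace ℂ (Fin n) → ℂ) {r : ℝ}
    (hr : r ∈ Ioo (0 : ℝ) 1) :
    ∫⁻ ζ, ‖D.X.indicator F (r • ζ)‖ₑ ^ 2 ∂D.σ = ∫⁻ ζ, ‖F (r • ζ)‖ₑ ^ 2 ∂D.σ := by
  refine setLIntegral_congr_fun D.isClosed_Γ.measurableSet fun ζ hζ => ?_
  simp only [indicator_of_mem (D.smul_mem hr hζ)]

theorem le_hardyNormSq (F : EuclideanSpace ℂ (Fin n) → ℂ) {r : ℝ} (hr : r ∈ Ioo (0 : ℝ) 1) :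
    ∫⁻ ζ, ‖F (r • ζ)‖ₑ ^ 2 ∂D.σ ≤ D.hardyNormSq F :=
  le_iSup₂_of_le (f := fun r _ => ∫⁻ ζ, ‖F (r • ζ)‖ₑ ^ 2 ∂D.σ) r hr le_rfl

/-- One step of the evaluation estimate: replace one more coordinate. -/
theorem lintegral_mixCoord_insert_le (hn : 0 < n) {a z : EuclideanSpace ℂ (Fin n)} {c : ℝ}
    (hc : c ∈ Ioo (0 : ℝ) 1) (hz : ∀ j, ‖z j‖ ≤ ‖a j‖) {F : EuclideanSpace ℂ (Fin n) → ℂ}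
    (hF : DifferentiableOn ℂ F D.X) {r : ℝ} (hr : r ∈ Ioo (0 : ℝ) 1) {s : Finset (Fin n)}
    {k : Fin n} (hk : k ∉ s) :
    ∫⁻ ζ in {ζ | ∀ j, ‖a j‖ ≤ c * ‖ζ j‖}, ‖F (r • mixCoord (insert k s) z ζ)‖ₑ ^ 2 ∂D.σ ≤
      (ENNReal.ofReal (2 / (1 - c)) * ENNReal.ofReal (2 * Real.pi)) *
        ∫⁻ ζ in {ζ | ∀ j, ‖a j‖ ≤ c * ‖ζ j‖}, ‖F (r • mixCoord s z ζ)‖ₑ ^ 2 ∂D.σ := by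
  set A : Set (EuclideanSpace ℂ (Fin n)) := {ζ | ∀ j, ‖a j‖ ≤ c * ‖ζ j‖} with hA
  have hAm : MeasurableSet A := by
    simp only [hA, Set.ofPred_forall]
    exact (isClosed_iInter fun j => isClosed_le continuous_const (by fun_prop)).measurableSet
  have hfin := D.isFiniteMeasure_σ hn
  have hAΓ : MeasurableSet (A ∩ D.Γ) := hAm.inter D.isClosed_Γ.measurableSet
  have hμ : D.σ.restrict A = (Measure.euclideanHausdorffMeasure D.dim).restrict (A ∩ D.Γ) := by
    rw [ModelDomain.σ, Measure.restrict_restrict hAm]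
  have hdom : ∀ ζ ∈ A, ∀ j, ‖z j‖ ≤ c * ‖ζ j‖ := fun ζ hζ j => (hz j).trans (hζ j)
  have hdom' : ∀ ζ ∈ A, ∀ j, ‖z j‖ ≤ ‖ζ j‖ := fun ζ hζ j =>
    (hdom ζ hζ j).trans (mul_le_of_le_one_left (norm_nonneg _) hc.2.le)
  set R : ℝ → EuclideanSpace ℂ (Fin n) → EuclideanSpace ℂ (Fin n) :=
    fun θ ζ => diagRotation (Pi.single k θ) ζ with hR
  have hRm : Measurable (Function.uncurry R) :=
    (continuous_diagRotation.comp (((continuous_single (A := fun _ : Fin n => ℝ) k).comp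
      continuous_fst).prodMk continuous_snd)).measurable
  have hRA : ∀ θ ζ, R θ ζ ∈ A ∩ D.Γ ↔ ζ ∈ A ∩ D.Γ := fun θ ζ => by
    refine and_congr (forall_congr' fun j => ?_) (D.diagRotation_mem_Γ _)
    rw [norm_diagRotation_apply]
  have hRμ : ∀ θ, MeasurePreserving (R θ) (D.σ.restrict A) (D.σ.restrict A) := fun θ => by
    rw [hμ]
    exact D.measurePreserving_of_isometry (diagRotation (Pi.single k θ)).toIsometryEquiv hAΓ
      fun ζ => hRA θ ζ
  set h : EuclideanSpace ℂ (Fin n) → ℝ≥0∞ :=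
    fun ζ => ‖D.X.indicator F (r • mixCoord s z ζ)‖ₑ ^ 2 with hh
  have hhm : Measurable h := ((D.measurable_indicator_X hF.continuousOn).comp
    ((continuous_mixCoord s z).const_smul r).measurable).enorm.pow_const 2
  have hmix : ∀ ζ ∈ A ∩ D.Γ, ∀ s, r • mixCoord s z ζ ∈ D.X := fun ζ hζ s => by
    refine D.smul_mem_of_le hr hζ.2 fun j => ?_
    rw [mixCoord_apply]
    split_ifs
    · exact hdom' ζ hζ.1 j
    · exact le_rfl
  -- Only the coordinate `k` varies, as `l * ζ k` with `l` in the closed disc. The target value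
  -- corresponds to `l = z k / ζ k`, of modulus at most `c`, and the circle mean is a mean over
  -- rotations of this coordinate, which preserve the measure on `A`.
  have hslice : ∀ ζ ∈ A ∩ D.Γ, ‖F (r • mixCoord (insert k s) z ζ)‖ₑ ^ 2 ≤
      ENNReal.ofReal (2 / (1 - c)) * ∫⁻ θ, h (R θ ζ) ∂arcMeasure := by
    intro ζ hζ
    set p : ℂ → EuclideanSpace ℂ (Fin n) := fun l => WithLp.toLp 2 fun j =>
      if j = k then l * ζ k else mixCoord s z ζ j with hp
    have hpd : Differentiable ℂ fun l => r • p l := by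
      rw [differentiable_euclidean]
      intro j
      by_cases hj : j = k
      · have : (fun l => (r • p l) j) = fun l => r • (l * ζ k) := by
          ext l; simp [hp, hj]
        rw [this]
        exact ((differentiable_id.mul_const _).const_smul r)
      · have : (fun l => (r • p l) j) = fun l => r • mixCoord s z ζ j := by
          ext l; simp [hp, hj]
        rw [this]
        exact differentiable_const _
    have hpX : ∀ l ∈ closedBall (0 : ℂ) 1, r • p l ∈ D.X := fun l hl => by
      refine D.smul_mem_of_le hr hζ.2 fun j => ?_
      change ‖if j = k then l * ζ k else mixCoord s z ζ j‖ ≤ _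
      split_ifs with hj
      · rw [hj, norm_mul]
        exact mul_le_of_le_one_left (norm_nonneg _) (by simpa using hl)
      · rw [mixCoord_apply]
        split_ifs
        · exact hdom' ζ hζ.1 j
        · exact le_rfl
    have hg : DiffContOnCl ℂ (fun l => F (r • p l)) (ball 0 1) := by
      refine DifferentiableOn.diffContOnCl (hF.comp hpd.differentiableOn fun l hl => hpX l ?_)
      rwa [closure_ball _ one_ne_zero] at hl
    have hw : ‖z k / ζ k‖ ≤ c := by
      rcases eq_or_ne (ζ k) 0 with h0 | h0
      · rw [h0, div_zero, norm_zero]; exact hc.1.le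
      · rw [norm_div, div_le_iff₀ (norm_pos_iff.mpr h0)]
        exact hdom ζ hζ.1 k
    have h1 := enorm_sq_le_lintegral_circle hg hc.1 hc.2 hw
    have h2 : p (z k / ζ k) = mixCoord (insert k s) z ζ := by
      ext j
      change (if j = k then z k / ζ k * ζ k else mixCoord s z ζ j) = _
      rw [mixCoord_apply, mixCoord_apply]
      by_cases hj : j = k
      · subst hj
        simp only [if_true, Finset.mem_insert_self]
        -- If the coordinate of `ζ` is zero, so is that of `z` by domination, and the convention for
        -- division by zero gives the right point.
        rcases eq_or_ne (ζ j) 0 with h0 | h0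
        · have := hdom ζ hζ.1 j
          rw [h0, norm_zero, mul_zero] at this
          rw [h0, mul_zero, norm_le_zero_iff.mp this]
        · exact div_mul_cancel₀ _ h0
      · simp [hj]
    have h3 : ∀ θ, p (circleMap 0 1 θ) = mixCoord s z (R θ ζ) := fun θ => by
      ext j
      change (if j = k then circleMap 0 1 θ * ζ k else mixCoord s z ζ j) = _
      rw [mixCoord_apply, mixCoord_apply, hR, diagRotation_apply]
      by_cases hj : j = k
      · subst hj
        simp [hk, circleMap]
      · simp [hj]
    rw [h2] at h1
    refine h1.trans (le_of_eq ?_)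
    congr 1
    refine lintegral_congr fun θ => ?_
    rw [h3, hh]
    simp only
    rw [indicator_of_mem (hmix _ ((hRA θ ζ).mpr hζ) s)]
  have hmem : ∀ᵐ ζ ∂D.σ.restrict A, ζ ∈ A ∩ D.Γ := by
    rw [hμ]; exact ae_restrict_mem hAΓ
  calc ∫⁻ ζ in A, ‖F (r • mixCoord (insert k s) z ζ)‖ₑ ^ 2 ∂D.σ
      ≤ ∫⁻ ζ in A, ENNReal.ofReal (2 / (1 - c)) * ∫⁻ θ, h (R θ ζ) ∂arcMeasure ∂D.σ := by
        refine lintegral_mono_ae ?_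
        filter_upwards [hmem] with ζ hζ using hslice ζ hζ
    _ = ENNReal.ofReal (2 / (1 - c)) * (ENNReal.ofReal (2 * Real.pi) * ∫⁻ ζ in A, h ζ ∂D.σ) := by
        rw [lintegral_const_mul' _ _ ENNReal.ofReal_ne_top,
          lintegral_lintegral_arcMeasure hRm hRμ hhm]
    _ = _ := by
        rw [mul_assoc]
        congr 2
        refine lintegral_congr_ae ?_
        filter_upwards [hmem] with ζ hζ
        rw [hh]
        simp only
        rw [indicator_of_mem (hmix ζ hζ s)]

/-- Point evaluations are bounded on the Hardy space, locally uniformly. -/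
theorem exists_enorm_sq_le (hn : 0 < n) {a : EuclideanSpace ℂ (Fin n)} (ha : a ∈ D.X) :
    ∃ C : ℝ≥0∞, C ≠ ⊤ ∧ ∀ F, DifferentiableOn ℂ F D.X → ∀ z : EuclideanSpace ℂ (Fin n),
      (∀ j, ‖z j‖ ≤ ‖a j‖) → ‖F z‖ₑ ^ 2 ≤ C * D.hardyNormSq F := by
  obtain ⟨c, hc, hA0⟩ := D.exists_σ_pos hn ha
  have hfin := D.isFiniteMeasure_σ hn
  set A : Set (EuclideanSpace ℂ (Fin n)) := {ζ | ∀ j, ‖a j‖ ≤ c * ‖ζ j‖} with hA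
  have hAtop : D.σ A ≠ ⊤ := measure_ne_top _ _
  set K := ENNReal.ofReal (2 / (1 - c)) * ENNReal.ofReal (2 * Real.pi) with hK
  have hKtop : K ≠ ⊤ := ENNReal.mul_ne_top ENNReal.ofReal_ne_top ENNReal.ofReal_ne_top
  refine ⟨(D.σ A)⁻¹ * K ^ n, ENNReal.mul_ne_top (ENNReal.inv_ne_top.mpr hA0)
    (ENNReal.pow_ne_top hKtop), fun F hF z hz => ?_⟩
  -- For the empty set the integral is bounded by the Hardy norm. For the full set the integrand is
  -- the constant `‖F (r • z)‖ₑ ^ 2`, and division by the positive measure of `A` gives the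
  -- estimate.
  have hind : ∀ r ∈ Ioo (0 : ℝ) 1, ∀ s : Finset (Fin n),
      ∫⁻ ζ in A, ‖F (r • mixCoord s z ζ)‖ₑ ^ 2 ∂D.σ ≤ K ^ s.card * D.hardyNormSq F := by
    intro r hr s
    induction s using Finset.induction_on with
    | empty =>
      have : ∀ ζ, mixCoord ∅ z ζ = ζ := fun ζ => by ext j; simp [mixCoord_apply]
      simp only [this, Finset.card_empty, pow_zero, one_mul]
      exact (setLIntegral_le_lintegral _ _).trans (D.le_hardyNormSq F hr)
    | insert k s hk ih =>
      refine (D.lintegral_mixCoord_insert_le hn hc hz hF hr hk).trans ?_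
      refine (mul_le_mul_right ih K).trans (le_of_eq ?_)
      rw [Finset.card_insert_of_notMem hk, pow_succ', mul_assoc K]
  have hr : ∀ r ∈ Ioo (0 : ℝ) 1, ‖F (r • z)‖ₑ ^ 2 ≤ (D.σ A)⁻¹ * K ^ n * D.hardyNormSq F := by
    intro r hr
    have h1 := hind r hr Finset.univ
    have h2 : ∀ ζ, mixCoord Finset.univ z ζ = z := fun ζ => by ext j; simp [mixCoord_apply]
    simp only [h2, Finset.card_univ, Fintype.card_fin, setLIntegral_const] at h1
    rw [mul_assoc, mul_comm (D.σ A)⁻¹, ← div_eq_mul_inv,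
      ENNReal.le_div_iff_mul_le (Or.inl hA0) (Or.inl hAtop)]
    exact h1
  have hzX : z ∈ D.X := D.isCompleteReinhardt_X a ha z hz
  have hlim : Tendsto (fun r : ℝ => ‖F (r • z)‖ₑ ^ 2) (𝓝[<] 1) (𝓝 (‖F z‖ₑ ^ 2)) := by
    have h1 : Tendsto (fun r : ℝ => r • z) (𝓝[<] 1) (𝓝 z) := by
      have : Tendsto (fun r : ℝ => r • z) (𝓝 1) (𝓝 ((1 : ℝ) • z)) :=
        (by fun_prop : Continuous fun r : ℝ => r • z).tendsto 1
      rw [one_smul] at this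
      exact this.mono_left nhdsWithin_le_nhds
    exact ((ENNReal.continuous_pow 2).tendsto _).comp ((continuous_enorm.tendsto _).comp
      ((hF.continuousOn.continuousAt (D.isOpen_X.mem_nhds hzX)).tendsto.comp h1))
  refine le_of_tendsto hlim ?_
  filter_upwards [eventually_mem_Ioo_one one_pos] with r h using hr r h

end ModelDomain

end

/-! ### Radial limits, closedness of the Hardy space and the Szegő kernel. -/

noncomputable section

/-- Multiplication by `exp (iθ)`. -/
def phaseRotation {n : ℕ} (θ : ℝ) (ζ : EuclideanSpace ℂ (Fin n)) : EuclideanSpace ℂ (Fin n) :=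
  diagRotation (fun _ => θ) ζ

theorem measurable_phaseRotation {n : ℕ} :
    Measurable (Function.uncurry (phaseRotation (n := n))) :=
  (continuous_diagRotation.comp ((continuous_pi fun _ => continuous_fst).prodMk
    continuous_snd)).measurable

theorem measurable_phaseRotation_swap {n : ℕ} :
    Measurable fun q : EuclideanSpace ℂ (Fin n) × ℝ => phaseRotation q.2 q.1 :=
  (continuous_diagRotation.comp ((continuous_pi fun _ => continuous_snd).prodMk
    continuous_fst)).measurable

theorem circleMap_smul {n : ℕ} (r θ : ℝ) (ζ : EuclideanSpace ℂ (Fin n)) :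
    circleMap 0 r θ • ζ = r • phaseRotation θ ζ := by
  ext j
  simp [phaseRotation, diagRotation_apply, circleMap, mul_assoc]

namespace ModelDomain

open Metric

variable {n : ℕ} (D : ModelDomain n)

theorem measurePreserving_phaseRotation (θ : ℝ) :
    MeasurePreserving (phaseRotation θ) D.σ D.σ := D.measurePreserving_diagRotation _

theorem phaseRotation_mem_Γ (θ : ℝ) {ζ : EuclideanSpace ℂ (Fin n)} :
    phaseRotation θ ζ ∈ D.Γ ↔ ζ ∈ D.Γ := D.diagRotation_mem_Γ _

theorem ae_mem_Γ : ∀ᵐ ζ ∂D.σ, ζ ∈ D.Γ := ae_restrict_mem D.isClosed_Γ.measurableSet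

theorem differentiableOn_slice {F : EuclideanSpace ℂ (Fin n) → ℂ} (hF : DifferentiableOn ℂ F D.X)
    {ζ : EuclideanSpace ℂ (Fin n)} (hζ : ζ ∈ D.Γ) :
    DifferentiableOn ℂ (fun l : ℂ => F (l • ζ)) (ball 0 1) :=
  hF.comp (differentiable_id.smul_const ζ).differentiableOn fun l hl =>
    D.complex_smul_mem (by simpa using hl) hζ

theorem measurable_dilate_enorm_sq {F : EuclideanSpace ℂ (Fin n) → ℂ} (hF : ContinuousOn F D.X)
    (r : ℝ) : Measurable fun ζ => ‖D.X.indicator F (r • ζ)‖ₑ ^ 2 :=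
  ((D.measurable_indicator_X hF).comp (measurable_const_smul r)).enorm.pow_const 2

theorem lintegral_lintegral_phaseRotation (hn : 0 < n) {h : EuclideanSpace ℂ (Fin n) → ℝ≥0∞}
    (hh : Measurable h) : ∫⁻ ζ, ∫⁻ θ, h (phaseRotation θ ζ) ∂arcMeasure ∂D.σ =
      ENNReal.ofReal (2 * Real.pi) * ∫⁻ ζ, h ζ ∂D.σ :=
  have := D.isFiniteMeasure_σ hn
  lintegral_lintegral_arcMeasure measurable_phaseRotation D.measurePreserving_phaseRotation hh

/-- Fatou's theorem on almost every slice. -/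
theorem ae_exists_slice_limit (hn : 0 < n) {F : EuclideanSpace ℂ (Fin n) → ℂ} (hF : D.MemHardy F) :
    ∀ᵐ ζ ∂D.σ, ∃ v : Lp ℂ 2 arcMeasure, (∀ᵐ θ ∂arcMeasure,
      Tendsto (fun r : ℝ => F (r • phaseRotation θ ζ)) (𝓝[<] 1) (𝓝 (v θ))) ∧
      ∀ r ∈ Ioo (0 : ℝ) 1, ∫⁻ θ, ‖F (r • phaseRotation θ ζ)‖ₑ ^ 2 ∂arcMeasure ≤
        ∫⁻ θ, ‖v θ‖ₑ ^ 2 ∂arcMeasure := by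
  have hfin := D.isFiniteMeasure_σ hn
  obtain ⟨h, hh⟩ : ∃ h : ℕ → EuclideanSpace ℂ (Fin n) → ℝ≥0∞,
      ∀ k, h k = fun ζ => ‖D.X.indicator F (radii k • ζ)‖ₑ ^ 2 := ⟨_, fun _ => rfl⟩
  have hhm : ∀ k, Measurable (h k) := fun k => by
    rw [hh]; exact D.measurable_dilate_enorm_sq hF.1.continuousOn _
  obtain ⟨I, hI⟩ : ∃ I : ℕ → EuclideanSpace ℂ (Fin n) → ℝ≥0∞,
      ∀ k, I k = fun ζ => ∫⁻ θ, h k (phaseRotation θ ζ) ∂arcMeasure := ⟨_, fun _ => rfl⟩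
  have hIm : ∀ k, Measurable (I k) := fun k => by
    rw [hI]
    have h1 : Measurable fun q : EuclideanSpace ℂ (Fin n) × ℝ => h k (phaseRotation q.2 q.1) :=
      (hhm k).comp measurable_phaseRotation_swap
    exact h1.lintegral_prod_right'
  have hle : ∀ k, ∫⁻ ζ, I k ζ ∂D.σ ≤ ENNReal.ofReal (2 * Real.pi) * D.hardyNormSq F := fun k => by
    rw [hI, D.lintegral_lintegral_phaseRotation hn (hhm k), hh,
      D.lintegral_indicator_dilate F (radii_mem k)]
    gcongr
    exact D.le_hardyNormSq F (radii_mem k)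
  -- By Fatou's lemma the lower limit of the slice means is integrable, so on almost every slice the
  -- means are bounded along infinitely many of the radii.
  have hlim : ∫⁻ ζ, liminf (fun k => I k ζ) atTop ∂D.σ ≤
      ENNReal.ofReal (2 * Real.pi) * D.hardyNormSq F :=
    (lintegral_liminf_le hIm).trans (liminf_le_of_le (by isBoundedDefault) fun b hb => by
      obtain ⟨k, hk⟩ := hb.exists
      exact hk.trans (hle k))
  have hlt : ∀ᵐ ζ ∂D.σ, liminf (fun k => I k ζ) atTop < ⊤ :=
    ae_lt_top (.liminf hIm)
      (hlim.trans_lt (ENNReal.mul_lt_top ENNReal.ofReal_lt_top hF.2)).ne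
  filter_upwards [hlt, D.ae_mem_Γ] with ζ hζ hζΓ
  obtain ⟨C, hC1, hC2⟩ := exists_between hζ
  have hfr := frequently_lt_of_liminf_lt (by isBoundedDefault) hC1
  have hb : ∃ᶠ r in 𝓝[<] (1 : ℝ),
      ∫⁻ θ, ‖F (circleMap 0 r θ • ζ)‖ₑ ^ 2 ∂arcMeasure ≤ C := by
    refine tendsto_radii.frequently (hfr.mono fun k hk => le_trans (le_of_eq ?_) hk.le)
    rw [hI, hh]
    refine lintegral_congr fun θ => ?_
    rw [circleMap_smul]
    beta_reduce
    rw [indicator_of_mem (D.smul_mem (radii_mem k) ((D.phaseRotation_mem_Γ θ).mpr hζΓ))]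
  obtain ⟨v, hv1, hv2⟩ := exists_radial_limit_of_frequently_bounded
    (D.differentiableOn_slice hF.1 hζΓ) hC2.ne hb
  simp only [circleMap_smul] at hv1 hv2
  exact ⟨v, hv1, hv2⟩

/-- Since `F` is continuous along each radius, the limit may be tested on rational radii, and
existence of a limit for a countable family of measurable functions is a measurable condition. -/
theorem measurableSet_exists_radialLimit {F : EuclideanSpace ℂ (Fin n) → ℂ}
    (hF : ContinuousOn F D.X) :
    MeasurableSet (D.Γ ∩ {ζ | ∃ c, Tendsto (fun r : ℝ => F (r • ζ)) (𝓝[<] 1) (𝓝 c)}) := by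
  have h1 : MeasurableSet {ζ : EuclideanSpace ℂ (Fin n) |
      ∃ c, Tendsto (fun q : ℚ => D.X.indicator F ((q : ℝ) • ζ))
        (comap (fun q : ℚ => (q : ℝ)) (𝓝[<] 1)) (𝓝 c)} :=
    measurableSet_exists_tendsto fun q =>
      (D.measurable_indicator_X hF).comp (measurable_const_smul (q : ℝ))
  convert D.isClosed_Γ.measurableSet.inter h1 using 1
  ext ζ
  refine and_congr_right fun hζ => exists_congr fun c => ?_
  have heq : ∀ᶠ r in 𝓝[<] (1 : ℝ), F (r • ζ) = D.X.indicator F (r • ζ) := by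
    filter_upwards [eventually_mem_Ioo_one one_pos] with r hr
    rw [indicator_of_mem (D.smul_mem hr hζ)]
  rw [tendsto_congr' heq]
  refine ⟨fun h => h.comp tendsto_comap, fun h => tendsto_nhdsLT_one_of_rat ?_ h⟩
  have h2 : ContinuousOn (fun r : ℝ => F (r • ζ)) (Ioo 0 1) :=
    hF.comp (by fun_prop) fun r hr => D.smul_mem hr hζ
  exact h2.congr fun r hr => indicator_of_mem (D.smul_mem hr hζ) F

/-- Functions in the Hardy space have radial limits almost everywhere. -/
theorem ae_tendsto_radialLimit (hn : 0 < n) {F : EuclideanSpace ℂ (Fin n) → ℂ}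
    (hF : D.MemHardy F) :
    ∀ᵐ ζ ∂D.σ, Tendsto (fun r : ℝ => F (r • ζ)) (𝓝[<] 1) (𝓝 (radialLimit F ζ)) := by
  have hfin := D.isFiniteMeasure_σ hn
  set L := D.Γ ∩ {ζ | ∃ c, Tendsto (fun r : ℝ => F (r • ζ)) (𝓝[<] 1) (𝓝 c)} with hL
  have hLm : MeasurableSet L := D.measurableSet_exists_radialLimit hF.1.continuousOn
  -- Almost every circle orbit meets the exceptional set in a null set; averaging over the orbits
  -- shows that the set itself is null.
  have h1 : ∀ᵐ ζ ∂D.σ, ∫⁻ θ, Lᶜ.indicator 1 (phaseRotation θ ζ) ∂arcMeasure = 0 := by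
    filter_upwards [D.ae_exists_slice_limit hn hF, D.ae_mem_Γ] with ζ ⟨v, hv, _⟩ hζ
    refine lintegral_eq_zero_of_ae_eq_zero ?_
    filter_upwards [hv] with θ hθ
    have : phaseRotation θ ζ ∈ L := ⟨(D.phaseRotation_mem_Γ θ).mpr hζ, _, hθ⟩
    simp [this]
  have h2 := D.lintegral_lintegral_phaseRotation hn (h := Lᶜ.indicator 1)
    (measurable_one.indicator hLm.compl)
  rw [lintegral_eq_zero_of_ae_eq_zero h1, lintegral_indicator_one hLm.compl] at h2
  have h3 : D.σ Lᶜ = 0 := by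
    have hpos : ENNReal.ofReal (2 * Real.pi) ≠ 0 := by simp [Real.pi_pos]
    exact (mul_eq_zero.mp h2.symm).resolve_left hpos
  have h4 : ∀ᵐ ζ ∂D.σ, ζ ∈ L := h3
  filter_upwards [h4] with ζ hζ using tendsto_nhds_limUnder hζ.2

theorem lintegral_le_of_ae_tendsto {F u : EuclideanSpace ℂ (Fin n) → ℂ} (hF : ContinuousOn F D.X)
    (hu : ∀ᵐ ζ ∂D.σ, Tendsto (fun r : ℝ => F (r • ζ)) (𝓝[<] 1) (𝓝 (u ζ))) :
    ∫⁻ ζ, ‖u ζ‖ₑ ^ 2 ∂D.σ ≤ D.hardyNormSq F := by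
  have hm : ∀ k, AEMeasurable (fun ζ => ‖F (radii k • ζ)‖ₑ ^ 2) D.σ := fun k =>
    ((D.measurable_dilate hF (radii_mem k)).enorm).pow_const 2
  calc ∫⁻ ζ, ‖u ζ‖ₑ ^ 2 ∂D.σ = ∫⁻ ζ, liminf (fun k => ‖F (radii k • ζ)‖ₑ ^ 2) atTop ∂D.σ := by
        refine lintegral_congr_ae ?_
        filter_upwards [hu] with ζ hζ
        exact (((ENNReal.continuous_pow 2).tendsto _).comp ((continuous_enorm.tendsto _).comp
          (hζ.comp tendsto_radii))).liminf_eq.symm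
    _ ≤ liminf (fun k => ∫⁻ ζ, ‖F (radii k • ζ)‖ₑ ^ 2 ∂D.σ) atTop := lintegral_liminf_le' hm
    _ ≤ D.hardyNormSq F := liminf_le_of_le (by isBoundedDefault) fun b hb => by
        obtain ⟨k, hk⟩ := hb.exists
        exact hk.trans (D.le_hardyNormSq F (radii_mem k))

theorem memLp_of_ae_tendsto {F u : EuclideanSpace ℂ (Fin n) → ℂ} (hF : ContinuousOn F D.X)
    (hN : D.hardyNormSq F < ⊤)
    (hu : ∀ᵐ ζ ∂D.σ, Tendsto (fun r : ℝ => F (r • ζ)) (𝓝[<] 1) (𝓝 (u ζ))) : MemLp u 2 D.σ := by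
  refine ⟨aestronglyMeasurable_of_tendsto_ae atTop (f := fun k ζ => F (radii k • ζ))
    (fun k => (D.measurable_dilate hF (radii_mem k)).aestronglyMeasurable) ?_, ?_⟩
  · filter_upwards [hu] with ζ hζ using hζ.comp tendsto_radii
  · rw [eLpNorm_eq_lintegral_rpow_enorm_toReal two_ne_zero ENNReal.ofNat_ne_top]
    simp only [ENNReal.toReal_ofNat, ENNReal.rpow_ofNat]
    exact ENNReal.rpow_lt_top_of_nonneg (by norm_num)
      ((D.lintegral_le_of_ae_tendsto hF hu).trans_lt hN).ne

/-- Functions in the Hardy space have boundary functions in `L²`. -/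
theorem exists_isHardyExtension (hn : 0 < n) {F : EuclideanSpace ℂ (Fin n) → ℂ}
    (hF : D.MemHardy F) : ∃ u, D.IsHardyExtension u F := by
  have h1 := D.ae_tendsto_radialLimit hn hF
  have h2 := D.memLp_of_ae_tendsto hF.1.continuousOn hF.2 h1
  refine ⟨h2.toLp _, hF, ?_⟩
  filter_upwards [h1, h2.coeFn_toLp] with ζ hζ hζ'
  rwa [hζ']

variable {D}

/-- One inequality is Fatou's lemma. For the other, both sides are averaged over circle orbits, and
on almost every slice the square means of the dilates are at most that of the boundary function.
Uniqueness of extensions and closedness of the Hardy space rest on this isometry. -/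
theorem IsHardyExtension.hardyNormSq_eq (hn : 0 < n) {u : Lp ℂ 2 D.σ}
    {F : EuclideanSpace ℂ (Fin n) → ℂ} (h : D.IsHardyExtension u F) :
    D.hardyNormSq F = ‖u‖ₑ ^ 2 := by
  have hfin := D.isFiniteMeasure_σ hn
  rw [Lp.enorm_sq_eq]
  refine le_antisymm ?_ (D.lintegral_le_of_ae_tendsto h.1.1.continuousOn h.2)
  refine iSup₂_le fun r hr => ?_
  have hpos : ENNReal.ofReal (2 * Real.pi) ≠ 0 := by simp [Real.pi_pos]
  have hum : Measurable fun ζ => ‖u ζ‖ₑ ^ 2 := (Lp.stronglyMeasurable u).enorm.pow_const 2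
  rw [← ENNReal.mul_le_mul_iff_right hpos ENNReal.ofReal_ne_top,
    ← D.lintegral_lintegral_phaseRotation hn hum, ← D.lintegral_indicator_dilate F hr,
    ← D.lintegral_lintegral_phaseRotation hn (D.measurable_dilate_enorm_sq h.1.1.continuousOn r)]
  refine lintegral_mono_ae ?_
  filter_upwards [D.ae_exists_slice_limit hn h.1, D.ae_mem_Γ,
    ae_arcMeasure_preimage_eq_zero measurable_phaseRotation D.measurePreserving_phaseRotation h.2]
    with ζ ⟨v, hv1, hv2⟩ hζ h3
  calc ∫⁻ θ, ‖D.X.indicator F (r • phaseRotation θ ζ)‖ₑ ^ 2 ∂arcMeasure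
      = ∫⁻ θ, ‖F (r • phaseRotation θ ζ)‖ₑ ^ 2 ∂arcMeasure := by
        refine lintegral_congr fun θ => ?_
        rw [indicator_of_mem (D.smul_mem hr ((D.phaseRotation_mem_Γ θ).mpr hζ))]
    _ ≤ ∫⁻ θ, ‖v θ‖ₑ ^ 2 ∂arcMeasure := hv2 r hr
    _ = ∫⁻ θ, ‖u (phaseRotation θ ζ)‖ₑ ^ 2 ∂arcMeasure := by
        refine lintegral_congr_ae ?_
        filter_upwards [hv1, h3] with θ h4 h5
        rw [tendsto_nhds_unique h4 h5]

theorem IsHardyExtension.sub {u v : Lp ℂ 2 D.σ} {F H : EuclideanSpace ℂ (Fin n) → ℂ}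
    (hu : D.IsHardyExtension u F) (hv : D.IsHardyExtension v H) :
    D.IsHardyExtension (u - v) (fun z => F z - H z) := by
  refine ⟨⟨hu.1.1.sub hv.1.1, ?_⟩, ?_⟩
  · have := D.hardyNormSq_add_lt_top hu.1.1.continuousOn hu.1.2
      (D.hardyNormSq_const_mul_lt_top (-1) hv.1.2)
    simpa [sub_eq_add_neg] using this
  · filter_upwards [hu.2, hv.2, Lp.coeFn_sub u v] with ζ h1 h2 h3
    rw [h3]
    exact h1.sub h2

theorem IsHardyExtension.add {u v : Lp ℂ 2 D.σ} {F H : EuclideanSpace ℂ (Fin n) → ℂ}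
    (hu : D.IsHardyExtension u F) (hv : D.IsHardyExtension v H) :
    D.IsHardyExtension (u + v) (fun z => F z + H z) := by
  refine ⟨⟨hu.1.1.add hv.1.1, D.hardyNormSq_add_lt_top hu.1.1.continuousOn hu.1.2 hv.1.2⟩, ?_⟩
  filter_upwards [hu.2, hv.2, Lp.coeFn_add u v] with ζ h1 h2 h3
  rw [h3]
  exact h1.add h2

theorem IsHardyExtension.const_smul (c : ℂ) {u : Lp ℂ 2 D.σ} {F : EuclideanSpace ℂ (Fin n) → ℂ}
    (hu : D.IsHardyExtension u F) : D.IsHardyExtension (c • u) (fun z => c * F z) := by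
  refine ⟨⟨hu.1.1.const_mul c, D.hardyNormSq_const_mul_lt_top c hu.1.2⟩, ?_⟩
  filter_upwards [hu.2, Lp.coeFn_smul c u] with ζ h1 h3
  rw [h3]
  exact h1.const_mul c

/-- Functions in the Hardy space are determined by their boundary functions. -/
theorem IsHardyExtension.eqOn (hn : 0 < n) {u : Lp ℂ 2 D.σ}
    {F H : EuclideanSpace ℂ (Fin n) → ℂ} (hF : D.IsHardyExtension u F)
    (hH : D.IsHardyExtension u H) : EqOn F H D.X := by
  intro z hz
  obtain ⟨C, -, hC⟩ := D.exists_enorm_sq_le hn hz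
  have h1 := hF.sub hH
  have h2 := hC _ h1.1.1 z fun _ => le_rfl
  rw [h1.hardyNormSq_eq hn, sub_self] at h2
  simpa [sub_eq_zero] using h2

variable (D)

/-- Fatou's lemma at each fixed radius: pointwise convergence inside `X` suffices. -/
theorem hardyNormSq_le_of_tendsto {F : EuclideanSpace ℂ (Fin n) → ℂ}
    {f : ℕ → EuclideanSpace ℂ (Fin n) → ℂ} (hf : ∀ k, ContinuousOn (f k) D.X)
    (hlim : ∀ z ∈ D.X, Tendsto (fun k => f k z) atTop (𝓝 (F z))) {C : ℝ≥0∞}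
    (hC : ∀ᶠ k in atTop, D.hardyNormSq (f k) ≤ C) : D.hardyNormSq F ≤ C := by
  refine iSup₂_le fun r hr => ?_
  calc ∫⁻ ζ, ‖F (r • ζ)‖ₑ ^ 2 ∂D.σ
      = ∫⁻ ζ, liminf (fun k => ‖f k (r • ζ)‖ₑ ^ 2) atTop ∂D.σ := by
        refine lintegral_congr_ae ?_
        filter_upwards [D.ae_mem_Γ] with ζ hζ
        exact (((ENNReal.continuous_pow 2).tendsto _).comp ((continuous_enorm.tendsto _).comp
          (hlim _ (D.smul_mem hr hζ)))).liminf_eq.symm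
    _ ≤ liminf (fun k => ∫⁻ ζ, ‖f k (r • ζ)‖ₑ ^ 2 ∂D.σ) atTop :=
        lintegral_liminf_le' fun k => ((D.measurable_dilate (hf k) hr).enorm).pow_const 2
    _ ≤ C := liminf_le_of_le (by isBoundedDefault) fun b hb => by
        obtain ⟨k, hk1, hk2⟩ := (hb.and hC).exists
        exact hk1.trans ((D.le_hardyNormSq (f k) hr).trans hk2)

/-- The Hardy space is closed in `L²`. -/
theorem isClosed_hardySpace (hn : 0 < n) : IsClosed (D.hardySpace : Set (Lp ℂ 2 D.σ)) := by
  refine IsSeqClosed.isClosed fun u v hu huv => ?_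
  choose f hf using hu
  have hcau : CauchySeq u := huv.cauchySeq
  -- Locally uniform bounds for point evaluations turn a Cauchy sequence in `L²` into locally
  -- uniformly Cauchy holomorphic functions.
  have hnear : ∀ z ∈ D.X, ∃ r > 0, ∃ C : ℝ≥0∞, C ≠ ⊤ ∧ ∀ z' ∈ ball z r, ∀ k l,
      ‖f k z' - f l z'‖ₑ ^ 2 ≤ C * ‖u k - u l‖ₑ ^ 2 := by
    intro z hz
    obtain ⟨b, hb, hzb⟩ := D.exists_norm_lt hz
    have h1 : ∀ᶠ z' in 𝓝 z, ∀ j, ‖z' j‖ < ‖b j‖ := by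
      rw [eventually_all]
      intro j
      exact (by fun_prop : Continuous fun z' : EuclideanSpace ℂ (Fin n) => ‖z' j‖).tendsto z
        (gt_mem_nhds (hzb j))
    obtain ⟨r, hr, hr2⟩ := Metric.eventually_nhds_iff_ball.mp h1
    obtain ⟨C, hC, hCb⟩ := D.exists_enorm_sq_le hn hb
    refine ⟨r, hr, C, hC, fun z' hz' k l => ?_⟩
    have h2 := (hf k).sub (hf l)
    rw [← h2.hardyNormSq_eq hn]
    exact hCb _ h2.1.1 z' fun j => (hr2 z' hz' j).le
  have hunif : ∀ z ∈ D.X, ∃ r > 0, UniformCauchySeqOn f atTop (ball z r) := by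
    intro z hz
    obtain ⟨r, hr, C, hC, hb⟩ := hnear z hz
    refine ⟨r, hr, ?_⟩
    rw [Metric.uniformCauchySeqOn_iff]
    intro ε hε
    obtain ⟨δ, hδ, hδε⟩ : ∃ δ : ℝ, 0 < δ ∧ C * ENNReal.ofReal δ ^ 2 < ENNReal.ofReal ε ^ 2 := by
      have h1 : Tendsto (fun δ : ℝ => C * ENNReal.ofReal δ ^ 2) (𝓝[>] 0) (𝓝 0) := by
        have h2 : Tendsto (fun δ : ℝ => ENNReal.ofReal δ ^ 2) (𝓝 0) (𝓝 (ENNReal.ofReal 0 ^ 2)) :=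
          ((ENNReal.continuous_pow 2).comp ENNReal.continuous_ofReal).tendsto 0
        have h3 := ENNReal.Tendsto.const_mul (a := C) h2 (Or.inr hC)
        simp only [ENNReal.ofReal_zero, ne_eq, OfNat.ofNat_ne_zero, not_false_eq_true, zero_pow,
          mul_zero] at h3
        exact h3.mono_left nhdsWithin_le_nhds
      have h4 : (0 : ℝ≥0∞) < ENNReal.ofReal ε ^ 2 :=
        ENNReal.pow_pos (ENNReal.ofReal_pos.mpr hε) 2
      obtain ⟨δ, hδ1, hδ2⟩ := ((h1.eventually (gt_mem_nhds h4)).and self_mem_nhdsWithin).exists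
      exact ⟨δ, hδ2, hδ1⟩
    obtain ⟨N, hN⟩ := Metric.cauchySeq_iff.mp hcau δ hδ
    refine ⟨N, fun k hk l hl z' hz' => ?_⟩
    have h5 : ‖f k z' - f l z'‖ₑ ^ 2 < ENNReal.ofReal ε ^ 2 := by
      refine (hb z' hz' k l).trans_lt (lt_of_le_of_lt ?_ hδε)
      gcongr
      rw [← ofReal_norm, ← dist_eq_norm]
      exact ENNReal.ofReal_le_ofReal (hN k hk l hl).le
    have h6 := (ENNReal.pow_right_strictMono two_ne_zero).lt_iff_lt.mp h5
    rw [← ofReal_norm, ← dist_eq_norm, ENNReal.ofReal_lt_ofReal_iff hε] at h6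
    exact h6
  set F : EuclideanSpace ℂ (Fin n) → ℂ := fun z => limUnder atTop fun k => f k z with hF
  have hlim : ∀ z ∈ D.X, Tendsto (fun k => f k z) atTop (𝓝 (F z)) := fun z hz => by
    obtain ⟨r, hr, hu⟩ := hunif z hz
    exact (hu.cauchySeq (mem_ball_self hr)).tendsto_limUnder
  have hdiff : DifferentiableOn ℂ F D.X := by
    intro z hz
    obtain ⟨r, hr, hu⟩ := hunif z hz
    obtain ⟨s, hs, hsX⟩ := Metric.isOpen_iff.mp D.isOpen_X z hz
    have hsub1 : ball z (min r s) ⊆ ball z r := ball_subset_ball (min_le_left _ _)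
    have hsub2 : ball z (min r s) ⊆ D.X := (ball_subset_ball (min_le_right _ _)).trans hsX
    refine (differentiableAt_of_tendstoUniformlyOn_ball (lt_min hr hs)
      (fun k => (hf k).1.1.mono hsub2) ?_).differentiableWithinAt
    exact (hu.mono hsub1).tendstoUniformlyOn_of_tendsto fun z' hz' => hlim z' (hsub2 hz')
  have hcont : ∀ k, ContinuousOn (f k) D.X := fun k => (hf k).1.1.continuousOn
  have hmem : D.MemHardy F := by
    refine ⟨hdiff, ?_⟩
    obtain ⟨M, hM⟩ := (Metric.isBounded_range_of_tendsto u huv).exists_norm_le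
    refine (D.hardyNormSq_le_of_tendsto hcont hlim (C := ENNReal.ofReal M ^ 2)
      (Eventually.of_forall fun k => ?_)).trans_lt (by simp)
    rw [(hf k).hardyNormSq_eq hn, ← ofReal_norm]
    gcongr
    exact hM _ ⟨k, rfl⟩
  obtain ⟨v', hv'⟩ := D.exists_isHardyExtension hn hmem
  -- The limit function has a boundary function `v'` of its own. It is identified with the `L²`
  -- limit through the Hardy norm of `f k - F`, so no interchange of the radial limit with `k → ∞`
  -- is needed.
  suffices Tendsto u atTop (𝓝 v') by
    rw [tendsto_nhds_unique huv this]
    exact ⟨F, hv'⟩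
  rw [Metric.tendsto_atTop]
  intro ε hε
  obtain ⟨N, hN⟩ := Metric.cauchySeq_iff.mp hcau (ε / 2) (half_pos hε)
  refine ⟨N, fun k hk => ?_⟩
  have h1 := (hf k).sub hv'
  have h2 : D.hardyNormSq (fun z => f k z - F z) ≤ ENNReal.ofReal (ε / 2) ^ 2 := by
    refine D.hardyNormSq_le_of_tendsto (f := fun l z => f k z - f l z)
      (fun l => (hcont k).sub (hcont l)) (fun z hz => (hlim z hz).const_sub _) ?_
    filter_upwards [eventually_ge_atTop N] with l hl
    rw [((hf k).sub (hf l)).hardyNormSq_eq hn, ← ofReal_norm, ← dist_eq_norm]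
    gcongr
    exact (hN k hk l hl).le
  rw [h1.hardyNormSq_eq hn, ← ofReal_norm, ← dist_eq_norm] at h2
  have h3 := (ENNReal.pow_right_strictMono two_ne_zero).le_iff_le.mp h2
  rw [ENNReal.ofReal_le_ofReal_iff (half_pos hε).le] at h3
  linarith

theorem hasOrthogonalProjection_hardySpace (hn : 0 < n) :
    D.hardySpace.HasOrthogonalProjection := by
  have := (D.isClosed_hardySpace hn).completeSpace_coe
  infer_instance

/-- The Szegő kernel exists. -/
theorem exists_isReproducing (hn : 0 < n) {z : EuclideanSpace ℂ (Fin n)} (hz : z ∈ D.X) :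
    ∃ k, D.IsReproducing z k := by
  have hcomplete := (D.isClosed_hardySpace hn).completeSpace_coe
  obtain ⟨C, hC, hCb⟩ := D.exists_enorm_sq_le hn hz
  have hex : ∀ u : D.hardySpace, ∃ F, D.IsHardyExtension u.1 F := fun u => u.2
  choose f hf using hex
  -- Extensions are chosen arbitrarily; uniqueness on `X` makes the evaluation linear. The Riesz
  -- representation of this bounded functional is the kernel.
  let L : D.hardySpace →ₗ[ℂ] ℂ :=
    { toFun := fun u => f u z
      map_add' := fun u v => (hf (u + v)).eqOn hn ((hf u).add (hf v)) hz
      map_smul' := fun c u => (hf (c • u)).eqOn hn ((hf u).const_smul c) hz }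
  let Lc : D.hardySpace →L[ℂ] ℂ := L.mkContinuous (C ^ (1 / 2 : ℝ)).toReal fun u => by
    have h1 := hCb _ (hf u).1.1 z fun _ => le_rfl
    rw [(hf u).hardyNormSq_eq hn] at h1
    have h2 : ‖f u z‖ₑ ≤ C ^ (1 / 2 : ℝ) * ‖u.1‖ₑ := by
      refine (ENNReal.pow_right_strictMono two_ne_zero).le_iff_le.mp (h1.trans (le_of_eq ?_))
      rw [mul_pow, ← ENNReal.rpow_natCast (C ^ (1 / 2 : ℝ)), ← ENNReal.rpow_mul]
      norm_num
    have h3 := ENNReal.toReal_mono (ENNReal.mul_ne_top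
      (ENNReal.rpow_ne_top_of_nonneg (by norm_num) hC) enorm_ne_top) h2
    rwa [ENNReal.toReal_mul, toReal_enorm, toReal_enorm] at h3
  set k := (InnerProductSpace.toDual ℂ D.hardySpace).symm Lc with hk
  refine ⟨k.1, k.2, fun u F hu => ?_⟩
  have hmem : u ∈ D.hardySpace := ⟨F, hu⟩
  have h1 : inner ℂ k ⟨u, hmem⟩ = Lc ⟨u, hmem⟩ := InnerProductSpace.toDual_symm_apply
  have h2 : Lc ⟨u, hmem⟩ = f ⟨u, hmem⟩ z := rfl
  rw [h2, (hf ⟨u, hmem⟩).eqOn hn hu hz] at h1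
  exact h1.symm

theorem isReproducing_reproducing (hn : 0 < n) {z : EuclideanSpace ℂ (Fin n)} (hz : z ∈ D.X) :
    D.IsReproducing z (D.reproducing z) := by
  have h := D.exists_isReproducing hn hz
  rw [reproducing, dif_pos h]
  exact h.choose_spec

end ModelDomain

end

/-! ### Boundary uniqueness on the model domain. -/

noncomputable section

/-- If a set has positive measure, so has the set of points whose circle orbits meet it in positive
measure. -/
theorem measure_ne_zero_of_slices {E : Type*} [MeasurableSpace E] {μ : Measure E} [SFinite μ]
    {R : ℝ → E → E} (hR : Measurable (Function.uncurry R)) (hμ : ∀ θ, MeasurePreserving (R θ) μ μ)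
    {Z Z' : Set E} (hZm : MeasurableSet Z) (hZ : μ Z ≠ 0)
    (h : ∀ᵐ ζ ∂μ, arcMeasure {θ | R θ ζ ∈ Z} ≠ 0 → ζ ∈ Z') : μ Z' ≠ 0 := by
  intro h0
  have h1 := lintegral_lintegral_arcMeasure hR hμ (h := Z.indicator 1)
    (measurable_one.indicator hZm)
  rw [lintegral_indicator_one hZm] at h1
  have h2 : ∀ᵐ ζ ∂μ, ∫⁻ θ, Z.indicator 1 (R θ ζ) ∂arcMeasure = 0 := by
    have h3 : ∀ᵐ ζ ∂μ, ζ ∉ Z' := by rw [ae_iff]; simpa using h0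
    filter_upwards [h, h3] with ζ h4 h5
    have h6 : arcMeasure {θ | R θ ζ ∈ Z} = 0 := by
      by_contra hcon
      exact h5 (h4 hcon)
    refine lintegral_eq_zero_of_ae_eq_zero ?_
    have h7 : ∀ᵐ θ ∂arcMeasure, R θ ζ ∉ Z := by rw [ae_iff]; simpa using h6
    filter_upwards [h7] with θ hθ
    simp [hθ]
  rw [lintegral_eq_zero_of_ae_eq_zero h2] at h1
  have hpos : ENNReal.ofReal (2 * Real.pi) ≠ 0 := by simp [Real.pi_pos]
  exact (mul_eq_zero.mp h1.symm).elim hpos hZ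

/-- Coordinatewise multiplication. -/
def coordMul {n : ℕ} (l : Fin n → ℂ) (ζ : EuclideanSpace ℂ (Fin n)) : EuclideanSpace ℂ (Fin n) :=
  WithLp.toLp 2 fun j => l j * ζ j

theorem coordMul_apply {n : ℕ} (l : Fin n → ℂ) (ζ : EuclideanSpace ℂ (Fin n)) (j : Fin n) :
    coordMul l ζ j = l j * ζ j := rfl

theorem continuous_coordMul {n : ℕ} (l : Fin n → ℂ) : Continuous (coordMul l) :=
  (PiLp.continuous_toLp 2 _).comp (continuous_pi fun j => by fun_prop)

theorem norm_coordMul_le {n : ℕ} {l : Fin n → ℂ} (hl : ∀ j, ‖l j‖ ≤ 1)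
    (ζ : EuclideanSpace ℂ (Fin n)) (j : Fin n) : ‖coordMul l ζ j‖ ≤ ‖ζ j‖ := by
  rw [coordMul_apply, norm_mul]
  exact mul_le_of_le_one_left (norm_nonneg _) (hl j)

namespace ModelDomain

open Metric

variable {n : ℕ} (D : ModelDomain n)

theorem half_coordMul_mem {l : Fin n → ℂ} (hl : ∀ j, ‖l j‖ ≤ 1) {ζ : EuclideanSpace ℂ (Fin n)}
    (hζ : ζ ∈ D.Γ) : (1 / 2 : ℝ) • coordMul l ζ ∈ D.X :=
  D.smul_mem_of_le (by norm_num) hζ (norm_coordMul_le hl ζ)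

/-- The points of `Γ` over whose half-size polydisc, in the directions of `s`, the function `H`
vanishes. -/
def vanishingSet (H : EuclideanSpace ℂ (Fin n) → ℂ) (s : Finset (Fin n)) :
    Set (EuclideanSpace ℂ (Fin n)) :=
  {ζ | ζ ∈ D.Γ ∧ ∀ l : Fin n → ℂ, (∀ j, ‖l j‖ ≤ 1) → (∀ j ∉ s, l j = 1) →
    H ((1 / 2 : ℝ) • coordMul l ζ) = 0}

theorem isClosed_vanishingSet {H : EuclideanSpace ℂ (Fin n) → ℂ} (hH : ContinuousOn H D.X)
    (s : Finset (Fin n)) : IsClosed (D.vanishingSet H s) := by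
  have h1 : D.vanishingSet H s = D.Γ ∩ ⋂ (l : Fin n → ℂ) (_ : ∀ j, ‖l j‖ ≤ 1)
      (_ : ∀ j ∉ s, l j = 1), D.Γ ∩ (fun ζ => H ((1 / 2 : ℝ) • coordMul l ζ)) ⁻¹' {0} := by
    ext ζ
    simp only [vanishingSet, mem_ofPred_eq, mem_inter_iff, mem_iInter, mem_preimage,
      mem_singleton_iff]
    exact and_congr_right fun hζ => ⟨fun h l h1 h2 => ⟨hζ, h l h1 h2⟩, fun h l h1 h2 =>
      (h l h1 h2).2⟩
  rw [h1]
  refine D.isClosed_Γ.inter (isClosed_iInter fun l => isClosed_iInter fun hl =>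
    isClosed_iInter fun _ => ?_)
  refine ContinuousOn.preimage_isClosed_of_isClosed ?_ D.isClosed_Γ isClosed_singleton
  have h2 : Continuous fun ζ => (1 / 2 : ℝ) • coordMul l ζ :=
    (continuous_coordMul l).const_smul (1 / 2 : ℝ)
  exact hH.comp h2.continuousOn fun ζ hζ => D.half_coordMul_mem hl hζ

/-- If rotations of coordinate `k` by a set of angles of positive measure lead into the vanishing
set, uniqueness in the disc forces `H` to vanish on the whole disc in that coordinate. The factor `1
/ 2` keeps the closed disc inside `X`. -/
theorem vanishingSet_insert_ne_zero (hn : 0 < n) {H : EuclideanSpace ℂ (Fin n) → ℂ}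
    (hH : DifferentiableOn ℂ H D.X) {s : Finset (Fin n)} {k : Fin n} (hk : k ∉ s)
    (hs : D.σ (D.vanishingSet H s) ≠ 0) : D.σ (D.vanishingSet H (insert k s)) ≠ 0 := by
  have hfin := D.isFiniteMeasure_σ hn
  set R : ℝ → EuclideanSpace ℂ (Fin n) → EuclideanSpace ℂ (Fin n) :=
    fun θ ζ => diagRotation (Pi.single k θ) ζ with hR
  have hRm : Measurable (Function.uncurry R) :=
    (continuous_diagRotation.comp (((continuous_single (A := fun _ : Fin n => ℝ) k).comp
      continuous_fst).prodMk continuous_snd)).measurable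
  refine measure_ne_zero_of_slices hRm (fun θ => D.measurePreserving_diagRotation _)
    (D.isClosed_vanishingSet hH.continuousOn s).measurableSet hs ?_
  filter_upwards [D.ae_mem_Γ] with ζ hζ hpos
  refine ⟨hζ, fun l hl1 hl2 => ?_⟩
  set p : ℂ → EuclideanSpace ℂ (Fin n) := fun x => coordMul (Function.update l k x) ζ with hp
  have hpd : Differentiable ℂ fun x => (1 / 2 : ℝ) • p x := by
    rw [differentiable_euclidean]
    intro j
    by_cases hj : j = k
    · subst hj
      have : (fun x => ((1 / 2 : ℝ) • p x) j) = fun x => (1 / 2 : ℝ) • (x * ζ j) := by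
        ext x; simp [hp, coordMul_apply]
      rw [this]
      exact (differentiable_id.mul_const _).const_smul (1 / 2 : ℝ)
    · have : (fun x => ((1 / 2 : ℝ) • p x) j) = fun x => (1 / 2 : ℝ) • (l j * ζ j) := by
        ext x; simp [hp, coordMul_apply, hj]
      rw [this]
      exact differentiable_const _
  have hpX : ∀ x ∈ closedBall (0 : ℂ) 1, (1 / 2 : ℝ) • p x ∈ D.X := fun x hx => by
    refine D.half_coordMul_mem (fun j => ?_) hζ
    by_cases hj : j = k
    · subst hj; simpa using hx
    · simpa [hj] using hl1 j
  have hd : DifferentiableOn ℂ (fun x => H ((1 / 2 : ℝ) • p x)) (closedBall 0 1) :=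
    hH.comp hpd.differentiableOn hpX
  have hzero := eqOn_zero_of_arcMeasure_pos hd.continuousOn (hd.mono ball_subset_closedBall) (by
    refine fun h0 => hpos (measure_mono_null (fun θ hθ => ?_) h0)
    have h1 := hθ.2 (Function.update l k 1)
      (fun j => by
        by_cases hj : j = k
        · subst hj; simp
        · simpa [hj] using hl1 j)
      (fun j hj => by
        by_cases hjk : j = k
        · subst hjk; simp
        · simpa [hjk] using hl2 j (by simp [hjk, hj]))
    have h2 : coordMul (Function.update l k 1) (R θ ζ) = p (circleMap 0 1 θ) := by
      ext j
      simp only [hp, hR, coordMul_apply, diagRotation_apply]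
      by_cases hj : j = k
      · subst hj; simp [circleMap]
      · simp [hj]
    rw [h2] at h1
    exact h1)
  have h3 := hzero (show l k ∈ closedBall (0 : ℂ) 1 by simpa using hl1 k)
  simpa [hp] using h3

/-- The boundary uniqueness theorem: a holomorphic function that is continuous up to the boundary
and vanishes on a part of `Γ` of positive measure is zero. -/
theorem eqOn_zero_of_σ_pos (hn : 0 < n) {H : EuclideanSpace ℂ (Fin n) → ℂ}
    (hHc : ContinuousOn H (closure D.X)) (hH : DifferentiableOn ℂ H D.X)
    (hpos : D.σ (D.Γ ∩ H ⁻¹' {0}) ≠ 0) : EqOn H 0 D.X := by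
  have hfin := D.isFiniteMeasure_σ hn
  have hclos : ∀ ζ ∈ D.Γ, ∀ l : ℂ, ‖l‖ ≤ 1 → l • ζ ∈ closure D.X := by
    intro ζ hζ l hl
    have h1 : Tendsto (fun r : ℝ => r • (l • ζ)) (𝓝[<] 1) (𝓝 (l • ζ)) := by
      have : Tendsto (fun r : ℝ => r • (l • ζ)) (𝓝 1) (𝓝 ((1 : ℝ) • (l • ζ))) :=
        (by fun_prop : Continuous fun r : ℝ => r • (l • ζ)).tendsto 1
      rw [one_smul] at this
      exact this.mono_left nhdsWithin_le_nhds
    refine mem_closure_of_tendsto h1 ?_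
    filter_upwards [eventually_mem_Ioo_one one_pos] with r hr
    refine D.smul_mem_of_le hr hζ fun j => ?_
    rw [PiLp.smul_apply, norm_smul]
    exact mul_le_of_le_one_left (norm_nonneg _) hl
  -- Uniqueness on the discs `l • ζ` carries the zeros from the boundary to the interior points `(1
  -- / 2) • ζ`, over a set of positive measure.
  have hempty : D.σ (D.vanishingSet H ∅) ≠ 0 := by
    refine measure_ne_zero_of_slices measurable_phaseRotation D.measurePreserving_phaseRotation
      ((hHc.mono D.Γ_subset_closure).preimage_isClosed_of_isClosed D.isClosed_Γ
        isClosed_singleton).measurableSet hpos ?_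
    filter_upwards [D.ae_mem_Γ] with ζ hζ hpos'
    refine ⟨hζ, fun l _ hl => ?_⟩
    have hzero := eqOn_zero_of_arcMeasure_pos (h := fun l : ℂ => H (l • ζ))
      (hHc.comp (by fun_prop) fun l hl => hclos ζ hζ l (by simpa using hl))
      (D.differentiableOn_slice hH hζ) (by
        refine fun h0 => hpos' (measure_mono_null (fun θ hθ => ?_) h0)
        have h1 : H (phaseRotation θ ζ) = 0 := hθ.2
        change H (circleMap 0 1 θ • ζ) = 0
        rwa [circleMap_smul, one_smul])
    have h2 := hzero (show (1 / 2 : ℂ) ∈ closedBall (0 : ℂ) 1 by simp; norm_num)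
    have h3 : (1 / 2 : ℝ) • coordMul l ζ = (1 / 2 : ℂ) • ζ := by
      ext j
      simp [coordMul_apply, hl j (by simp)]
    rw [h3]
    exact h2
  have huniv : D.σ (D.vanishingSet H Finset.univ) ≠ 0 := by
    have : ∀ s : Finset (Fin n), D.σ (D.vanishingSet H s) ≠ 0 := fun s => by
      induction s using Finset.induction_on with
      | empty => exact hempty
      | insert k s hk ih => exact D.vanishingSet_insert_ne_zero hn hH hk ih
    exact this _
  -- With no zero coordinate, the polydisc with radii `‖ζ j‖ / 2`, on which `H` vanishes, is a
  -- neighbourhood of the origin.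
  obtain ⟨ζ, hζ, hζ0⟩ : ∃ ζ ∈ D.vanishingSet H Finset.univ, ∀ j, ζ j ≠ 0 := by
    by_contra hcon
    push Not at hcon
    refine huniv ?_
    have h1 : ∀ᵐ ζ ∂D.σ, ∀ j, ζ j ≠ 0 := by
      rw [ae_all_iff]; exact fun j => D.ae_coord_ne_zero hn j
    refine measure_mono_null (fun ζ hζ => ?_) (ae_iff.mp h1)
    simpa using hcon ζ hζ
  have hnear : ∀ᶠ z in 𝓝 (0 : EuclideanSpace ℂ (Fin n)), H z = 0 := by
    have h1 : ∀ᶠ z in 𝓝 (0 : EuclideanSpace ℂ (Fin n)), ∀ j, ‖z j‖ < ‖ζ j‖ / 2 := by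
      rw [eventually_all]
      intro j
      refine (by fun_prop : Continuous fun z : EuclideanSpace ℂ (Fin n) => ‖z j‖).tendsto 0
        (gt_mem_nhds ?_)
      have := norm_pos_iff.mpr (hζ0 j)
      simp only [PiLp.zero_apply, norm_zero]
      positivity
    filter_upwards [h1] with z hz
    have h2 := hζ.2 (fun j => 2 * z j / ζ j) (fun j => by
      have := norm_pos_iff.mpr (hζ0 j)
      rw [norm_div, norm_mul, div_le_one this, Complex.norm_ofNat]
      linarith [hz j]) (fun j hj => absurd (Finset.mem_univ j) hj)
    have h3 : (1 / 2 : ℝ) • coordMul (fun j => 2 * z j / ζ j) ζ = z := by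
      ext j
      have := hζ0 j
      rw [PiLp.smul_apply, coordMul_apply, div_mul_cancel₀ _ this, Complex.real_smul]
      push_cast
      ring
    rwa [h3] at h2
  -- The identity theorem on the disc `l • z` propagates the vanishing from the origin to `l = 1`.
  intro z hz
  have hzl : ∀ l ∈ closedBall (0 : ℂ) 1, l • z ∈ D.X := fun l hl =>
    D.isCompleteReinhardt_X z hz _ fun j => by
      rw [PiLp.smul_apply, norm_smul]
      exact mul_le_of_le_one_left (norm_nonneg _) (by simpa using hl)
  have hd : DifferentiableOn ℂ (fun l : ℂ => H (l • z)) (closedBall 0 1) :=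
    hH.comp (by fun_prop) hzl
  have hd' := (hd.mono ball_subset_closedBall).analyticOnNhd isOpen_ball
  have h0 : (fun l : ℂ => H (l • z)) =ᶠ[𝓝 0] 0 := by
    have : Tendsto (fun l : ℂ => l • z) (𝓝 0) (𝓝 ((0 : ℂ) • z)) :=
      (by fun_prop : Continuous fun l : ℂ => l • z).tendsto 0
    rw [zero_smul] at this
    exact this.eventually hnear
  have hball := hd'.eqOn_zero_of_preconnected_of_eventuallyEq_zero
    (convex_ball (0 : ℂ) 1).isPreconnected (mem_ball_self one_pos) h0
  have hcl : EqOn (fun l : ℂ => H (l • z)) 0 (closedBall 0 1) :=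
    hball.of_subset_closure hd.continuousOn continuousOn_const ball_subset_closedBall
      (by rw [closure_ball _ one_ne_zero])
  have := hcl (show (1 : ℂ) ∈ closedBall (0 : ℂ) 1 by simp)
  simpa using this

end ModelDomain

end

/-! ### The derivative of the quotient map at the boundary and positivity of the density. -/

noncomputable section

section BoundaryDerivative

open Metric

variable {n : ℕ}

/-- The complex derivative extends to the boundary. -/
theorem exists_tendsto_fderiv_boundary {X : Set (EuclideanSpace ℂ (Fin n))} (hX : IsOpen X)
    {Φ : EuclideanSpace ℂ (Fin n) → EuclideanSpace ℂ (Fin n)} (hΦ : DifferentiableOn ℂ Φ X)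
    {x : EuclideanSpace ℂ (Fin n)} (hx : x ∈ closure X)
    (hs : ContDiffWithinAt ℝ 1 Φ (closure X) x) :
    ∃ M : EuclideanSpace ℂ (Fin n) →L[ℂ] EuclideanSpace ℂ (Fin n),
      Tendsto (fderiv ℂ Φ) (𝓝[X] x) (𝓝 M) ∧
      HasFDerivWithinAt Φ (M.restrictScalars ℝ) (closure X) x := by
  have h1 : ContDiffWithinAt ℝ (0 + 1) Φ (closure X) x := by rwa [zero_add]
  obtain ⟨u, hu, -, -, f', hf', hc⟩ := (contDiffWithinAt_succ_iff_hasFDerivWithinAt'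
    (by simp)).mp h1
  rw [insert_eq_of_mem hx] at hu
  have hxu : x ∈ u := mem_of_mem_nhdsWithin hx hu
  have hle : 𝓝[X] x ≤ 𝓝[closure X] x := nhdsWithin_mono _ subset_closure
  have hne : (𝓝[X] x).NeBot := mem_closure_iff_nhdsWithin_neBot.mp hx
  set r := ContinuousLinearMap.restrictScalarsIsometry ℂ (EuclideanSpace ℂ (Fin n))
    (EuclideanSpace ℂ (Fin n)) ℝ ℝ with hr
  have h2 : Tendsto (fun y => r (fderiv ℂ Φ y)) (𝓝[X] x) (𝓝 (f' x)) := by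
    refine (hc.continuousWithinAt.tendsto.mono_left hle).congr' ?_
    filter_upwards [hle hu, self_mem_nhdsWithin] with y hy hyX
    have h3 := (hf' y hy).hasFDerivAt (mem_of_superset (hX.mem_nhds hyX) subset_closure)
    have h4 := ((hΦ.differentiableAt (hX.mem_nhds hyX)).hasFDerivAt).restrictScalars ℝ
    exact h3.unique h4
  -- The real derivatives inside converge to the one at the boundary. The complex linear maps form a
  -- closed subspace, so the limit is complex linear.
  have hclosed : IsClosed (range r) := r.isometry.isClosedEmbedding.isClosed_range
  obtain ⟨M, hM⟩ := hclosed.mem_of_tendsto h2 (Eventually.of_forall fun y => mem_range_self _)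
  refine ⟨M, ?_, ?_⟩
  · rw [← hM] at h2
    exact (r.isometry.isEmbedding.isInducing.tendsto_nhds_iff).mpr h2
  · have h5 := hf' x hxu
    rw [← hM] at h5
    exact h5

/-- A map with invertible derivative within a set is antilipschitz at the base point. -/
theorem exists_antilipschitz_at {S : Set (EuclideanSpace ℂ (Fin n))}
    {Φ : EuclideanSpace ℂ (Fin n) → EuclideanSpace ℂ (Fin n)} {x : EuclideanSpace ℂ (Fin n)}
    {M : EuclideanSpace ℂ (Fin n) →L[ℂ] EuclideanSpace ℂ (Fin n)} (hM : M.det ≠ 0)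
    (h : HasFDerivWithinAt Φ (M.restrictScalars ℝ) S x) :
    ∃ k : ℕ, ∀ y ∈ S, dist x y < 1 / (k + 1) → dist x y ≤ (k + 1) * dist (Φ x) (Φ y) := by
  set e := M.toContinuousLinearEquivOfDetNeZero hM with he
  set N := ‖(e.symm : EuclideanSpace ℂ (Fin n) →L[ℂ] EuclideanSpace ℂ (Fin n))‖ + 1 with hN
  have hN0 : 0 < N := by positivity
  have hlow : ∀ v, ‖v‖ ≤ N * ‖M v‖ := fun v => by
    have h1 : e.symm (M v) = v := e.symm_apply_apply v
    calc ‖v‖ = ‖e.symm (M v)‖ := by rw [h1]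
      _ ≤ ‖(e.symm : EuclideanSpace ℂ (Fin n) →L[ℂ] EuclideanSpace ℂ (Fin n))‖ * ‖M v‖ :=
        (e.symm : EuclideanSpace ℂ (Fin n) →L[ℂ] EuclideanSpace ℂ (Fin n)).le_opNorm (M v)
      _ ≤ N * ‖M v‖ := by gcongr; linarith
  have h2 := h.isLittleO.def (by positivity : 0 < 1 / (2 * N))
  rw [eventually_nhdsWithin_iff] at h2
  obtain ⟨δ, hδ, hb⟩ := Metric.eventually_nhds_iff.mp h2
  obtain ⟨k1, hk1⟩ := exists_nat_one_div_lt hδ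
  obtain ⟨k2, hk2⟩ := exists_nat_ge (2 * N)
  -- One natural number controls both the radius and the constant, so that a countable decomposition
  -- by `k` becomes possible.
  refine ⟨max k1 k2, fun y hy hxy => ?_⟩
  have hk1' : (1 : ℝ) / ((max k1 k2 : ℕ) + 1) ≤ 1 / (k1 + 1) := by
    gcongr; exact le_max_left _ _
  have hk2' : 2 * N ≤ (max k1 k2 : ℕ) + 1 :=
    hk2.trans ((Nat.cast_le.mpr (le_max_right k1 k2)).trans (by linarith))
  have h3 := hb (y := y) (by rw [dist_comm]; linarith) hy
  have h4 := hlow (y - x)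
  have h5 : ‖M (y - x)‖ ≤ ‖Φ y - Φ x‖ + 1 / (2 * N) * ‖y - x‖ := by
    have h6 : M (y - x) = (Φ y - Φ x) - (Φ y - Φ x - M (y - x)) := by abel
    calc ‖M (y - x)‖ = ‖(Φ y - Φ x) - (Φ y - Φ x - M (y - x))‖ := by rw [← h6]
      _ ≤ ‖Φ y - Φ x‖ + ‖Φ y - Φ x - M (y - x)‖ := norm_sub_le _ _
      _ ≤ _ := by gcongr; exact h3
  have h7 : N * ‖M (y - x)‖ ≤ N * ‖Φ y - Φ x‖ + 1 / 2 * ‖y - x‖ := by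
    calc N * ‖M (y - x)‖ ≤ N * (‖Φ y - Φ x‖ + 1 / (2 * N) * ‖y - x‖) := by gcongr
      _ = _ := by field_simp
  rw [dist_comm x y, dist_comm (Φ x), dist_eq_norm, dist_eq_norm]
  calc ‖y - x‖ ≤ 2 * N * ‖Φ y - Φ x‖ := by linarith
    _ ≤ _ := by gcongr

/-- A set whose image under a pointwise antilipschitz map is a null set is a null set. -/
theorem euclideanHausdorffMeasure_eq_zero_of_antilipschitz_at {d : ℕ}
    {S : Set (EuclideanSpace ℂ (Fin n))}
    {Φ : EuclideanSpace ℂ (Fin n) → EuclideanSpace ℂ (Fin n)}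
    (hΦ : ∀ x ∈ S, ∃ k : ℕ, ∀ y ∈ S, dist x y < 1 / (k + 1) →
      dist x y ≤ (k + 1) * dist (Φ x) (Φ y))
    (h0 : Measure.euclideanHausdorffMeasure d (Φ '' S) = 0) :
    Measure.euclideanHausdorffMeasure d S = 0 := by
  -- The set splits into countably many pieces: on `P k` the constant is fixed, and intersection
  -- with a ball of radius `1 / (2 * (k + 1))` makes any two points close enough for the estimate to
  -- apply.
  set P : ℕ → Set (EuclideanSpace ℂ (Fin n)) := fun k =>
    {x | x ∈ S ∧ ∀ y ∈ S, dist x y < 1 / (k + 1) → dist x y ≤ (k + 1) * dist (Φ x) (Φ y)} with hP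
  have hcover : S ⊆ ⋃ (k : ℕ) (i : ℕ),
      P k ∩ ball (TopologicalSpace.denseSeq (EuclideanSpace ℂ (Fin n)) i) (1 / (2 * (k + 1))) := by
    intro x hx
    obtain ⟨k, hk⟩ := hΦ x hx
    have hpos : (0 : ℝ) < 1 / (2 * (k + 1)) := by positivity
    obtain ⟨i, hi⟩ := (TopologicalSpace.denseRange_denseSeq
      (EuclideanSpace ℂ (Fin n))).exists_dist_lt x hpos
    exact mem_iUnion₂.mpr ⟨k, i, ⟨hx, hk⟩, hi⟩
  refine measure_mono_null hcover (measure_iUnion_null fun k => measure_iUnion_null fun i => ?_)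
  set A := P k ∩ ball (TopologicalSpace.denseSeq (EuclideanSpace ℂ (Fin n)) i)
    (1 / (2 * (k + 1))) with hA
  have hK : 0 ≤ (k : ℝ) + 1 := by positivity
  have h1 := euclideanHausdorffMeasure_le_of_antilipschitz (f := Φ) (s := A)
    (K := ⟨(k : ℝ) + 1, hK⟩) (fun x hx y hy => hx.1.2 y hy.1.1 (by
      calc dist x y ≤ dist x (TopologicalSpace.denseSeq (EuclideanSpace ℂ (Fin n)) i) +
            dist y (TopologicalSpace.denseSeq (EuclideanSpace ℂ (Fin n)) i) :=
          dist_triangle_right _ _ _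
        _ < 1 / (2 * (k + 1)) + 1 / (2 * (k + 1)) := add_lt_add hx.2 hy.2
        _ = 1 / (k + 1) := by field_simp; norm_num)) d
  have h2 : Measure.euclideanHausdorffMeasure d (Φ '' A) = 0 :=
    measure_mono_null (image_mono fun x hx => hx.1.1) h0
  rw [h2, mul_zero] at h1
  exact nonpos_iff_eq_zero.mp h1

end BoundaryDerivative

namespace QuotientQuadruple

variable {n : ℕ} (Q : QuotientQuadruple n)

theorem continuousOn_Φ : ContinuousOn Q.Φ (closure Q.X) := Q.smooth.continuousOn

theorem continuousOn_Φ_Γ : ContinuousOn Q.Φ Q.Γ := Q.continuousOn_Φ.mono Q.Γ_subset_closure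

theorem isCompact_ΓΩ : IsCompact Q.ΓΩ := Q.isCompact_Γ.image_of_continuousOn Q.continuousOn_Φ_Γ

/-- The restriction of `Φ` to the boundaries. -/
def boundaryMap : Q.Γ → Q.ΓΩ := fun ζ => ⟨Q.Φ ζ, mem_image_of_mem _ ζ.2⟩

theorem measurable_boundaryMap : Measurable Q.boundaryMap :=
  (Continuous.subtype_mk Q.continuousOn_Φ_Γ.domRestrict _).measurable

theorem surjective_boundaryMap : Function.Surjective Q.boundaryMap := by
  rintro ⟨_, ζ, hζ, rfl⟩
  exact ⟨⟨ζ, hζ⟩, rfl⟩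

/-- Images of saturated Borel sets are Borel sets. -/
theorem measurableSet_image_of_saturated {A : Set (EuclideanSpace ℂ (Fin n))}
    (hA : MeasurableSet A) (hAΓ : A ⊆ Q.Γ) (hsat : ∀ ζ ∈ Q.Γ, ∀ ξ ∈ A, Q.Φ ζ = Q.Φ ξ → ζ ∈ A) :
    MeasurableSet (Q.Φ '' A) := by
  have hpol : PolishSpace Q.Γ := Q.isClosed_Γ.polishSpace
  have h1 : MeasurableSet (Q.boundaryMap ⁻¹' (Subtype.val ⁻¹' (Q.Φ '' A))) := by
    have : Q.boundaryMap ⁻¹' (Subtype.val ⁻¹' (Q.Φ '' A)) = Subtype.val ⁻¹' A := by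
      ext ζ
      simp only [mem_preimage, boundaryMap]
      exact ⟨fun ⟨ξ, hξ, h⟩ => hsat ζ ζ.2 ξ hξ h.symm, fun h => mem_image_of_mem _ h⟩
    rw [this]
    exact measurable_subtype_coe hA
  -- Descriptive set theory enters here: under a measurable surjection from a Polish space, a set
  -- with Borel preimage is Borel.
  rw [Q.measurable_boundaryMap.measurableSet_preimage_iff_of_surjective
    Q.surjective_boundaryMap] at h1
  have h2 := (MeasurableEmbedding.subtype_coe Q.isCompact_ΓΩ.isClosed.measurableSet).measurableSet_image.mpr h1
  rwa [Subtype.image_preimage_coe,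
      inter_eq_right.mpr (show Q.Φ '' A ⊆ Q.ΓΩ from image_mono hAΓ)] at h2

theorem mem_Γ_iff {τ : EuclideanSpace ℂ (Fin n) ≃ₗᵢ[ℂ] EuclideanSpace ℂ (Fin n)} (hτ : τ ∈ Q.G)
    {z : EuclideanSpace ℂ (Fin n)} : τ z ∈ Q.Γ ↔ z ∈ Q.Γ := by
  refine ⟨fun h => ?_, fun h => Q.maps_Γ τ hτ h⟩
  have h1 := Q.maps_Γ τ⁻¹ (Q.G.inv_mem hτ) h
  have h2 : τ⁻¹ (τ z) = z := τ.symm_apply_apply z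
  rwa [h2] at h1

theorem measurePreserving_of_mem
    {τ : EuclideanSpace ℂ (Fin n) ≃ₗᵢ[ℂ] EuclideanSpace ℂ (Fin n)} (hτ : τ ∈ Q.G) :
    MeasurePreserving τ Q.σ Q.σ :=
  Q.measurePreserving_of_isometry τ.toIsometryEquiv Q.isClosed_Γ.measurableSet
    fun _ => Q.mem_Γ_iff hτ

/-- Every null property fails only on a `G`-invariant Borel null set that contains all points over
which the fiber of `Φ` is not an orbit. -/
theorem exists_invariant_null_set {p : EuclideanSpace ℂ (Fin n) → Prop} (hp : ∀ᵐ ζ ∂Q.σ, p ζ) :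
    ∃ N, MeasurableSet N ∧ Q.σ N = 0 ∧ (∀ τ ∈ Q.G, ∀ ζ, τ ζ ∈ N ↔ ζ ∈ N) ∧
      ∀ ζ ∉ N, p ζ ∧ ∀ ζ' ∈ Q.Γ, Q.Φ ζ' = Q.Φ ζ → ∃ τ ∈ Q.G, τ ζ = ζ' := by
  have hfin := Q.finite_G
  obtain ⟨N, hN, hNm, hN0⟩ := exists_measurable_superset_of_null (ae_iff.mp (hp.and Q.fiber_boundary))
  -- The finite union of the translates is invariant, and null because the group preserves `σ`.
  refine ⟨⋃ τ : Q.G, τ.1 ⁻¹' N, MeasurableSet.iUnion fun τ => τ.1.continuous.measurable hNm,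
    measure_iUnion_null fun τ => ?_, fun τ hτ ζ => ?_, fun ζ hζ => ?_⟩
  · rw [(Q.measurePreserving_of_mem τ.2).measure_preimage hNm.nullMeasurableSet, hN0]
  · simp only [mem_iUnion, mem_preimage]
    constructor
    · rintro ⟨υ, h⟩
      refine ⟨υ * (⟨τ, hτ⟩ : Q.G), ?_⟩
      exact h
    · rintro ⟨υ, h⟩
      refine ⟨υ * (⟨τ, hτ⟩ : Q.G)⁻¹, ?_⟩
      have : (υ * (⟨τ, hτ⟩ : Q.G)⁻¹).1 (τ ζ) = υ.1 ζ := by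
        change υ.1 (τ.symm (τ ζ)) = _
        rw [τ.symm_apply_apply]
      rwa [this]
  · by_contra hcon
    refine hζ (mem_iUnion.mpr ⟨1, hN hcon⟩)

variable {Q} {w : EuclideanSpace ℂ (Fin n) → ℝ}

/-- Preimages of invariant sets: the measure of the image. -/
theorem IsPullbackDensity.measure_image_eq (hw : Q.IsPullbackDensity w)
    {A : Set (EuclideanSpace ℂ (Fin n))}
    (hA : MeasurableSet A) (hAΓ : A ⊆ Q.Γ) (hsat : ∀ ζ ∈ Q.Γ, ∀ ξ ∈ A, Q.Φ ζ = Q.Φ ξ → ζ ∈ A) :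
    Measure.euclideanHausdorffMeasure Q.dim (Q.Φ '' A) =
      (Nat.card Q.G : ℝ≥0∞)⁻¹ * ∫⁻ ζ in A, ENNReal.ofReal (w ζ) ∂Q.σ := by
  rw [← hw.change (Q.Φ '' A) (image_mono hAΓ) (Q.measurableSet_image_of_saturated hA hAΓ hsat)]
  have h1 : Q.Γ ∩ Q.Φ ⁻¹' (Q.Φ '' A) = A := by
    ext ζ
    exact ⟨fun ⟨h1, ξ, hξ, h2⟩ => hsat ζ h1 ξ hξ h2.symm, fun h => ⟨hAΓ h, mem_image_of_mem _ h⟩⟩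
  rw [h1, ModelDomain.σ, Measure.restrict_restrict hA, inter_eq_left.mpr hAΓ]

/-- The Jacobian of `Φ` does not vanish almost everywhere on `Γ`. -/
theorem ae_extendFrom_jacobian_ne_zero (hn : 0 < n) (Q : QuotientQuadruple n) :
    ∀ᵐ ζ ∂Q.σ, extendFrom Q.X (jacobian Q.Φ) ζ ≠ 0 := by
  have hlim : ∀ x ∈ closure Q.X, ∃ y, Tendsto (jacobian Q.Φ) (𝓝[Q.X] x) (𝓝 y) := fun x hx => by
    obtain ⟨M, hM, -⟩ := exists_tendsto_fderiv_boundary Q.isOpen_X Q.holomorphic hx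
      ((Q.smooth x hx).of_le (by exact_mod_cast le_top))
    exact ⟨M.det, (ContinuousLinearMap.continuous_det.tendsto M).comp hM⟩
  have hcont : ContinuousOn (extendFrom Q.X (jacobian Q.Φ)) (closure Q.X) :=
    continuousOn_extendFrom subset_rfl hlim
  have heq : EqOn (extendFrom Q.X (jacobian Q.Φ)) (jacobian Q.Φ) Q.X := fun x hx =>
    extendFrom_eq (subset_closure hx)
      ((Q.holomorphic.jacobian Q.isOpen_X).continuousOn x hx)
  have hdiff : DifferentiableOn ℂ (extendFrom Q.X (jacobian Q.Φ)) Q.X :=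
    (Q.holomorphic.jacobian Q.isOpen_X).congr heq
  by_contra hcon
  have hpos : Q.σ (Q.Γ ∩ extendFrom Q.X (jacobian Q.Φ) ⁻¹' {0}) ≠ 0 := fun h0 => by
    refine hcon ?_
    have h1 : ∀ᵐ ζ ∂Q.σ, ζ ∉ Q.Γ ∩ extendFrom Q.X (jacobian Q.Φ) ⁻¹' {0} := by
      rw [ae_iff]
      simp only [not_not]
      exact h0
    filter_upwards [h1, Q.ae_mem_Γ] with ζ h2 h3 h4
    exact h2 ⟨h3, h4⟩
  -- Zeros on a part of the boundary of positive measure would make the Jacobian vanish on `X`,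
  -- although the image of `X` is open and nonempty.
  have hzero := Q.eqOn_zero_of_σ_pos hn hcont hdiff hpos
  obtain ⟨z, hz, hz'⟩ := exists_jacobian_ne_zero Q.isOpen_X Q.holomorphic Q.isOpen_Ω
    Q.isConnected_Ω.nonempty Q.image_eq
  exact hz' ((heq hz).symm.trans (hzero hz))

/-- The density is positive almost everywhere. -/
theorem IsPullbackDensity.ae_pos (hn : 0 < n) (hw : Q.IsPullbackDensity w) :
    ∀ᵐ ζ ∂Q.σ, 0 < w ζ := by
  obtain ⟨w', hw'm, hww'⟩ := hw.aemeasurable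
  obtain ⟨N, hNm, hN0, hNinv, hN⟩ := Q.exists_invariant_null_set
    (hww'.and (ae_extendFrom_jacobian_ne_zero hn Q))
  -- Off the invariant null set `N` this is the zero set of `w`, written with a Borel
  -- representative. Invariance of `w` makes it saturated, so the measure of its image is given by
  -- the integral of `w` over it, which is zero.
  set B := (Q.Γ \ N) ∩ w' ⁻¹' {0} with hB
  have hBm : MeasurableSet B :=
    (Q.isClosed_Γ.measurableSet.diff hNm).inter (hw'm (measurableSet_singleton 0))
  have hBΓ : B ⊆ Q.Γ := fun ζ hζ => hζ.1.1
  have hBw : ∀ ζ, ζ ∈ B ↔ ζ ∈ Q.Γ \ N ∧ w ζ = 0 := fun ζ => and_congr_right fun h => by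
    rw [(hN ζ h.2).1.1]; rfl
  have hsat : ∀ ζ ∈ Q.Γ, ∀ ξ ∈ B, Q.Φ ζ = Q.Φ ξ → ζ ∈ B := by
    intro ζ hζ ξ hξ h
    obtain ⟨τ, hτ, rfl⟩ := (hN ξ hξ.1.2).2 ζ hζ h
    rw [hBw] at hξ ⊢
    exact ⟨⟨hζ, fun h' => hξ.1.2 ((hNinv τ hτ ξ).mp h')⟩, by
      rw [hw.invariant τ hτ ξ hξ.1.1, hξ.2]⟩
  have h1 := hw.measure_image_eq hBm hBΓ hsat
  have h2 : ∫⁻ ζ in B, ENNReal.ofReal (w ζ) ∂Q.σ = 0 := by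
    rw [setLIntegral_congr_fun hBm (g := fun _ => 0)]
    · simp
    · intro ζ hζ
      simp [((hBw ζ).mp hζ).2]
  rw [h2, mul_zero] at h1
  -- On `B` the extended Jacobian is nonzero, so `Φ` is antilipschitz at each point and the null
  -- image forces `B` to be null.
  have h3 : Measure.euclideanHausdorffMeasure Q.dim B = 0 := by
    refine euclideanHausdorffMeasure_eq_zero_of_antilipschitz_at (fun x hx => ?_) h1
    have hxc : x ∈ closure Q.X := Q.Γ_subset_closure hx.1.1
    obtain ⟨M, hM, hM'⟩ := exists_tendsto_fderiv_boundary Q.isOpen_X Q.holomorphic hxc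
      ((Q.smooth x hxc).of_le (by exact_mod_cast le_top))
    have hdet : M.det ≠ 0 := by
      rw [← extendFrom_eq (f := jacobian Q.Φ) hxc
        ((ContinuousLinearMap.continuous_det.tendsto M).comp hM)]
      exact (hN x hx.1.2).1.2
    obtain ⟨k, hk⟩ := exists_antilipschitz_at hdet hM'
    exact ⟨k, fun y hy => hk y (Q.Γ_subset_closure hy.1.1)⟩
  have h4 : ∀ᵐ ζ ∂Q.σ, ζ ∉ B := by
    rw [ae_iff]
    simp only [not_not]
    exact nonpos_iff_eq_zero.mp ((Measure.restrict_apply_le _ _).trans h3.le)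
  have h5 : ∀ᵐ ζ ∂Q.σ, ζ ∉ N := by rw [ae_iff]; simpa using hN0
  filter_upwards [h4, h5, Q.ae_mem_Γ] with ζ h6 h7 h8
  refine lt_of_le_of_ne (hw.nonneg ζ h8) fun h => h6 ?_
  rw [hBw]
  exact ⟨⟨h8, h7⟩, h.symm⟩

end QuotientQuadruple

end

/-! ### Change of variables and the lift to the boundary of the model domain. -/

noncomputable section

namespace QuotientQuadruple

variable {n : ℕ} {Q : QuotientQuadruple n} {w : EuclideanSpace ℂ (Fin n) → ℝ}
  {g : EuclideanSpace ℂ (Fin n) → ℂ}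

theorem aemeasurable_Φ (Q : QuotientQuadruple n) : AEMeasurable Q.Φ Q.σ :=
  Q.continuousOn_Φ_Γ.aemeasurable Q.isClosed_Γ.measurableSet

theorem card_ne_zero (Q : QuotientQuadruple n) : (Nat.card Q.G : ℝ≥0∞) ≠ 0 := by
  have := Q.finite_G
  exact_mod_cast Nat.card_pos.ne'

theorem measurable_indicator_Φ (Q : QuotientQuadruple n) : Measurable (Q.Γ.indicator Q.Φ) := by
  classical
  rw [← Set.piecewise_eq_indicator]
  exact Q.continuousOn_Φ_Γ.measurable_piecewise continuousOn_const Q.isClosed_Γ.measurableSet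

/-- The defining property of `w` read as an identity of measures. Extension of `Φ` by zero off `Γ`
makes the map Borel on the whole space. -/
theorem IsPullbackDensity.m_eq_map (hw : Q.IsPullbackDensity w) :
    Q.m = (Nat.card Q.G : ℝ≥0∞)⁻¹ •
      (Q.σ.withDensity fun ζ => ENNReal.ofReal (w ζ)).map (Q.Γ.indicator Q.Φ) := by
  ext E hE
  have hΩ := Q.isCompact_ΓΩ.isClosed.measurableSet
  have hpre : MeasurableSet (Q.Γ.indicator Q.Φ ⁻¹' E) := Q.measurable_indicator_Φ hE
  rw [m, Measure.restrict_apply hE, ← hw.change _ inter_subset_right (hE.inter hΩ),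
    Measure.smul_apply, smul_eq_mul, Measure.map_apply Q.measurable_indicator_Φ hE,
    withDensity_apply _ hpre, ModelDomain.σ, Measure.restrict_restrict hpre]
  congr 3
  ext ζ
  constructor
  · rintro ⟨h1, h2, -⟩
    exact ⟨by rwa [mem_preimage, indicator_of_mem h1], h1⟩
  · rintro ⟨h1, h2⟩
    rw [mem_preimage, indicator_of_mem h2] at h1
    exact ⟨h2, h1, mem_image_of_mem _ h2⟩

/-- The change of variables formula for `Φ : Γ → Γ_Ω`. -/
theorem IsPullbackDensity.lintegral_m_eq (hw : Q.IsPullbackDensity w)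
    {h : EuclideanSpace ℂ (Fin n) → ℝ≥0∞} (hh : Measurable h) :
    ∫⁻ η, h η ∂Q.m =
      (Nat.card Q.G : ℝ≥0∞)⁻¹ * ∫⁻ ζ, ENNReal.ofReal (w ζ) * h (Q.Φ ζ) ∂Q.σ := by
  have hm : Measurable fun ζ => h (Q.Γ.indicator Q.Φ ζ) := hh.comp Q.measurable_indicator_Φ
  rw [hw.m_eq_map, lintegral_smul_measure, lintegral_map hh Q.measurable_indicator_Φ,
    lintegral_withDensity_eq_lintegral_mul₀ hw.aemeasurable.ennreal_ofReal hm.aemeasurable,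
    smul_eq_mul]
  congr 1
  refine lintegral_congr_ae ?_
  filter_upwards [Q.ae_mem_Γ] with ζ hζ
  simp only [Pi.mul_apply, indicator_of_mem hζ]

/-- Over a null set of `Γ_Ω` the integral of `w` vanishes, and positivity of `w` makes the preimage
null. In particular composition with `Φ` respects equality almost everywhere. -/
theorem IsPullbackDensity.ae_comp_of_ae_m (hn : 0 < n) (hw : Q.IsPullbackDensity w)
    {p : EuclideanSpace ℂ (Fin n) → Prop} (hp : ∀ᵐ η ∂Q.m, p η) : ∀ᵐ ζ ∂Q.σ, p (Q.Φ ζ) := by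
  obtain ⟨E, hE, hEm, hE0⟩ := exists_measurable_superset_of_null (ae_iff.mp hp)
  have h1 := hw.lintegral_m_eq (h := E.indicator 1) (measurable_one.indicator hEm)
  rw [lintegral_indicator_one hEm, hE0] at h1
  have h2 := (mul_eq_zero.mp h1.symm).resolve_left Q.card_inv_ne_zero
  have hm : AEMeasurable (fun ζ => ENNReal.ofReal (w ζ) *
      E.indicator (1 : EuclideanSpace ℂ (Fin n) → ℝ≥0∞) (Q.Φ ζ)) Q.σ :=
    hw.aemeasurable.ennreal_ofReal.mul
      ((measurable_one.indicator hEm).comp_aemeasurable Q.aemeasurable_Φ)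
  rw [lintegral_eq_zero_iff' hm] at h2
  filter_upwards [h2, hw.ae_pos hn] with ζ h3 h4
  by_contra hcon
  have h5 : Q.Φ ζ ∈ E := hE hcon
  simp [h5] at h3
  linarith

/-- The exceptional set is enlarged to an invariant null set that contains all points whose fiber is
not an orbit. Its part in `Γ` is saturated, and so has a null image. -/
theorem IsPullbackDensity.ae_m_of_ae (hw : Q.IsPullbackDensity w)
    {p : EuclideanSpace ℂ (Fin n) → Prop} (hp : ∀ᵐ ζ ∂Q.σ, p ζ) :
    ∀ᵐ η ∂Q.m, ∀ ξ ∈ Q.Γ, Q.Φ ξ = η → p ξ := by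
  obtain ⟨N, hNm, hN0, hNinv, hN⟩ := Q.exists_invariant_null_set hp
  have h1 := hw.measure_image_eq (A := Q.Γ ∩ N) (Q.isClosed_Γ.measurableSet.inter hNm)
    inter_subset_left (by
      intro ζ hζ ξ hξ h
      refine ⟨hζ, ?_⟩
      by_contra hcon
      obtain ⟨τ, hτ, rfl⟩ := (hN ζ hcon).2 ξ hξ.1 h.symm
      exact hcon ((hNinv τ hτ ζ).mp hξ.2))
  rw [setLIntegral_measure_zero _ _ (measure_mono_null inter_subset_right hN0), mul_zero] at h1
  have h2 : ∀ᵐ η ∂Q.m, η ∉ Q.Φ '' (Q.Γ ∩ N) := by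
    rw [ae_iff]
    simp only [not_not]
    exact nonpos_iff_eq_zero.mp ((Measure.restrict_apply_le _ _).trans h1.le)
  filter_upwards [h2] with η hη ξ hξ hξη
  refine (hN ξ fun h => hη ⟨ξ, ⟨hξ, h⟩, hξη⟩).1

theorem Φ_apply_eq_of_mem_X (Q : QuotientQuadruple n)
    {τ : EuclideanSpace ℂ (Fin n) ≃ₗᵢ[ℂ] EuclideanSpace ℂ (Fin n)} (hτ : τ ∈ Q.G)
    {z : EuclideanSpace ℂ (Fin n)} (hz : z ∈ Q.X) : Q.Φ (τ z) = Q.Φ z :=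
  (Q.fiber z hz _ (Q.maps_X τ hτ hz)).mpr ⟨τ, hτ, rfl⟩

theorem tendsto_Φ_radial (Q : QuotientQuadruple n) {ζ : EuclideanSpace ℂ (Fin n)} (hζ : ζ ∈ Q.Γ) :
    Tendsto (fun r : ℝ => Q.Φ (r • ζ)) (𝓝[<] 1) (𝓝 (Q.Φ ζ)) := by
  have h1 : Tendsto (fun r : ℝ => r • ζ) (𝓝[<] 1) (𝓝[closure Q.X] ζ) := by
    refine tendsto_nhdsWithin_iff.mpr ⟨?_, ?_⟩
    · have : Tendsto (fun r : ℝ => r • ζ) (𝓝 1) (𝓝 ((1 : ℝ) • ζ)) :=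
        (by fun_prop : Continuous fun r : ℝ => r • ζ).tendsto 1
      rw [one_smul] at this
      exact this.mono_left nhdsWithin_le_nhds
    · filter_upwards [eventually_mem_Ioo_one one_pos] with r hr
      exact subset_closure (Q.smul_mem hr hζ)
  exact (Q.continuousOn_Φ ζ (Q.Γ_subset_closure hζ)).tendsto.comp h1

/-- By linearity of `τ` the interior identity holds along radii; continuity of `Φ` carries it to the
boundary. -/
theorem Φ_apply_eq_of_mem_Γ (Q : QuotientQuadruple n)
    {τ : EuclideanSpace ℂ (Fin n) ≃ₗᵢ[ℂ] EuclideanSpace ℂ (Fin n)} (hτ : τ ∈ Q.G)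
    {ζ : EuclideanSpace ℂ (Fin n)} (hζ : ζ ∈ Q.Γ) : Q.Φ (τ ζ) = Q.Φ ζ := by
  refine tendsto_nhds_unique (Q.tendsto_Φ_radial ((Q.mem_Γ_iff hτ).mpr hζ))
    ((Q.tendsto_Φ_radial hζ).congr' ?_)
  filter_upwards [eventually_mem_Ioo_one one_pos] with r hr
  have : r • τ ζ = τ (r • ζ) := (map_real_smul τ τ.continuous r ζ).symm
  rw [this, Q.Φ_apply_eq_of_mem_X hτ (Q.smul_mem hr hζ)]

/-- Near `r = 1` the two radial functions coincide, so the values of `limUnder` agree even at points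
where no limit exists. -/
theorem IsAdmissible.radialLimit_apply (hg : Q.IsAdmissible w g)
    {τ : EuclideanSpace ℂ (Fin n) ≃ₗᵢ[ℂ] EuclideanSpace ℂ (Fin n)} (hτ : τ ∈ Q.G)
    {ζ : EuclideanSpace ℂ (Fin n)} (hζ : ζ ∈ Q.Γ) : radialLimit g (τ ζ) = radialLimit g ζ := by
  unfold radialLimit limUnder
  congr 1
  refine Filter.map_congr ?_
  filter_upwards [eventually_mem_Ioo_one one_pos] with r hr
  have : r • τ ζ = τ (r • ζ) := (map_real_smul τ τ.continuous r ζ).symm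
  rw [this, hg.invariant τ hτ _ (Q.smul_mem hr hζ)]

theorem IsAdmissible.aestronglyMeasurable (hg : Q.IsAdmissible w g) :
    AEStronglyMeasurable (radialLimit g) Q.σ := by
  refine aestronglyMeasurable_of_tendsto_ae atTop (f := fun k ζ => g (radii k • ζ))
    (fun k => (Q.measurable_dilate hg.holomorphic.continuousOn
      (radii_mem k)).aestronglyMeasurable) ?_
  filter_upwards [hg.boundary] with ζ hζ using hζ.1.comp tendsto_radii

theorem IsAdmissible.ae_enorm_sq (hg : Q.IsAdmissible w g) :
    ∀ᵐ ζ ∂Q.σ, ‖radialLimit g ζ‖ₑ ^ 2 = ENNReal.ofReal (w ζ) := by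
  filter_upwards [hg.boundary] with ζ hζ
  rw [← hζ.2, ENNReal.ofReal_pow (norm_nonneg _), ofReal_norm]

theorem IsAdmissible.ae_ne_zero (hn : 0 < n) (hw : Q.IsPullbackDensity w)
    (hg : Q.IsAdmissible w g) : ∀ᵐ ζ ∂Q.σ, radialLimit g ζ ≠ 0 := by
  filter_upwards [hg.boundary, hw.ae_pos hn] with ζ hζ h1 h2
  rw [h2, norm_zero] at hζ
  norm_num at hζ
  linarith [hζ.2]

/-- The weight `|g*|² = w` cancels against the density in the change of variables, leaving the
factor `|G|`. -/
theorem lintegral_lift (hw : Q.IsPullbackDensity w) (hg : Q.IsAdmissible w g)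
    {f : EuclideanSpace ℂ (Fin n) → ℂ} (hf : Measurable f) :
    ∫⁻ ζ, ‖radialLimit g ζ * f (Q.Φ ζ)‖ₑ ^ 2 ∂Q.σ = Nat.card Q.G * ∫⁻ η, ‖f η‖ₑ ^ 2 ∂Q.m := by
  rw [hw.lintegral_m_eq (hf.enorm.pow_const 2), ← mul_assoc,
    ENNReal.mul_inv_cancel Q.card_ne_zero (ENNReal.natCast_ne_top _), one_mul]
  refine lintegral_congr_ae ?_
  filter_upwards [hg.ae_enorm_sq] with ζ hζ
  rw [enorm_mul, mul_pow, hζ]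

theorem memLp_two_of_lintegral_lt_top {α : Type*} [MeasurableSpace α] {μ : Measure α} {f : α → ℂ}
    (hf : AEStronglyMeasurable f μ) (h : ∫⁻ x, ‖f x‖ₑ ^ 2 ∂μ < ⊤) : MemLp f 2 μ := by
  refine ⟨hf, ?_⟩
  rw [eLpNorm_eq_lintegral_rpow_enorm_toReal two_ne_zero ENNReal.ofNat_ne_top]
  simp only [ENNReal.toReal_ofNat, ENNReal.rpow_ofNat]
  exact ENNReal.rpow_lt_top_of_nonneg (by norm_num) h.ne

theorem memLp_lift (hw : Q.IsPullbackDensity w) (hg : Q.IsAdmissible w g) (f : Lp ℂ 2 Q.m) :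
    MemLp (fun ζ => radialLimit g ζ * f (Q.Φ ζ)) 2 Q.σ := by
  have hfm := (Lp.stronglyMeasurable f).measurable
  refine memLp_two_of_lintegral_lt_top (hg.aestronglyMeasurable.mul
    (hfm.comp_aemeasurable Q.aemeasurable_Φ).aestronglyMeasurable) ?_
  rw [lintegral_lift hw hg hfm, ← Lp.enorm_sq_eq]
  exact ENNReal.mul_lt_top (ENNReal.natCast_lt_top _) (by simp)

/-- The lift `f ↦ g* · (f ∘ Φ)` of functions on `Γ_Ω` to functions on `Γ`. -/
def lift (hn : 0 < n) (hw : Q.IsPullbackDensity w) (hg : Q.IsAdmissible w g) :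
    Lp ℂ 2 Q.m →ₗ[ℂ] Lp ℂ 2 Q.σ where
  toFun f := (memLp_lift hw hg f).toLp _
  map_add' f h := by
    refine Lp.ext ?_
    filter_upwards [(memLp_lift hw hg (f + h)).coeFn_toLp, (memLp_lift hw hg f).coeFn_toLp,
      (memLp_lift hw hg h).coeFn_toLp, Lp.coeFn_add ((memLp_lift hw hg f).toLp _)
      ((memLp_lift hw hg h).toLp _), hw.ae_comp_of_ae_m hn (Lp.coeFn_add f h)]
      with ζ h1 h2 h3 h4 h5
    rw [h1, h4, Pi.add_apply, h2, h3, h5, Pi.add_apply, mul_add]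
  map_smul' c f := by
    refine Lp.ext ?_
    filter_upwards [(memLp_lift hw hg (c • f)).coeFn_toLp, (memLp_lift hw hg f).coeFn_toLp,
      Lp.coeFn_smul c ((memLp_lift hw hg f).toLp _),
      hw.ae_comp_of_ae_m hn (Lp.coeFn_smul c f)] with ζ h1 h2 h3 h4
    rw [h1, RingHom.id_apply, h3, Pi.smul_apply, h2, h4, Pi.smul_apply, smul_eq_mul, smul_eq_mul]
    ring

theorem lift_coeFn (hn : 0 < n) (hw : Q.IsPullbackDensity w) (hg : Q.IsAdmissible w g)
    (f : Lp ℂ 2 Q.m) : ∀ᵐ ζ ∂Q.σ, lift hn hw hg f ζ = radialLimit g ζ * f (Q.Φ ζ) :=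
  (memLp_lift hw hg f).coeFn_toLp

theorem norm_sq_lift (hn : 0 < n) (hw : Q.IsPullbackDensity w) (hg : Q.IsAdmissible w g)
    (f : Lp ℂ 2 Q.m) : ‖lift hn hw hg f‖ ^ 2 = Nat.card Q.G * ‖f‖ ^ 2 := by
  have h1 : ‖lift hn hw hg f‖ₑ ^ 2 = Nat.card Q.G * ‖f‖ₑ ^ 2 := by
    rw [Lp.enorm_sq_eq, Lp.enorm_sq_eq,
      ← lintegral_lift hw hg (Lp.stronglyMeasurable f).measurable]
    refine lintegral_congr_ae ?_
    filter_upwards [lift_coeFn hn hw hg f] with ζ hζ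
    rw [hζ]
  have h2 := congrArg ENNReal.toReal h1
  simpa using h2

/-- Polarization of the norm identity. -/
theorem inner_lift (hn : 0 < n) (hw : Q.IsPullbackDensity w) (hg : Q.IsAdmissible w g)
    (f h : Lp ℂ 2 Q.m) :
    inner ℂ (lift hn hw hg f) (lift hn hw hg h) = (Nat.card Q.G : ℂ) * inner ℂ f h := by
  have hc : ∀ u : Lp ℂ 2 Q.m,
      ((‖lift hn hw hg u‖ : ℂ)) ^ 2 = (Nat.card Q.G : ℂ) * (‖u‖ : ℂ) ^ 2 := fun u => by
    exact_mod_cast norm_sq_lift hn hw hg u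
  rw [inner_eq_sum_norm_sq_div_four, inner_eq_sum_norm_sq_div_four, ← map_smul, ← map_add,
    ← map_sub, ← map_sub, ← map_add]
  simp only [Complex.coe_algebraMap, hc]
  ring

theorem continuous_lift (hn : 0 < n) (hw : Q.IsPullbackDensity w) (hg : Q.IsAdmissible w g) :
    Continuous (lift hn hw hg) := by
  refine AddMonoidHomClass.continuous_of_bound (lift hn hw hg) (Real.sqrt (Nat.card Q.G))
    fun f => ?_
  refine le_of_pow_le_pow_left₀ two_ne_zero (by positivity) (le_of_eq ?_)
  rw [norm_sq_lift, mul_pow, Real.sq_sqrt (Nat.cast_nonneg _)]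

/-- Square integrable `G`-invariant functions on `Γ` are lifts. -/
theorem exists_lift_eq (hn : 0 < n) (hw : Q.IsPullbackDensity w) (hg : Q.IsAdmissible w g)
    (p : Lp ℂ 2 Q.σ) (hp : ∀ τ ∈ Q.G, ∀ᵐ ζ ∂Q.σ, p (τ ζ) = p ζ) : ∃ u, lift hn hw hg u = p := by
  have hfin := Q.finite_G
  have hcount : Countable Q.G := Finite.to_countable
  set gm := hg.aestronglyMeasurable.mk (radialLimit g) with hgm
  have hgmm : Measurable gm := hg.aestronglyMeasurable.stronglyMeasurable_mk.measurable
  have hpm : Measurable p := (Lp.stronglyMeasurable p).measurable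
  have hp' : ∀ᵐ ζ ∂Q.σ, ∀ τ : Q.G, p (τ.1 ζ) = p ζ := by
    rw [ae_all_iff]; exact fun τ => hp τ.1 τ.2
  have hgmae : ∀ᵐ ζ ∂Q.σ, ∀ τ : Q.G, radialLimit g (τ.1 ζ) = gm (τ.1 ζ) := by
    rw [ae_all_iff]
    exact fun τ => (Q.measurePreserving_of_mem τ.2).quasiMeasurePreserving.ae
      hg.aestronglyMeasurable.ae_eq_mk
  obtain ⟨N, hNm, hN0, hNinv, hN⟩ := Q.exists_invariant_null_set
    ((hp'.and hgmae).and (hg.ae_ne_zero hn hw))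
  -- The quotient of Borel representatives, set to zero on the invariant set `N`, is constant on
  -- every fiber of `Φ` in `Γ`, not merely on almost every one, and therefore descends.
  set q : EuclideanSpace ℂ (Fin n) → ℂ := Nᶜ.indicator fun ζ => p ζ / gm ζ with hq
  have hqm : Measurable q := (hpm.div hgmm).indicator hNm.compl
  have hsat : ∀ ζ ∈ Q.Γ, ∀ ξ ∈ Q.Γ, Q.Φ ζ = Q.Φ ξ → q ζ = q ξ := by
    have key : ∀ ζ ∈ Q.Γ, ∀ ξ ∈ Q.Γ, Q.Φ ζ = Q.Φ ξ → ζ ∉ N → q ζ = q ξ := by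
      intro ζ hζ ξ hξ h hζN
      obtain ⟨τ, hτ, rfl⟩ := (hN ζ hζN).2 ξ hξ h.symm
      have hτN : τ ζ ∉ N := fun h' => hζN ((hNinv τ hτ ζ).mp h')
      have h1 := (hN ζ hζN).1.1
      have h2 : gm (τ ζ) = gm ζ := by
        have h3 := h1.2 ⟨τ, hτ⟩
        have h4 := h1.2 1
        change radialLimit g (τ ζ) = gm (τ ζ) at h3
        change radialLimit g ζ = gm ζ at h4
        rw [← h3, ← h4, hg.radialLimit_apply hτ hζ]
      have h5 : p (τ ζ) = p ζ := h1.1 ⟨τ, hτ⟩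
      rw [hq, indicator_of_mem (show ζ ∈ Nᶜ from hζN), indicator_of_mem (show τ ζ ∈ Nᶜ from hτN),
        h2, h5]
    intro ζ hζ ξ hξ h
    by_cases hζN : ζ ∈ N
    · by_cases hξN : ξ ∈ N
      · rw [hq, indicator_of_notMem (show ζ ∉ Nᶜ from fun h' => h' hζN),
          indicator_of_notMem (show ξ ∉ Nᶜ from fun h' => h' hξN)]
      · exact (key ξ hξ ζ hζ h.symm hξN).symm
    · exact key ζ hζ ξ hξ h hζN
  -- The section is an arbitrary choice and need not be measurable. Measurability of `v` follows
  -- from that of its composition with the boundary map, a measurable surjection from a Polish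
  -- space.
  set v : Q.ΓΩ → ℂ := fun η => q (Function.surjInv Q.surjective_boundaryMap η).1 with hv
  have hvq : v ∘ Q.boundaryMap = fun ζ : Q.Γ => q ζ := by
    ext ζ
    refine hsat _ (Subtype.coe_prop _) _ ζ.2 ?_
    have := Function.surjInv_eq Q.surjective_boundaryMap (Q.boundaryMap ζ)
    exact congrArg Subtype.val this
  have hvm : Measurable v := by
    have hpol : PolishSpace Q.Γ := Q.isClosed_Γ.polishSpace
    rw [← Q.measurable_boundaryMap.measurable_comp_iff_of_surjective Q.surjective_boundaryMap, hvq]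
    exact hqm.comp measurable_subtype_coe
  set u : EuclideanSpace ℂ (Fin n) → ℂ := Function.extend Subtype.val v 0 with hu
  have hum : Measurable u :=
    (MeasurableEmbedding.subtype_coe Q.isCompact_ΓΩ.isClosed.measurableSet).measurable_extend hvm
      measurable_zero
  have huΦ : ∀ ζ ∈ Q.Γ, u (Q.Φ ζ) = q ζ := fun ζ hζ => by
    have h1 : u (Q.boundaryMap ⟨ζ, hζ⟩).1 = v (Q.boundaryMap ⟨ζ, hζ⟩) :=
      Subtype.val_injective.extend_apply _ _ _
    exact h1.trans (congrFun hvq ⟨ζ, hζ⟩)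
  have hNae : ∀ᵐ ζ ∂Q.σ, ζ ∉ N := by rw [ae_iff]; simpa using hN0
  have hfinal : ∀ᵐ ζ ∂Q.σ, radialLimit g ζ * u (Q.Φ ζ) = p ζ := by
    filter_upwards [hNae, Q.ae_mem_Γ] with ζ h1 h2
    have h3 := (hN ζ h1).1
    have h4 : radialLimit g ζ = gm ζ := h3.1.2 1
    rw [huΦ ζ h2, hq, indicator_of_mem (show ζ ∈ Nᶜ from h1), ← h4, mul_div_cancel₀ _ h3.2]
  have humem : MemLp u 2 Q.m := by
    refine memLp_two_of_lintegral_lt_top hum.aestronglyMeasurable ?_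
    have h1 := lintegral_lift hw hg hum
    have h2 : ∫⁻ ζ, ‖radialLimit g ζ * u (Q.Φ ζ)‖ₑ ^ 2 ∂Q.σ = ‖p‖ₑ ^ 2 := by
      rw [Lp.enorm_sq_eq]
      refine lintegral_congr_ae ?_
      filter_upwards [hfinal] with ζ hζ
      rw [hζ]
    rw [h2] at h1
    by_contra hcon
    rw [not_lt, top_le_iff] at hcon
    rw [hcon, ENNReal.mul_top Q.card_ne_zero] at h1
    exact ENNReal.pow_ne_top enorm_ne_top h1
  refine ⟨humem.toLp u, Lp.ext ?_⟩
  filter_upwards [lift_coeFn hn hw hg (humem.toLp u), hfinal,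
    hw.ae_comp_of_ae_m hn humem.coeFn_toLp] with ζ h1 h2 h3
  rw [h1, h3, h2]

end QuotientQuadruple

end

/-! ### Correspondence of the Hardy spaces and of the Szegő projections. -/

noncomputable section

namespace QuotientQuadruple

variable {n : ℕ} {Q : QuotientQuadruple n} {w : EuclideanSpace ℂ (Fin n) → ℝ}
  {g : EuclideanSpace ℂ (Fin n) → ℂ}
  {τ : EuclideanSpace ℂ (Fin n) ≃ₗᵢ[ℂ] EuclideanSpace ℂ (Fin n)}

/-- Chain rule for `Φ = Φ ∘ τ` near `z`. -/
theorem jacobian_eq_zero_of_apply (hτ : τ ∈ Q.G) {z : EuclideanSpace ℂ (Fin n)} (hz : z ∈ Q.X)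
    (h : jacobian Q.Φ (τ z) = 0) : jacobian Q.Φ z = 0 := by
  have h1 : Q.Φ =ᶠ[𝓝 z] fun y => Q.Φ (τ y) := by
    filter_upwards [Q.isOpen_X.mem_nhds hz] with y hy using (Q.Φ_apply_eq_of_mem_X hτ hy).symm
  have h2 : HasFDerivAt Q.Φ (fderiv ℂ Q.Φ (τ z)) (τ z) :=
    ((Q.holomorphic _ (Q.maps_X τ hτ hz)).differentiableAt
      (Q.isOpen_X.mem_nhds (Q.maps_X τ hτ hz))).hasFDerivAt
  have h3 := h2.comp z τ.toContinuousLinearEquiv.hasFDerivAt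
  have h4 : fderiv ℂ Q.Φ z = _ := h1.fderiv_eq.trans h3.fderiv
  rw [jacobian, h4]
  rw [ContinuousLinearMap.det, ContinuousLinearMap.toLinearMap_comp, LinearMap.det_comp]
  exact mul_eq_zero_of_left h _

/-- A function on `Ω` is holomorphic when its pullback to `X` is. -/
theorem differentiableOn_of_comp_Φ {f : EuclideanSpace ℂ (Fin n) → ℂ}
    (hf : DifferentiableOn ℂ (fun z => f (Q.Φ z)) Q.X) : DifferentiableOn ℂ f Q.Ω := by
  classical
  have := Q.finite_G
  have := Fintype.ofFinite Q.G
  have hJ := DifferentiableOn.jacobian Q.isOpen_X Q.holomorphic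
  have hD : ∀ z ∈ Q.X, ∏ τ : Q.G, jacobian Q.Φ (τ.1 (Function.invFunOn Q.Φ Q.X (Q.Φ z))) ^ 4 =
      ∏ τ : Q.G, jacobian Q.Φ (τ.1 z) ^ 4 := by
    intro z hz
    have hex : ∃ a ∈ Q.X, Q.Φ a = Q.Φ z := ⟨z, hz, rfl⟩
    obtain ⟨τ₀, hτ₀, he⟩ := (Q.fiber z hz _ (Function.invFunOn_mem hex)).mp
      (Function.invFunOn_eq hex)
    refine Fintype.prod_bijective (fun τ : Q.G => τ * ⟨τ₀, hτ₀⟩) (Group.mulRight_bijective _) _ _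
      fun τ => ?_
    have h1 : (τ * ⟨τ₀, hτ₀⟩ : Q.G).1 z = τ.1 (τ₀ z) := rfl
    rw [← he, h1]
  -- The product over the orbit is invariant and thus a function on `Ω`. The factor of the identity
  -- is the required fourth power of the Jacobian, and the other factors form a holomorphic function
  -- on `X`.
  refine differentiableOn_of_comp_proper (Φ := Q.Φ)
    (D := fun y => ∏ τ : Q.G, jacobian Q.Φ (τ.1 (Function.invFunOn Q.Φ Q.X y)) ^ 4)
    (h := fun z => ∏ τ ∈ Finset.univ.erase (1 : Q.G), jacobian Q.Φ (τ.1 z) ^ 4)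
    Q.isOpen_X Q.isOpen_Ω Q.holomorphic Q.proper Q.image_eq ?_ ?_ ?_ ?_ hf
  · intro x hx x' hx' h h0
    obtain ⟨τ, hτ, rfl⟩ := (Q.fiber x' hx' x hx).mp h
    exact jacobian_eq_zero_of_apply hτ hx' h0
  · have h1 : ∀ τ : Q.G, DifferentiableOn ℂ (fun z => jacobian Q.Φ (τ.1 z) ^ 4) Q.X := fun τ =>
      (hJ.comp τ.1.differentiable.differentiableOn (Q.maps_X τ.1 τ.2)).pow 4
    exact fun x hx => (HasFDerivWithinAt.finsetProd (u := Finset.univ.erase (1 : Q.G))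
      fun τ _ => (h1 τ x hx).hasFDerivWithinAt).differentiableWithinAt.congr
        (fun y _ => by simp) (by simp)
  · intro z hz
    rw [hD z hz, ← Finset.mul_prod_erase _ _ (Finset.mem_univ (1 : Q.G))]
    rfl
  · intro z hz h0
    rw [hD z hz]
    exact Finset.prod_ne_zero_iff.mpr fun τ _ => pow_ne_zero 4 fun h1 =>
      h0 (jacobian_eq_zero_of_apply τ.2 hz h1)

theorem smul_apply_comm (τ : EuclideanSpace ℂ (Fin n) ≃ₗᵢ[ℂ] EuclideanSpace ℂ (Fin n)) (r : ℝ)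
    (ζ : EuclideanSpace ℂ (Fin n)) : r • τ ζ = τ (r • ζ) :=
  (map_real_smul τ τ.continuous r ζ).symm

/-- The action of `τ ∈ G` on `L²(Γ)`. -/
def translate (hτ : τ ∈ Q.G) : Lp ℂ 2 Q.σ →ₗᵢ[ℂ] Lp ℂ 2 Q.σ :=
  Lp.compMeasurePreservingₗᵢ ℂ τ (Q.measurePreserving_of_mem hτ)

theorem translate_coeFn (hτ : τ ∈ Q.G) (u : Lp ℂ 2 Q.σ) :
    ∀ᵐ ζ ∂Q.σ, translate hτ u ζ = u (τ ζ) :=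
  Lp.coeFn_compMeasurePreserving u (Q.measurePreserving_of_mem hτ)

theorem translate_translate_inv (hτ : τ ∈ Q.G) (u : Lp ℂ 2 Q.σ) :
    translate hτ (translate (Q.G.inv_mem hτ) u) = u := by
  refine Lp.ext ?_
  filter_upwards [translate_coeFn hτ (translate (Q.G.inv_mem hτ) u),
    (Q.measurePreserving_of_mem hτ).quasiMeasurePreserving.ae
      (translate_coeFn (Q.G.inv_mem hτ) u)] with ζ h1 h2
  rw [h1, h2]
  exact congrArg u (τ.symm_apply_apply ζ)

theorem isHardyExtension_translate (hτ : τ ∈ Q.G) {u : Lp ℂ 2 Q.σ}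
    {F : EuclideanSpace ℂ (Fin n) → ℂ} (h : Q.IsHardyExtension u F) :
    Q.IsHardyExtension (translate hτ u) fun z => F (τ z) := by
  refine ⟨⟨h.1.1.comp τ.differentiable.differentiableOn (Q.maps_X τ hτ), ?_⟩, ?_⟩
  · refine lt_of_le_of_lt (iSup₂_le fun r hr => ?_) h.1.2
    have h1 := (Q.measurePreserving_of_mem hτ).lintegral_comp
      (Q.measurable_dilate_enorm_sq h.1.1.continuousOn r)
    rw [Q.lintegral_indicator_dilate F hr] at h1
    refine le_trans (le_of_eq ?_) (le_iSup₂_of_le r hr h1.le)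
    refine lintegral_congr_ae ?_
    filter_upwards [Q.ae_mem_Γ] with ζ hζ
    rw [smul_apply_comm, indicator_of_mem (Q.maps_X τ hτ (Q.smul_mem hr hζ))]
  · filter_upwards [translate_coeFn hτ u,
      (Q.measurePreserving_of_mem hτ).quasiMeasurePreserving.ae h.2] with ζ h1 h2
    simpa only [h1, smul_apply_comm] using h2

theorem translate_mem_hardySpace (hτ : τ ∈ Q.G) {u : Lp ℂ 2 Q.σ} (hu : u ∈ Q.hardySpace) :
    translate hτ u ∈ Q.hardySpace :=
  let ⟨_, hF⟩ := hu
  ⟨_, isHardyExtension_translate hτ hF⟩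

theorem translate_lift (hn : 0 < n) (hw : Q.IsPullbackDensity w) (hg : Q.IsAdmissible w g)
    (hτ : τ ∈ Q.G) (f : Lp ℂ 2 Q.m) :
    translate hτ (lift hn hw hg f) = lift hn hw hg f := by
  refine Lp.ext ?_
  filter_upwards [translate_coeFn hτ (lift hn hw hg f), lift_coeFn hn hw hg f,
    (Q.measurePreserving_of_mem hτ).quasiMeasurePreserving.ae (lift_coeFn hn hw hg f),
    Q.ae_mem_Γ] with ζ h1 h2 h3 h4
  rw [h1, h2, h3, hg.radialLimit_apply hτ h4, Q.Φ_apply_eq_of_mem_Γ hτ h4]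

/-- The Szegő projection of `X` commutes with the action of `G`. -/
theorem translate_starProjection [Q.hardySpace.HasOrthogonalProjection] (hτ : τ ∈ Q.G)
    {p : Lp ℂ 2 Q.σ} (hp : translate hτ p = p) :
    translate hτ (Q.hardySpace.starProjection p) = Q.hardySpace.starProjection p := by
  refine (Submodule.eq_starProjection_of_mem_of_inner_eq_zero
    (translate_mem_hardySpace hτ (Submodule.starProjection_apply_mem _ p)) fun v hv => ?_).symm
  -- Writing the test vector as a translate moves the orthogonality relation back to the
  -- untranslated projection.
  rw [← translate_translate_inv hτ v]
  nth_rewrite 1 [← hp]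
  rw [← map_sub, LinearIsometry.inner_map_map]
  exact Submodule.starProjection_inner_eq_zero p _
    (translate_mem_hardySpace (Q.G.inv_mem hτ) hv)

/-- The pullback of a function in `H²(Ω)`, multiplied by `g`, is in `H²(X)`. -/
theorem IsHardyExtensionΩ.lift (hn : 0 < n) (hw : Q.IsPullbackDensity w)
    (hg : Q.IsAdmissible w g) {u : Lp ℂ 2 Q.m} {F : EuclideanSpace ℂ (Fin n) → ℂ}
    (h : Q.IsHardyExtensionΩ g u F) :
    Q.IsHardyExtension (lift hn hw hg u) fun z => F (Q.Φ z) * g z := by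
  refine ⟨⟨(h.1.1.comp Q.holomorphic Q.mapsTo).mul hg.holomorphic,
    (Q.hardyNormSqΩ_lt_top_iff g F).mp h.1.2⟩, ?_⟩
  filter_upwards [hw.ae_comp_of_ae_m hn h.2, hg.boundary, lift_coeFn hn hw hg u, Q.ae_mem_Γ]
    with ζ h1 h2 h3 h4
  rw [h3, mul_comm]
  exact (h1 ζ h4 rfl).mul h2.1

/-- If the lift of `u` is in `H²(X)`, then `u` is in `H²(Ω)`. -/
theorem exists_isHardyExtensionΩ (hn : 0 < n) (hw : Q.IsPullbackDensity w)
    (hg : Q.IsAdmissible w g) {u : Lp ℂ 2 Q.m} {H : EuclideanSpace ℂ (Fin n) → ℂ}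
    (h : Q.IsHardyExtension (lift hn hw hg u) H) : ∃ F, Q.IsHardyExtensionΩ g u F := by
  -- The lift is invariant on the boundary, and extensions are unique, so `H` is invariant inside
  -- and `H / g` descends to `Ω`.
  have hinv : ∀ τ ∈ Q.G, ∀ z ∈ Q.X, H (τ z) = H z := fun τ hτ z hz => by
    have h1 := isHardyExtension_translate hτ h
    rw [translate_lift] at h1
    exact h1.eqOn hn h hz
  set F : EuclideanSpace ℂ (Fin n) → ℂ := fun y =>
    H (Function.invFunOn Q.Φ Q.X y) / g (Function.invFunOn Q.Φ Q.X y) with hF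
  have hFΦ : ∀ z ∈ Q.X, F (Q.Φ z) = H z / g z := by
    intro z hz
    have hex : ∃ a ∈ Q.X, Q.Φ a = Q.Φ z := ⟨z, hz, rfl⟩
    obtain ⟨τ, hτ, he⟩ := (Q.fiber z hz _ (Function.invFunOn_mem hex)).mp
      (Function.invFunOn_eq hex)
    simp only [hF]
    rw [← he, hinv τ hτ z hz, hg.invariant τ hτ z hz]
  refine ⟨F, ⟨differentiableOn_of_comp_Φ ((h.1.1.mul (hg.holomorphic.inv hg.ne_zero)).congr
    fun z hz => (hFΦ z hz).trans (div_eq_mul_inv _ _)), ?_⟩, ?_⟩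
  · rw [hardyNormSqΩ_lt_top_iff]
    refine lt_of_le_of_lt (iSup₂_mono fun r hr => le_of_eq (lintegral_congr_ae ?_)) h.1.2
    filter_upwards [Q.ae_mem_Γ] with ζ hζ
    have hrζ := Q.smul_mem hr hζ
    rw [hFΦ _ hrζ, div_mul_cancel₀ _ (hg.ne_zero _ hrζ)]
  · have h1 : ∀ᵐ ζ ∂Q.σ, Tendsto (fun r : ℝ => F (Q.Φ (r • ζ))) (𝓝[<] 1) (𝓝 (u (Q.Φ ζ))) := by
      filter_upwards [h.2, hg.boundary, lift_coeFn hn hw hg u, Q.ae_mem_Γ, hg.ae_ne_zero hn hw]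
        with ζ h1 h2 h3 h4 h5
      have h6 := h1.div h2.1 h5
      rw [h3, mul_div_cancel_left₀ _ h5] at h6
      refine h6.congr' ?_
      filter_upwards [eventually_mem_Ioo_one one_pos] with r hr
      exact (hFΦ _ (Q.smul_mem hr h4)).symm
    filter_upwards [hw.ae_m_of_ae h1] with η h2 ξ hξ hη
    have h3 := h2 ξ hξ hη
    rwa [hη] at h3

/-- Multiplication and division by the zero-free function `g` translate between the two spaces.
Closedness of `H²(Ω)` is thereby inherited from `H²(X)`. -/
theorem hardySpaceΩ_eq_comap (hn : 0 < n) (hw : Q.IsPullbackDensity w)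
    (hg : Q.IsAdmissible w g) : Q.hardySpaceΩ hg = Q.hardySpace.comap (lift hn hw hg) :=
  Submodule.ext fun _ =>
    ⟨fun ⟨_, hF⟩ => ⟨_, hF.lift hn hw hg⟩, fun ⟨_, hH⟩ => exists_isHardyExtensionΩ hn hw hg hH⟩

theorem mem_hardySpaceΩ_iff (hn : 0 < n) (hw : Q.IsPullbackDensity w) (hg : Q.IsAdmissible w g)
    {u : Lp ℂ 2 Q.m} : u ∈ Q.hardySpaceΩ hg ↔ lift hn hw hg u ∈ Q.hardySpace := by
  rw [hardySpaceΩ_eq_comap hn hw hg, Submodule.mem_comap]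

theorem isClosed_hardySpaceΩ (hn : 0 < n) (hw : Q.IsPullbackDensity w) (hg : Q.IsAdmissible w g) :
    IsClosed (Q.hardySpaceΩ hg : Set (Lp ℂ 2 Q.m)) := by
  rw [hardySpaceΩ_eq_comap hn hw hg, Submodule.comap_coe]
  exact (Q.isClosed_hardySpace hn).preimage (continuous_lift hn hw hg)

theorem hasOrthogonalProjection_hardySpaceΩ (hn : 0 < n) (hw : Q.IsPullbackDensity w)
    (hg : Q.IsAdmissible w g) : (Q.hardySpaceΩ hg).HasOrthogonalProjection := by
  have := (isClosed_hardySpaceΩ hn hw hg).completeSpace_coe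
  infer_instance

/-- The Szegő projections commute with the lift. -/
theorem lift_szegoProjectionΩ (hn : 0 < n) (hw : Q.IsPullbackDensity w) (hg : Q.IsAdmissible w g)
    [Q.hardySpace.HasOrthogonalProjection] [(Q.hardySpaceΩ hg).HasOrthogonalProjection]
    (f : Lp ℂ 2 Q.m) : lift hn hw hg (Q.szegoProjectionΩ hg f) =
      Q.szegoProjection (lift hn hw hg f) := by
  -- The projected lift is invariant because the projection commutes with the group; being
  -- invariant, it is itself a lift.
  obtain ⟨v, hv⟩ := exists_lift_eq hn hw hg (Q.szegoProjection (lift hn hw hg f)) (by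
    intro τ hτ
    have h1 := translate_starProjection hτ (translate_lift hn hw hg hτ f)
    have h2 := translate_coeFn hτ (Q.hardySpace.starProjection (lift hn hw hg f))
    rw [h1] at h2
    filter_upwards [h2] with ζ h3 using h3.symm)
  have hmem : v ∈ Q.hardySpaceΩ hg := by
    rw [mem_hardySpaceΩ_iff hn hw hg, hv]
    exact Submodule.starProjection_apply_mem _ _
  have hS : Q.szegoProjectionΩ hg f = v := by
    refine Submodule.eq_starProjection_of_mem_of_inner_eq_zero hmem fun u hu => ?_
    have hcard : (Nat.card Q.G : ℂ) ≠ 0 := by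
      have := Q.finite_G
      exact_mod_cast Nat.card_pos.ne'
    refine (mul_eq_zero.mp ?_).resolve_left hcard
    -- Up to the factor `|G|`, orthogonality of `f - v` to `H²(Ω)` is orthogonality upstairs to
    -- lifts that lie in `H²(X)`.
    rw [← inner_lift hn hw hg, map_sub, hv]
    exact Submodule.starProjection_inner_eq_zero _ _ ((mem_hardySpaceΩ_iff hn hw hg).mp hu)
  rw [hS, hv]

/-- Since `w = g* · conj g*`, the conjugate factor in the denominator cancels and the lift of `f`
appears. -/
theorem szegoKernel_integrand_ae_eq (hn : 0 < n) (hw : Q.IsPullbackDensity w)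
    (hg : Q.IsAdmissible w g) (f : Lp ℂ 2 Q.m) (z : EuclideanSpace ℂ (Fin n)) :
    (fun ζ => Q.szegoKernel z ζ / (g z * conj (radialLimit g ζ)) * f (Q.Φ ζ) * (w ζ : ℂ)) =ᵐ[Q.σ]
      fun ζ => inner ℂ (Q.reproducing z ζ) (lift hn hw hg f ζ) / g z := by
  filter_upwards [lift_coeFn hn hw hg f, hg.boundary, hg.ae_ne_zero hn hw] with ζ h1 h2 h3
  have h4 : (w ζ : ℂ) = radialLimit g ζ * conj (radialLimit g ζ) := by
    rw [Complex.mul_conj', ← h2.2]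
    push_cast
    rfl
  have h5 : conj (radialLimit g ζ) ≠ 0 := (map_ne_zero _).mpr h3
  rw [h1, h4, RCLike.inner_apply, ModelDomain.szegoKernel, div_mul_eq_div_div]
  field_simp

theorem integrable_szegoKernel (hn : 0 < n) (hw : Q.IsPullbackDensity w) (hg : Q.IsAdmissible w g)
    (f : Lp ℂ 2 Q.m) (z : EuclideanSpace ℂ (Fin n)) :
    Integrable (fun ζ => Q.szegoKernel z ζ / (g z * conj (radialLimit g ζ)) * f (Q.Φ ζ) *
      (w ζ : ℂ)) Q.σ :=
  ((L2.integrable_inner (𝕜 := ℂ) (Q.reproducing z) (lift hn hw hg f)).div_const (g z)).congr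
    (szegoKernel_integrand_ae_eq hn hw hg f z).symm

/-- The reproducing element lies in `H²(X)` and is fixed by the self-adjoint projection, so pairing
it with the lift of `f` gives the value at `z` of the projected lift. -/
theorem integral_szegoKernel (hn : 0 < n) (hw : Q.IsPullbackDensity w) (hg : Q.IsAdmissible w g)
    [Q.hardySpace.HasOrthogonalProjection] (f : Lp ℂ 2 Q.m) {H : EuclideanSpace ℂ (Fin n) → ℂ}
    (hH : Q.IsHardyExtension (Q.szegoProjection (lift hn hw hg f)) H)
    {z : EuclideanSpace ℂ (Fin n)} (hz : z ∈ Q.X) :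
    ∫ ζ, Q.szegoKernel z ζ / (g z * conj (radialLimit g ζ)) * f (Q.Φ ζ) * (w ζ : ℂ) ∂Q.σ =
      H z / g z := by
  obtain ⟨hk, hrep⟩ := Q.isReproducing_reproducing hn hz
  rw [integral_congr_ae (szegoKernel_integrand_ae_eq hn hw hg f z), integral_div, hrep _ _ hH,
    ModelDomain.szegoProjection, ← Submodule.inner_starProjection_left_eq_right,
    Submodule.starProjection_eq_self_iff.mpr hk, L2.inner_def]

/-- By uniqueness of extensions `H` equals `g` times the pullback of `F`. Hence `h` takes the value
`F y` at all `|G|` terms of the orbit sum. -/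
theorem eq_pushforward (hn : 0 < n) (hw : Q.IsPullbackDensity w) (hg : Q.IsAdmissible w g)
    [Q.hardySpace.HasOrthogonalProjection] [(Q.hardySpaceΩ hg).HasOrthogonalProjection]
    (f : Lp ℂ 2 Q.m) {F H : EuclideanSpace ℂ (Fin n) → ℂ}
    (hF : Q.IsHardyExtensionΩ g (Q.szegoProjectionΩ hg f) F)
    (hH : Q.IsHardyExtension (Q.szegoProjection (lift hn hw hg f)) H)
    {y : EuclideanSpace ℂ (Fin n)} (hy : y ∈ Q.Ω) {h : EuclideanSpace ℂ (Fin n) → ℂ}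
    (hh : ∀ z ∈ Q.X, h z = H z / g z) :
    F y = (1 / (Nat.card Q.G : ℂ)) * Q.pushforward h y := by
  have hfin := Q.finite_G
  have := Fintype.ofFinite Q.G
  obtain ⟨z, hz, rfl⟩ : y ∈ Q.Φ '' Q.X := Q.image_eq ▸ hy
  have h1 := hF.lift hn hw hg
  rw [lift_szegoProjectionΩ] at h1
  have h2 : ∀ τ : Q.G, h (τ.1 z) = F (Q.Φ z) := fun τ => by
    have hτz := Q.maps_X τ.1 τ.2 hz
    rw [hh _ hτz, ← h1.eqOn hn hH hτz, mul_div_cancel_right₀ _ (hg.ne_zero _ hτz),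
      Q.Φ_apply_eq_of_mem_X τ.2 hz]
  have hcard : (Nat.card Q.G : ℂ) ≠ 0 := by exact_mod_cast Nat.card_pos.ne'
  rw [Q.pushforward_apply _ hz, finsum_congr h2, finsum_eq_sum_of_fintype, Finset.sum_const,
    Finset.card_univ, ← Nat.card_eq_fintype_card, nsmul_eq_mul, ← mul_assoc,
    one_div_mul_cancel hcard, one_mul]

end QuotientQuadruple

end
theorem mainTheorem3 {n : ℕ} (hn : 0 < n) (Q : QuotientQuadruple n)
    (w : EuclideanSpace ℂ (Fin n) → ℝ) (hw : Q.IsPullbackDensity w)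
    (g : EuclideanSpace ℂ (Fin n) → ℂ) (hg : Q.IsAdmissible w g) :
    ∃ (_ : Q.hardySpace.HasOrthogonalProjection)
      (_ : (Q.hardySpaceΩ hg).HasOrthogonalProjection),
      (∀ z ∈ Q.X, Q.IsReproducing z (Q.reproducing z)) ∧
      ∀ f : Lp ℂ 2 Q.m,
        (∀ z ∈ Q.X, Integrable (fun ζ => Q.szegoKernel z ζ / (g z * conj (radialLimit g ζ)) *
          f (Q.Φ ζ) * (w ζ : ℂ)) Q.σ) ∧
        (∀ F, Q.IsHardyExtensionΩ g (Q.szegoProjectionΩ hg f) F → ∀ y ∈ Q.Ω,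
          F y = (1 / (Nat.card Q.G : ℂ)) * Q.pushforward (fun z =>
            ∫ ζ, Q.szegoKernel z ζ / (g z * conj (radialLimit g ζ)) *
              f (Q.Φ ζ) * (w ζ : ℂ) ∂Q.σ) y) ∧
        ∃ hf : MemLp (fun ζ => radialLimit g ζ * f (Q.Φ ζ)) 2 Q.σ,
          ∀ F H, Q.IsHardyExtensionΩ g (Q.szegoProjectionΩ hg f) F →
            Q.IsHardyExtension (Q.szegoProjection (hf.toLp _)) H →
            ∀ y ∈ Q.Ω, F y = (1 / (Nat.card Q.G : ℂ)) * Q.pushforward (fun z => H z / g z) y := by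
  have hX := Q.hasOrthogonalProjection_hardySpace hn
  have hΩ := QuotientQuadruple.hasOrthogonalProjection_hardySpaceΩ hn hw hg
  refine ⟨hX, hΩ, fun z hz => Q.isReproducing_reproducing hn hz, fun f =>
    ⟨fun z _ => QuotientQuadruple.integrable_szegoKernel hn hw hg f z, fun F hF y hy => ?_,
      QuotientQuadruple.memLp_lift hw hg f, fun F H hF hH y hy =>
        -- The class `hf.toLp _` is by definition the lift of `f`.
        QuotientQuadruple.eq_pushforward hn hw hg f hF hH hy fun _ _ => rfl⟩⟩
  obtain ⟨H, hH⟩ : Q.szegoProjection (QuotientQuadruple.lift hn hw hg f) ∈ Q.hardySpace :=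
    Submodule.starProjection_apply_mem _ _
  exact QuotientQuadruple.eq_pushforward hn hw hg f hF hH hy fun z hz =>
    QuotientQuadruple.integral_szegoKernel hn hw hg f hH hz
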